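/- Let $d\ge 1$, let $f:\mathbb R^d\to\mathbb R$ be twice differentiable and bounded below, with $L$-Lipschitz gradient and with Hessian $\rho$-Lipschitz in the spectral norm ($L,\rho>0$). Let $x_{int}\in\mathbb R^d$, $\triangle_f=f(x_{int})-\inf f$, $\epsilon>0$, $\chi\ge 1$, and put $$\eta=\frac1{4L},\quad B=\frac{1}{288\chi^2}\sqrt{\frac{\epsilon}{\rho}},\quad \theta=\frac12\Big(\frac{\epsilon\rho}{L^2}\Big)^{1/4},\quad K=\frac{2\chi}{\theta},\quad r=\min\Big\{\frac B2,\frac{\theta B}{20K},\sqrt{\frac{\theta B^2}{2K}}\Big\},$$ where $\theta<1$ is assumed. Perturbed restarted AGD: start with $x^{-1}=x^0=x_{int}$, $k=0$. While $k<K$: set $y^k=x^k+(1-\theta)(x^k-x^{k-1})$, $x^{k+1}=y^k-\eta\nabla f(y^k)$, $k\leftarrow k+1$; if then $k\sum_{t=0}^{k-1}\|x^{t+1}-x^t\|^2>B^2$, restart with $x^{-1}=x^0=x^k+\xi\,1_{\|\nabla f(y^{k-1})\|\le B/\eta}$, $k=0$, where $\xi$ is a fresh perturbation in the closed ball of radius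 $r$ around $0$. After the loop choose $K_0\in\arg\min_{\lfloor K/2\rfloor\le k\le K-1}\|x^{k+1}-x^k\|$ and output $\hat y=\frac1{K_0+1}\sum_{k=0}^{K_0}y^k$. The run up to the first restart is called the first epoch. There are absolute constants $c,C>0$ such that for all such data the following holds. (i) $r\le C\epsilon/L$. For all perturbations of norm at most $r$, the method terminates after at most $$C\left(\frac{\triangle_f L^{1/2}\rho^{1/4}\chi^6}{\epsilon^{7/4}}+\frac{L^{1/2}\chi}{(\epsilon\rho)^{1/4}}\right)$$ gradient evaluations, and its output satisfies $\|\nabla f(\hat y)\|\le\epsilon$. (The second term is of the order of $K$, the length of the last epoch; it is dominated by the first as soon as $\triangle_f\ge\epsilon^{3/2}/(\sqrt\rho\,\chi^5)$.) (ii) Let $0<\zeta<1$, let $\chi\ge c\,\ell$ with $$\ell=\max\Big\{1,\log\frac{dL\,(1+\triangle_f\sqrt\rho\,\epsilon^{-3/2})}{\zeta\sqrt{\epsilon\rho}}\Big\},$$ and let the perturbations be independent and uniform in the ball of radius $r$. If the first epoch ends in a restart, or if $\lambda_{\min}(\nabla^2 f(x_{int}))\ge-\sqrt{\epsilon\rho}$,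 then with probability at least $1-\zeta$ the method stops within the bound of (i) with $\|\nabla f(\hat y)\|\le\epsilon$ and $\lambda_{\min}(\nabla^2 f(\hat y))\ge-1.011\sqrt{\epsilon\rho}$. If the initial point is perturbed by the same rule, that is, if the method is started at $x_{int}+\xi\,1_{\|\nabla f(x_{int})\|\le B/\eta}$ instead of $x_{int}$, then this holds without any condition on $x_{int}$. Moreover $\ell=O\big(\max\{1,\log\frac{d}{\zeta\epsilon}\}\big)$, with a constant that depends only on $L$, $\rho$ and an upper bound of $\triangle_f$; so $\chi$ can be chosen of this order. -/

import Mathlib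

open MeasureTheory ProbabilityTheory

noncomputable section

/-- `ℝ^d` with the Euclidean norm. -/
abbrev Vec (d : ℕ) : Type := EuclideanSpace ℝ (Fin d)

/-- The Hessian `∇²f(x)`, as the derivative of the gradient field. -/
def hess {d : ℕ} (f : Vec d → ℝ) (x : Vec d) : Vec d →L[ℝ] Vec d :=
  fderiv ℝ (gradient f) x

/-- The smallest eigenvalue. -/
def lambdaMin {d : ℕ} (A : Vec d →L[ℝ] Vec d) : ℝ :=
  sInf {μ : ℝ | Module.End.HasEigenvalue (A : Vec d →ₗ[ℝ] Vec d) μ}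

/-- `f` is twice differentiable, with `L`-Lipschitz gradient and `ρ`-Lipschitz Hessian
(in the spectral norm), and is bounded below. -/
structure SmoothObjective {d : ℕ} (f : Vec d → ℝ) (L ρ : ℝ) : Prop where
  diff : Differentiable ℝ f
  diff_grad : Differentiable ℝ (gradient f)
  lip_grad : ∀ x y, ‖gradient f x - gradient f y‖ ≤ L * ‖x - y‖
  lip_hess : ∀ x y, ‖hess f x - hess f y‖ ≤ ρ * ‖x - y‖
  bdd : BddBelow (Set.range f)

/-- `Δ_f = f(x) - inf f`. -/
def gap {d : ℕ} (f : Vec d → ℝ) (x : Vec d) : ℝ := f x - ⨅ z, f z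

/-- Parameters of the restarted accelerated gradient method. -/
structure Params where
  η : ℝ
  θ : ℝ
  B : ℝ
  K : ℝ

/-- The parameter choice `η = 1/(4L)`, `θ = (1/2)(ερ/L²)^{1/4}`, `B = (1/(288χ²))√(ε/ρ)`,
`K = 2χ/θ` (not rounded). -/
def params (L ρ ε χ : ℝ) : Params where
  η := 1 / (4 * L)
  θ := 1 / 2 * (ε * ρ / L ^ 2) ^ (1 / 4 : ℝ)
  B := 1 / (288 * χ ^ 2) * √(ε / ρ)
  K := 2 * χ / (1 / 2 * (ε * ρ / L ^ 2) ^ (1 / 4 : ℝ))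

/-- The perturbation radius `r = min {B/2, θB/(20K), √(θB²/(2K))}`. -/
def Params.radius (p : Params) : ℝ :=
  min (p.B / 2) (min (p.θ * p.B / (20 * p.K)) √(p.θ * p.B ^ 2 / (2 * p.K)))

section Algorithm

variable {d : ℕ} (f : Vec d → ℝ) (p : Params)

/-- The extrapolation step `y = x + (1-θ)(x - x⁻)`, where `x⁻` is the previous iterate. -/
def extrapolate (xprev x : Vec d) : Vec d := x + (1 - p.θ) • (x - xprev)

/-- The pair `(x^{k-1}, x^k)` of accelerated gradient iterates of the epoch that starts
at `x^{-1} = x^0 = x₀`. -/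
def agdPair (x₀ : Vec d) : ℕ → Vec d × Vec d
  | 0 => (x₀, x₀)
  | k + 1 =>
    let s := agdPair x₀ k
    let y := extrapolate p s.1 s.2
    (s.2, y - p.η • gradient f y)

/-- The iterate `x^k` of the epoch that starts at `x₀`. -/
def agdX (x₀ : Vec d) (k : ℕ) : Vec d := (agdPair f p x₀ k).2

/-- The extrapolated point `y^k` of the epoch that starts at `x₀`. -/
def agdY (x₀ : Vec d) (k : ℕ) : Vec d :=
  extrapolate p (agdPair f p x₀ k).1 (agdPair f p x₀ k).2

/-- The restart condition `k ∑_{t<k} ‖x^{t+1} - x^t‖² > B²`. -/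
def Triggers (x₀ : Vec d) (k : ℕ) : Prop :=
  p.B ^ 2 < k * ∑ t ∈ Finset.range k, ‖agdX f p x₀ (t + 1) - agdX f p x₀ t‖ ^ 2

/-- The epoch that starts at `x₀` ends in a restart: the condition triggers at some `k` reached
by the loop `while k < K`. -/
def EpochRestarts (x₀ : Vec d) : Prop :=
  ∃ k : ℕ, k ≤ ⌈p.K⌉₊ ∧ Triggers f p x₀ k

open Classical in
/-- `x + ξ · 1[‖∇f(y)‖ ≤ B/η]`. -/
def perturb (x y ξ : Vec d) : Vec d :=
  if ‖gradient f y‖ ≤ p.B / p.η then x + ξ else x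

/-- State of the algorithm: the point `x^0` at which the current epoch started, the counter `k`,
and the number of restarts so far. The iterates of the current epoch are
`agdX f p start 0, …, agdX f p start k`. -/
structure State (d : ℕ) where
  start : Vec d
  k : ℕ
  restarts : ℕ

open Classical in
/-- One pass through the body of the loop `while k < K`; it evaluates one new gradient, at `y^k`.
The perturbation used at the `n`-th restart (counting from `0`) is `ξ n`.
A state with `k ≥ K` has left the loop. -/
def step (ξ : ℕ → Vec d) (s : State d) : State d :=
  if (s.k : ℝ) < p.K then
    if Triggers f p s.start (s.k + 1) then
      { start := perturb f p (agdX f p s.start (s.k + 1)) (agdY f p s.start s.k) (ξ s.restarts)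
        k := 0
        restarts := s.restarts + 1 }
    else { s with k := s.k + 1 }
  else s

/-- State after `t` passes, when the method is started at `x^{-1} = x^0 = x₀`. -/
def run (x₀ : Vec d) (ξ : ℕ → Vec d) (t : ℕ) : State d :=
  (step f p ξ)^[t] { start := x₀, k := 0, restarts := 0 }

/-- The loop is left after exactly `T` passes, that is after `T` gradient evaluations. -/
def HaltsAt (x₀ : Vec d) (ξ : ℕ → Vec d) (T : ℕ) : Prop :=
  p.K ≤ (run f p x₀ ξ T).k ∧ ∀ t < T, ((run f p x₀ ξ t).k : ℝ) < p.K

/-- `yhat = (1/(K₀+1)) ∑_{k ≤ K₀} y^k` for the epoch that starts at `x₀`, where `K₀` minimizes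
`‖x^{k+1} - x^k‖` over the integers `⌊K/2⌋ ≤ k ≤ K-1`. Every minimizer is admitted. -/
def IsOutput (x₀ yhat : Vec d) : Prop :=
  ∃ K₀ : ℕ, (⌊p.K / 2⌋₊ ≤ K₀ ∧ (K₀ : ℝ) ≤ p.K - 1) ∧
    (∀ k : ℕ, ⌊p.K / 2⌋₊ ≤ k → (k : ℝ) ≤ p.K - 1 →
      ‖agdX f p x₀ (K₀ + 1) - agdX f p x₀ K₀‖ ≤ ‖agdX f p x₀ (k + 1) - agdX f p x₀ k‖) ∧
    yhat = (1 / ((K₀ : ℝ) + 1)) • ∑ k ∈ Finset.range (K₀ + 1), agdY f p x₀ k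

/-- The method started at `x₀` stops after exactly `T` gradient evaluations and may
return `yhat`. -/
def Returns (x₀ : Vec d) (ξ : ℕ → Vec d) (T : ℕ) (yhat : Vec d) : Prop :=
  HaltsAt f p x₀ ξ T ∧ IsOutput f p (run f p x₀ ξ T).start yhat

/-- Whatever minimizer `K₀` is chosen, the method started at `x₀` stops after at most `N`
gradient evaluations, returns some point, and each point it may return satisfies `Q`. -/
def Achieves (x₀ : Vec d) (ξ : ℕ → Vec d) (N : ℝ) (Q : Vec d → Prop) : Prop :=
  ∃ T : ℕ, (T : ℝ) ≤ N ∧ (∃ yhat, Returns f p x₀ ξ T yhat) ∧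
    ∀ yhat, Returns f p x₀ ξ T yhat → Q yhat

end Algorithm

/-- `Δ L^{1/2} ρ^{1/4} χ⁶ / ε^{7/4}`, plus the order `L^{1/2} χ / (ερ)^{1/4}` of the length `K`
of the last epoch, which is run even when `Δ = 0`. -/
def evalBound (L ρ ε χ Δ : ℝ) : ℝ :=
  Δ * L ^ (1 / 2 : ℝ) * ρ ^ (1 / 4 : ℝ) * χ ^ 6 / ε ^ (7 / 4 : ℝ) +
    L ^ (1 / 2 : ℝ) * χ / (ε * ρ) ^ (1 / 4 : ℝ)

/-- `max {1, log (d L (1 + Δ ρ^{1/2} / ε^{3/2}) / (ζ √(ερ)))}`: the order of `χ`. -/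
def logFactor (d : ℕ) (L ρ ε ζ Δ : ℝ) : ℝ :=
  max 1 (Real.log (d * L * (1 + Δ * √ρ / ε ^ (3 / 2 : ℝ)) / (ζ * √(ε * ρ))))

end

/-! Progress is measured in the unit `U = θB²/(ηK)`. By Cauchy-Schwarz the iterates stay within `B`
of the start of the epoch until the restart test fires, so that `f` is close to its quadratic model
there.

An epoch that restarts lowers `f`. If its last gradient exceeds `B/η`, an energy argument gives a
drop of `B²/(4η)` (`decrease_of_large_gradient`). Otherwise the epoch lies in a ball of radius `3B`,
and the quadratic model splits along the eigenvectors of the Hessian into scalar problems. Each of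
these decreases in proportion to its squared steps, whatever the sign of its curvature
(`scalar_quadratic_decrease`). Since the test fired, the squared steps add up to at least
`2B²/(3K)`, which yields a drop of `3U/16` (`decrease_of_small_gradient`). A perturbation costs at
most `U/8`, so a net `U/16` remains, and there are at most `16Δ/U` restarts (`exists_last_epoch`).

In an epoch without restart the gradients at the `y^k` telescope, so their average is small. As the
gradient is almost linear, it is small at the averaged point too (`isOutput_norm_gradient_le`).

For the second-order claim, let two epochs start near a point of curvature below `-√(ερ)` and differ
along the lowest eigenvector. Their difference obeys a linear momentum recurrence with small
relative error and grows by a factor of order `exp (χ/3)` (`growth_of_unstable`). If neither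
restarts, the difference stays below `3B`, so the starts are exponentially close
(`exists_escape_direction`). The stuck starts thus form a set with short chords in one direction,
and disjoint translates show that it fills little of the ball (`volume_le_of_short_chords`).
Independence and a union bound over the epochs make a stuck perturbation unlikely. Since an
unperturbed restart is always followed by another restart, the last epoch then starts near a point
without strong negative curvature, and the Lipschitz Hessian carries this to the output
(`achieves_second_order`). -/

open scoped RealInnerProductSpace

/-! ### Taylor estimates from Lipschitz gradient and Hessian. -/

section Calculus

/-- A curve on `[0, 1]` that starts at `0` and has speed at most `c t ^ n` ends within
`c / (n + 1)` of `0`. -/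
lemma norm_le_of_norm_deriv_le_mul_pow {E : Type*} [NormedAddCommGroup E] [NormedSpace ℝ E]
    {F F' : ℝ → E} {c : ℝ} (n : ℕ) (h0 : F 0 = 0) (hF : ∀ t, HasDerivAt F (F' t) t)
    (hb : ∀ t, 0 ≤ t → ‖F' t‖ ≤ c * t ^ n) : ‖F 1‖ ≤ c / (n + 1) := by
  have hB : ∀ t : ℝ, HasDerivAt (fun t : ℝ => c / (n + 1) * t ^ (n + 1)) (c * t ^ n) t := by
    intro t
    have h := (hasDerivAt_pow (n + 1) t).const_mul (c / ((n : ℝ) + 1))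
    have hn : (n : ℝ) + 1 ≠ 0 := by positivity
    refine h.congr_deriv ?_
    push_cast
    rw [← mul_assoc, div_mul_cancel₀ _ hn]
  have h := image_norm_le_of_norm_deriv_right_le_deriv_boundary (a := 0) (b := 1)
    (fun t _ => (hF t).continuousAt.continuousWithinAt) (fun t _ => (hF t).hasDerivWithinAt)
    (B := fun t : ℝ => c / (n + 1) * t ^ (n + 1)) (by simp [h0]) hB (fun t ht => hb t ht.1)
    (Set.right_mem_Icc.2 zero_le_one)
  simpa using h

variable {d : ℕ} {f : Vec d → ℝ} {L ρ : ℝ}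

lemma hasDerivAt_segment (x v : Vec d) (t : ℝ) :
    HasDerivAt (fun t : ℝ => x + t • v) v t := by
  simpa using ((hasDerivAt_id t).smul_const v).const_add x

namespace SmoothObjective

lemma hasDerivAt_comp_segment (hf : SmoothObjective f L ρ) (x v : Vec d) (t : ℝ) :
    HasDerivAt (fun t : ℝ => f (x + t • v)) ⟪gradient f (x + t • v), v⟫ t := by
  have h := ((hf.diff (x + t • v)).hasFDerivAt).comp_hasDerivAt t (hasDerivAt_segment x v t)
  have e : fderiv ℝ f (x + t • v) v = ⟪gradient f (x + t • v), v⟫ := by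
    rw [← toDual_gradient]; simp
  rw [← e]; exact h

lemma hasDerivAt_gradient_comp_segment (hf : SmoothObjective f L ρ) (x v : Vec d) (t : ℝ) :
    HasDerivAt (fun t : ℝ => gradient f (x + t • v)) (hess f (x + t • v) v) t :=
  HasFDerivAt.comp_hasDerivAt (l := gradient f) (l' := hess f (x + t • v)) t
    ((hf.diff_grad (x + t • v)).hasFDerivAt) (hasDerivAt_segment x v t)

lemma hess_isSymmetric (hf : SmoothObjective f L ρ) (x : Vec d) :
    (hess f x : Vec d →ₗ[ℝ] Vec d).IsSymmetric := by
  have h1 : ∀ y, HasFDerivAt f (fderiv ℝ f y) y := fun y => (hf.diff y).hasFDerivAt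
  have e : fderiv ℝ f = fun y => innerSL ℝ (gradient f y) := by
    ext y v
    rw [← toDual_gradient]; simp
  have h2 : HasFDerivAt (fderiv ℝ f) ((innerSL ℝ : Vec d →L[ℝ] _) ∘L hess f x) x := by
    rw [e]
    exact (innerSL ℝ : Vec d →L[ℝ] _).hasFDerivAt.comp x (hf.diff_grad x).hasFDerivAt
  intro v w
  have h := second_derivative_symmetric h1 h2 v w
  change ⟪hess f x v, w⟫ = ⟪hess f x w, v⟫ at h
  simpa [real_inner_comm] using h

lemma norm_hess_le (hf : SmoothObjective f L ρ) (hL : 0 ≤ L) (x : Vec d) : ‖hess f x‖ ≤ L :=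
  norm_fderiv_le_of_lip' ℝ hL (Filter.Eventually.of_forall fun y => hf.lip_grad y x)

lemma continuous_gradient (hf : SmoothObjective f L ρ) : Continuous (gradient f) :=
  hf.diff_grad.continuous

lemma abs_sub_linear_le (hf : SmoothObjective f L ρ) (x y : Vec d) :
    |f y - f x - ⟪gradient f x, y - x⟫| ≤ L / 2 * ‖y - x‖ ^ 2 := by
  have h := norm_le_of_norm_deriv_le_mul_pow (c := L * ‖y - x‖ ^ 2) 1
    (F := fun t : ℝ => f (x + t • (y - x)) - f x - t * ⟪gradient f x, y - x⟫)
    (F' := fun t => ⟪gradient f (x + t • (y - x)), y - x⟫ - ⟪gradient f x, y - x⟫)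
    (by simp)
    (fun t => by
      have h := ((hf.hasDerivAt_comp_segment x (y - x) t).sub_const (f x)).fun_sub
        ((hasDerivAt_id t).mul_const ⟪gradient f x, y - x⟫)
      exact h.congr_deriv (by simp))
    (fun t ht => by
      rw [← inner_sub_left]
      refine (norm_inner_le_norm _ _).trans ?_
      have h := hf.lip_grad (x + t • (y - x)) x
      rw [add_sub_cancel_left, norm_smul, Real.norm_of_nonneg ht] at h
      calc _ ≤ L * (t * ‖y - x‖) * ‖y - x‖ := by gcongr
        _ = _ := by ring)
  rw [Real.norm_eq_abs] at h
  simp only [one_smul, add_sub_cancel, one_mul, Nat.cast_one] at h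
  calc _ ≤ _ := h
    _ = _ := by ring

lemma norm_gradient_sub_linear_le (hf : SmoothObjective f L ρ) (x y : Vec d) :
    ‖gradient f y - gradient f x - hess f x (y - x)‖ ≤ ρ / 2 * ‖y - x‖ ^ 2 := by
  have h := norm_le_of_norm_deriv_le_mul_pow (c := ρ * ‖y - x‖ ^ 2) 1
    (F := fun t : ℝ => gradient f (x + t • (y - x)) - gradient f x - t • hess f x (y - x))
    (F' := fun t => hess f (x + t • (y - x)) (y - x) - hess f x (y - x))
    (by simp)
    (fun t => by
      have h := ((hf.hasDerivAt_gradient_comp_segment x (y - x) t).sub_const (gradient f x)).fun_sub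
        ((hasDerivAt_id t).smul_const (hess f x (y - x)))
      exact h.congr_deriv (by simp))
    (fun t ht => by
      rw [← sub_apply]
      refine (ContinuousLinearMap.le_opNorm _ _).trans ?_
      have h := hf.lip_hess (x + t • (y - x)) x
      rw [add_sub_cancel_left, norm_smul, Real.norm_of_nonneg ht] at h
      calc _ ≤ ρ * (t * ‖y - x‖) * ‖y - x‖ := by gcongr
        _ = _ := by ring)
  simp only [one_smul, add_sub_cancel, Nat.cast_one] at h
  calc _ ≤ _ := h
    _ = _ := by ring

lemma abs_sub_quadratic_le (hf : SmoothObjective f L ρ) (x y : Vec d) :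
    |f y - f x - ⟪gradient f x, y - x⟫ - 1 / 2 * ⟪hess f x (y - x), y - x⟫|
      ≤ ρ / 6 * ‖y - x‖ ^ 3 := by
  have h := norm_le_of_norm_deriv_le_mul_pow (c := ρ / 2 * ‖y - x‖ ^ 3) 2
    (F := fun t : ℝ => f (x + t • (y - x)) - f x - t * ⟪gradient f x, y - x⟫
      - t ^ 2 * (1 / 2 * ⟪hess f x (y - x), y - x⟫))
    (F' := fun t => ⟪gradient f (x + t • (y - x)), y - x⟫ - ⟪gradient f x, y - x⟫
      - t * ⟪hess f x (y - x), y - x⟫)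
    (by simp)
    (fun t => by
      have h := (((hf.hasDerivAt_comp_segment x (y - x) t).sub_const (f x)).fun_sub
        ((hasDerivAt_id t).mul_const ⟪gradient f x, y - x⟫)).fun_sub
        ((hasDerivAt_pow 2 t).mul_const (1 / 2 * ⟪hess f x (y - x), y - x⟫))
      exact h.congr_deriv (by simp only [one_mul, Nat.cast_ofNat]; ring))
    -- The speed of the remainder is the error of the linear model of the gradient, paired with `y -
    -- x`; hence it is of order `t²`.
    (fun t ht => by
      have e : ⟪gradient f (x + t • (y - x)), y - x⟫ - ⟪gradient f x, y - x⟫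
          - t * ⟪hess f x (y - x), y - x⟫ = ⟪gradient f (x + t • (y - x)) - gradient f x
            - hess f x (x + t • (y - x) - x), y - x⟫ := by
        rw [add_sub_cancel_left, map_smul, inner_sub_left, inner_sub_left, real_inner_smul_left]
      rw [e]
      refine (norm_inner_le_norm _ _).trans ?_
      have h := hf.norm_gradient_sub_linear_le x (x + t • (y - x))
      rw [add_sub_cancel_left, norm_smul, Real.norm_of_nonneg ht] at h
      rw [add_sub_cancel_left]
      calc _ ≤ ρ / 2 * (t * ‖y - x‖) ^ 2 * ‖y - x‖ := by gcongr
        _ = _ := by ring)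
  rw [Real.norm_eq_abs] at h
  simp only [one_smul, add_sub_cancel, one_mul, one_pow, Nat.cast_ofNat] at h
  calc _ ≤ _ := h
    _ = _ := by ring

/-- On a ball around `x` the gradient differs from its linearisation at `x` by a map with a small
Lipschitz constant. -/
lemma norm_gradient_sub_gradient_sub_hess_le (hf : SmoothObjective f L ρ) (hρ : 0 ≤ ρ) {R : ℝ}
    (x : Vec d) {y z : Vec d} (hy : ‖y - x‖ ≤ R) (hz : ‖z - x‖ ≤ R) :
    ‖gradient f y - gradient f z - hess f x (y - z)‖ ≤ ρ * R * ‖y - z‖ := by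
  have h := (convex_closedBall x R).norm_image_sub_le_of_norm_hasFDerivWithin_le
    (f := fun u => gradient f u - hess f x u) (f' := fun u => hess f u - hess f x)
    (C := ρ * R) (x := z) (y := y)
    (fun u _ => ((hf.diff_grad u).hasFDerivAt.sub
      (hess f x).hasFDerivAt).hasFDerivWithinAt)
    (fun u hu => (hf.lip_hess u x).trans (by
      gcongr; simpa [dist_eq_norm] using hu))
    (by simpa [dist_eq_norm] using hz) (by simpa [dist_eq_norm] using hy)
  rwa [sub_sub_sub_comm, ← map_sub] at h

end SmoothObjective

end Calculus

/-! ### Rayleigh quotients and perturbation of the smallest eigenvalue. -/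

section Spectral

variable {d : ℕ}

/-- This needs `0 < d`: for `d = 0` the set is empty and the infimum defaults to `0`. -/
lemma lambdaMin_set_nonempty (hd : 0 < d) {A : Vec d →L[ℝ] Vec d}
    (hA : (A : Vec d →ₗ[ℝ] Vec d).IsSymmetric) :
    {μ : ℝ | Module.End.HasEigenvalue (A : Vec d →ₗ[ℝ] Vec d) μ}.Nonempty :=
  ⟨_, hA.hasEigenvalue_eigenvalues (n := d) (by simp) ⟨0, hd⟩⟩

lemma abs_eigenvalue_le_norm {A : Vec d →L[ℝ] Vec d} {μ : ℝ}
    (h : Module.End.HasEigenvalue (A : Vec d →ₗ[ℝ] Vec d) μ) : |μ| ≤ ‖A‖ := by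
  obtain ⟨v, hv⟩ := h.exists_hasEigenvector
  have h1 : A v = μ • v := hv.apply_eq_smul
  have h2 := A.le_opNorm v
  rw [h1, norm_smul, Real.norm_eq_abs] at h2
  exact le_of_mul_le_mul_right h2 (norm_pos_iff.2 hv.2)

lemma bddBelow_eigenvalues (A : Vec d →L[ℝ] Vec d) :
    BddBelow {μ : ℝ | Module.End.HasEigenvalue (A : Vec d →ₗ[ℝ] Vec d) μ} :=
  ⟨-‖A‖, fun _ h => (abs_le.1 (abs_eigenvalue_le_norm h)).1⟩

lemma inner_apply_eq_sum {A : Vec d →L[ℝ] Vec d}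
    (hA : (A : Vec d →ₗ[ℝ] Vec d).IsSymmetric) (v w : Vec d) :
    ⟪A v, w⟫ = ∑ i, hA.eigenvalues (n := d) (by simp) i *
      (⟪hA.eigenvectorBasis (n := d) (by simp) i, v⟫ *
        ⟪hA.eigenvectorBasis (n := d) (by simp) i, w⟫) := by
  rw [← (hA.eigenvectorBasis (n := d) (by simp)).sum_inner_mul_inner]
  refine Finset.sum_congr rfl fun i _ => ?_
  have h : ⟪A v, hA.eigenvectorBasis (n := d) (by simp) i⟫
      = hA.eigenvalues (n := d) (by simp) i * ⟪v, hA.eigenvectorBasis (n := d) (by simp) i⟫ := by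
    have := hA v (hA.eigenvectorBasis (n := d) (by simp) i)
    rw [hA.apply_eigenvectorBasis] at this
    rw [← real_inner_smul_right]
    simpa using this
  rw [h, real_inner_comm v]
  ring

lemma lambdaMin_mul_sq_le {A : Vec d →L[ℝ] Vec d}
    (hA : (A : Vec d →ₗ[ℝ] Vec d).IsSymmetric) (v : Vec d) :
    lambdaMin A * ‖v‖ ^ 2 ≤ ⟪A v, v⟫ := by
  rw [inner_apply_eq_sum hA,
    ← (hA.eigenvectorBasis (n := d) (by simp)).sum_sq_inner_right v, Finset.mul_sum]
  refine Finset.sum_le_sum fun i _ => ?_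
  rw [← sq]
  exact mul_le_mul_of_nonneg_right (csInf_le (bddBelow_eigenvalues A)
    (hA.hasEigenvalue_eigenvalues _ i)) (sq_nonneg _)

/-- Weyl's inequality, by testing `A` on an eigenvector of `A'`. -/
lemma lambdaMin_sub_le (hd : 0 < d) {A A' : Vec d →L[ℝ] Vec d}
    (hA : (A : Vec d →ₗ[ℝ] Vec d).IsSymmetric) (hA' : (A' : Vec d →ₗ[ℝ] Vec d).IsSymmetric) :
    lambdaMin A - ‖A' - A‖ ≤ lambdaMin A' := by
  refine le_csInf (lambdaMin_set_nonempty hd hA') fun μ hμ => ?_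
  obtain ⟨v, hv⟩ := Module.End.HasEigenvalue.exists_hasEigenvector hμ
  have h1 : A' v = μ • v := hv.apply_eq_smul
  have hv0 : 0 < ‖v‖ ^ 2 := by have := norm_pos_iff.2 hv.2; positivity
  have h2 : ⟪A' v, v⟫ = μ * ‖v‖ ^ 2 := by
    rw [h1, real_inner_smul_left, real_inner_self_eq_norm_sq]
  have h3 := lambdaMin_mul_sq_le hA v
  have h4 : |⟪(A' - A) v, v⟫| ≤ ‖A' - A‖ * ‖v‖ * ‖v‖ :=
    (abs_real_inner_le_norm _ _).trans (by gcongr; exact (A' - A).le_opNorm v)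
  rw [sub_apply, inner_sub_left] at h4
  have h5 := (abs_le.1 h4).1
  refine le_of_mul_le_mul_right ?_ hv0
  nlinarith

end Spectral

/-! ### Decrease of scalar quadratics under momentum. -/

section ScalarQuadratic

/-! Momentum steps with inexact gradients `c + l b + δ` on the scalar quadratic
`c a + l a² / 2`. The curvature `l` may be negative. -/

/-- The energy "quadratic plus `(1-θ)/(2η)` times the squared last step" decreases: the defect is a
sum of squares whose coefficients are nonnegative, because `l η ≥ -θ` gives `(1-θ)(1 - l η) ≤ 1 -
θ²`. -/
lemma scalar_step_of_mild_curvature {η θ l c δ a a₁ D : ℝ} (hη : 0 < η) (hθ : 0 < θ) (hθ1 : θ < 1)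
    (hl : l * η ≤ 1) (hl' : -θ ≤ l * η)
    (ha : a₁ = a + (1 - θ) * D - η * (c + l * (a + (1 - θ) * D) + δ)) :
    c * a₁ + l / 2 * a₁ ^ 2 + (1 - θ) / (2 * η) * (a₁ - a) ^ 2 ≤
      c * a + l / 2 * a ^ 2 + (1 - θ) / (2 * η) * D ^ 2 - 3 * θ / (8 * η) * (a₁ - a) ^ 2
        + 2 * η / θ * δ ^ 2 := by
  set b := a + (1 - θ) * D with hb
  have hc : c = (b - a₁) / η - l * b - δ := by field_simp; linarith
  have key : c * a + l / 2 * a ^ 2 + (1 - θ) / (2 * η) * D ^ 2 - 3 * θ / (8 * η) * (a₁ - a) ^ 2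
        + 2 * η / θ * δ ^ 2 - (c * a₁ + l / 2 * a₁ ^ 2 + (1 - θ) / (2 * η) * (a₁ - a) ^ 2)
      = (1 - θ) * (1 - (1 - θ) * (1 - l * η)) / (2 * η) * D ^ 2
        + (1 - l * η) / (2 * η) * (a₁ - b) ^ 2
        + (θ * (a₁ - a) + 4 * η * δ) ^ 2 / (8 * η * θ) := by
    have hD : (1 - θ) * D = b - a := by rw [hb]; ring
    have e : (1 - θ) * (1 - (1 - θ) * (1 - l * η)) / (2 * η) * D ^ 2
        = (1 - θ) / (2 * η) * D ^ 2 - (1 - l * η) / (2 * η) * ((1 - θ) * D) ^ 2 := by ring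
    rw [e, hD, hc]
    field_simp
    ring
  have h1 : 0 ≤ (1 - θ) * (1 - (1 - θ) * (1 - l * η)) / (2 * η) * D ^ 2 := by
    have : 0 ≤ 1 - (1 - θ) * (1 - l * η) := by nlinarith
    have : 0 ≤ 1 - θ := by linarith
    positivity
  have h2 : 0 ≤ (1 - l * η) / (2 * η) * (a₁ - b) ^ 2 := by
    have : 0 ≤ 1 - l * η := by linarith
    positivity
  have h3 : 0 ≤ (θ * (a₁ - a) + 4 * η * δ) ^ 2 / (8 * η * θ) := by positivity
  linarith

/-- For strongly negative curvature the energy may grow. What persists is that a step hardly points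
uphill: `q` bounds the product of the step with the derivative at its start, and it contracts by `1
- θ` up to the error. -/
lemma scalar_step_of_negative_curvature {η θ l c δ a₀ a a₁ q : ℝ} (hη : 0 < η) (hθ : 0 < θ)
    (hθ1 : θ < 1) (hl : -1 ≤ l * η) (hl' : l * η ≤ -θ)
    (ha : a₁ = a + (1 - θ) * (a - a₀) - η * (c + l * (a + (1 - θ) * (a - a₀)) + δ))
    (hq : -((a - a₀) * (l * a₀ + c)) ≥ -q) :
    -((a₁ - a) * (l * a + c)) ≥ -((1 - θ) * q + η / 2 * δ ^ 2) := by
  set D := a - a₀ with hD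
  have key : -((a₁ - a) * (l * a + c)) + ((1 - θ) * q + η / 2 * δ ^ 2)
      = (1 - θ) * (-(D * (l * a₀ + c)) + q)
        + η / 2 * (l * a + c + δ) ^ 2 + (-l) * (1 - θ) * D ^ 2
        + η * (l * (1 - θ) * D) * (l * a + c) + η / 2 * (l * a + c) ^ 2 := by
    have : a₀ = a - D := by rw [hD]; ring
    rw [ha, this]
    ring
  have h1 : 0 ≤ (1 - θ) * (-(D * (l * a₀ + c)) + q) :=
    mul_nonneg (by linarith) (by linarith)
  have h2 : 0 ≤ (-l) * (1 - θ) * D ^ 2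
        + η * (l * (1 - θ) * D) * (l * a + c) + η / 2 * (l * a + c) ^ 2 := by
    have e : (-l) * (1 - θ) * D ^ 2
        + η * (l * (1 - θ) * D) * (l * a + c) + η / 2 * (l * a + c) ^ 2
        = η / 2 * (l * a + c + l * (1 - θ) * D) ^ 2
          + (-l) * (1 - θ) * D ^ 2 * (1 + (1 - θ) * (l * η) / 2) := by ring
    have hl0 : 0 ≤ -l := by
      by_contra h
      have : 0 < l * η := mul_pos (by linarith) hη
      linarith
    have : 0 ≤ 1 + (1 - θ) * (l * η) / 2 := by nlinarith
    have : 0 ≤ 1 - θ := by linarith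
    rw [e]
    positivity
  have h3 : 0 ≤ η / 2 * (l * a + c + δ) ^ 2 := by positivity
  linarith

/-- The quadratic decreases in proportion to the squared lengths of the steps. -/
lemma scalar_quadratic_decrease {η θ l c : ℝ} {a δ : ℕ → ℝ} (hη : 0 < η) (hθ : 0 < θ) (hθ1 : θ < 1)
    (hl : |l| * η ≤ 1) (h0 : a 0 = 0)
    (ha : ∀ k, a (k + 1) = a k + (1 - θ) * (a k - a (k - 1))
      - η * (c + l * (a k + (1 - θ) * (a k - a (k - 1))) + δ k)) (n : ℕ) :
    c * a n + l / 2 * a n ^ 2 ≤ -(3 * θ / (8 * η)) * ∑ k ∈ Finset.range n, (a (k + 1) - a k) ^ 2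
      + 2 * η / θ * ∑ k ∈ Finset.range n, δ k ^ 2 := by
  have hl1 : l * η ≤ 1 := le_trans (by gcongr; exact le_abs_self l) hl
  have hl2 : -1 ≤ l * η := by
    have : -|l| * η ≤ l * η := by gcongr; exact neg_abs_le l
    linarith
  rcases le_total (-θ) (l * η) with h | h
  · have H : c * a n + l / 2 * a n ^ 2 + (1 - θ) / (2 * η) * (a n - a (n - 1)) ^ 2
        ≤ -(3 * θ / (8 * η)) * ∑ k ∈ Finset.range n, (a (k + 1) - a k) ^ 2
          + 2 * η / θ * ∑ k ∈ Finset.range n, δ k ^ 2 := by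
      induction n with
      | zero => simp [h0]
      | succ n ih =>
        have := scalar_step_of_mild_curvature hη hθ hθ1 hl1 h (ha n)
        rw [Finset.sum_range_succ, Finset.sum_range_succ, Nat.add_sub_cancel]
        linarith
    have : 0 ≤ (1 - θ) / (2 * η) * (a n - a (n - 1)) ^ 2 := by
      have : 0 ≤ 1 - θ := by linarith
      positivity
    linarith
  -- The term `(1-θ)/θ * q` prepays the first-order increases `(1-θ)q + (1-θ)²q + …` that `q` can
  -- still cause in later steps.
  · have H : ∃ q, 0 ≤ q ∧ -((a n - a (n - 1)) * (l * a (n - 1) + c)) ≥ -q ∧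
        c * a n + l / 2 * a n ^ 2 + (1 - θ) / θ * q
          ≤ -(3 * θ / (8 * η)) * ∑ k ∈ Finset.range n, (a (k + 1) - a k) ^ 2
            + 2 * η / θ * ∑ k ∈ Finset.range n, δ k ^ 2 := by
      induction n with
      | zero => exact ⟨0, by simp [h0]⟩
      | succ n ih =>
        obtain ⟨q, hq0, hq, hg⟩ := ih
        have hs := scalar_step_of_negative_curvature hη hθ hθ1 hl2 h (ha n) hq
        refine ⟨(1 - θ) * q + η / 2 * δ n ^ 2, ?_, hs, ?_⟩
        · have : 0 ≤ 1 - θ := by linarith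
          positivity
        · rw [Finset.sum_range_succ, Finset.sum_range_succ]
          have e1 : c * a (n + 1) + l / 2 * a (n + 1) ^ 2 = c * a n + l / 2 * a n ^ 2
              + (a (n + 1) - a n) * (l * a n + c) + l / 2 * (a (n + 1) - a n) ^ 2 := by ring
          have e2 : (1 - θ) / θ * ((1 - θ) * q + η / 2 * δ n ^ 2)
              = (1 - θ) / θ * q + η / (2 * θ) * δ n ^ 2
                - ((1 - θ) * q + η / 2 * δ n ^ 2) := by field_simp
          -- The concavity of the quadratic itself supplies the decrease: `l/2 ≤ -θ/(2η)`.
          have h3 : l / 2 * (a (n + 1) - a n) ^ 2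
              ≤ -(3 * θ / (8 * η)) * (a (n + 1) - a n) ^ 2 := by
            gcongr
            have : l ≤ -θ / η := by rw [le_div_iff₀ hη]; exact h
            have e : -(3 * θ / (8 * η)) = 3 / 8 * (-θ / η) := by ring
            have : -θ / η ≤ 0 := div_nonpos_of_nonpos_of_nonneg (by linarith) hη.le
            linarith
          have h4 : η / (2 * θ) * δ n ^ 2 ≤ 2 * η / θ * δ n ^ 2 := by
            gcongr
            · linarith
            · linarith
          linarith
    obtain ⟨q, hq, -, h1⟩ := H
    have : 0 ≤ (1 - θ) / θ * q := by
      have : 0 ≤ 1 - θ := by linarith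
      positivity
    linarith

end ScalarQuadratic

/-! ### One epoch: localisation and energy. -/

section Epoch

/-- The relations between the parameters that the analysis of the method uses. -/
structure Params.Tuned (p : Params) (L ρ χ : ℝ) : Prop where
  L_pos : 0 < L
  ρ_pos : 0 < ρ
  one_le : 1 ≤ χ
  η_eq : p.η = 1 / (4 * L)
  θ_pos : 0 < p.θ
  θ_lt : p.θ < 1
  B_pos : 0 < p.B
  K_eq : p.K = 2 * χ / p.θ
  B_eq : 288 * χ ^ 2 * (ρ * p.B * p.η) = p.θ ^ 2

namespace Params.Tuned

variable {p : Params} {L ρ χ : ℝ}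

lemma η_pos (hp : p.Tuned L ρ χ) : 0 < p.η := by
  have := hp.L_pos
  rw [hp.η_eq]; positivity

lemma χ_pos (hp : p.Tuned L ρ χ) : 0 < χ := lt_of_lt_of_le one_pos hp.one_le

lemma L_mul_η (hp : p.Tuned L ρ χ) : L * p.η = 1 / 4 := by
  have := hp.L_pos
  rw [hp.η_eq]; field_simp

lemma L_eq (hp : p.Tuned L ρ χ) : L = 1 / (4 * p.η) := by
  have := hp.η_pos
  rw [eq_div_iff (by positivity)]
  linarith [hp.L_mul_η]

lemma two_lt_K (hp : p.Tuned L ρ χ) : 2 < p.K := by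
  rw [hp.K_eq, lt_div_iff₀ hp.θ_pos]
  linarith [hp.θ_lt, hp.one_le]

lemma K_pos (hp : p.Tuned L ρ χ) : 0 < p.K := by linarith [hp.two_lt_K]

lemma ceil_K_le (hp : p.Tuned L ρ χ) : (⌈p.K⌉₊ : ℝ) ≤ 3 / 2 * p.K := by
  have := Nat.ceil_lt_add_one hp.K_pos.le
  linarith [hp.two_lt_K]

lemma two_lt_ceil_K (hp : p.Tuned L ρ χ) : 2 < ⌈p.K⌉₊ := by
  rw [Nat.lt_ceil]; exact_mod_cast hp.two_lt_K

end Params.Tuned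

variable {d : ℕ} (f : Vec d → ℝ) (p : Params)

lemma agdX_zero (x₀ : Vec d) : agdX f p x₀ 0 = x₀ := rfl

lemma agdX_succ (x₀ : Vec d) (k : ℕ) :
    agdX f p x₀ (k + 1) = agdY f p x₀ k - p.η • gradient f (agdY f p x₀ k) := rfl

/-- Truncated subtraction reads `x^{k-1}` as `x^0` at `k = 0`, which is the convention `x^{-1} =
x^0`. -/
lemma agdY_eq (x₀ : Vec d) (k : ℕ) :
    agdY f p x₀ k = agdX f p x₀ k + (1 - p.θ) • (agdX f p x₀ k - agdX f p x₀ (k - 1)) := by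
  cases k <;> rfl

lemma agdY_zero (x₀ : Vec d) : agdY f p x₀ 0 = x₀ := by
  simp [agdY_eq, agdX_zero]

variable {f p}

/-- Telescoping and Cauchy-Schwarz; this is the reason for the factor `k` in the restart test. -/
lemma norm_agdX_sub_sq_le (x₀ : Vec d) (k : ℕ) :
    ‖agdX f p x₀ k - x₀‖ ^ 2
      ≤ k * ∑ t ∈ Finset.range k, ‖agdX f p x₀ (t + 1) - agdX f p x₀ t‖ ^ 2 := by
  have e : agdX f p x₀ k - x₀
      = ∑ t ∈ Finset.range k, (agdX f p x₀ (t + 1) - agdX f p x₀ t) := by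
    rw [Finset.sum_range_sub, agdX_zero]
  calc ‖agdX f p x₀ k - x₀‖ ^ 2
      ≤ (∑ t ∈ Finset.range k, ‖agdX f p x₀ (t + 1) - agdX f p x₀ t‖) ^ 2 := by
        rw [e]; gcongr; exact norm_sum_le _ _
    _ ≤ _ := by
        simpa using sq_sum_le_card_mul_sum_sq (s := Finset.range k)
          (f := fun t => ‖agdX f p x₀ (t + 1) - agdX f p x₀ t‖)

lemma norm_agdX_sub_le (hB : 0 ≤ p.B) {x₀ : Vec d} {k : ℕ} (h : ¬ Triggers f p x₀ k) :
    ‖agdX f p x₀ k - x₀‖ ≤ p.B := by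
  rw [Triggers, not_lt] at h
  exact le_of_sq_le_sq ((norm_agdX_sub_sq_le x₀ k).trans h) hB

lemma norm_agdY_sub_le (hB : 0 ≤ p.B) (hθ : 0 ≤ p.θ) (hθ1 : p.θ ≤ 1) {x₀ : Vec d} {k : ℕ}
    (h : ¬ Triggers f p x₀ k) : ‖agdY f p x₀ k - x₀‖ ≤ 2 * p.B := by
  have h1 := norm_agdX_sub_le hB h
  have h2 : ‖agdX f p x₀ k - agdX f p x₀ (k - 1)‖ ≤ p.B := by
    rcases k with _ | k
    · simpa using hB
    · rw [Nat.add_sub_cancel]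
      rw [Triggers, not_lt] at h
      refine le_of_sq_le_sq (le_trans ?_ h) hB
      have h3 : ‖agdX f p x₀ (k + 1) - agdX f p x₀ k‖ ^ 2
          ≤ ∑ t ∈ Finset.range (k + 1), ‖agdX f p x₀ (t + 1) - agdX f p x₀ t‖ ^ 2 :=
        Finset.single_le_sum (f := fun t => ‖agdX f p x₀ (t + 1) - agdX f p x₀ t‖ ^ 2)
          (fun _ _ => by positivity) (Finset.self_mem_range_succ k)
      have h4 : (1 : ℝ) ≤ ((k + 1 : ℕ) : ℝ) := by push_cast; linarith [k.cast_nonneg (α := ℝ)]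
      have h5 : 0 ≤ ∑ t ∈ Finset.range (k + 1), ‖agdX f p x₀ (t + 1) - agdX f p x₀ t‖ ^ 2 := by
        positivity
      nlinarith
  have e : agdY f p x₀ k - x₀
      = (agdX f p x₀ k - x₀) + (1 - p.θ) • (agdX f p x₀ k - agdX f p x₀ (k - 1)) := by
    rw [agdY_eq]; abel
  rw [e]
  refine (norm_add_le _ _).trans ?_
  rw [norm_smul, Real.norm_of_nonneg (by linarith)]
  have : (1 - p.θ) * ‖agdX f p x₀ k - agdX f p x₀ (k - 1)‖ ≤ 1 * p.B := by gcongr; linarith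
  linarith

/-- Change of the objective in one gradient step with momentum. -/
lemma agd_step_le {L ρ χ : ℝ} (hf : SmoothObjective f L ρ) (hp : p.Tuned L ρ χ) (x₀ : Vec d)
    (k : ℕ) :
    f (agdX f p x₀ (k + 1)) ≤ f (agdX f p x₀ k)
      + 5 / (8 * p.η) * ‖agdX f p x₀ k - agdX f p x₀ (k - 1)‖ ^ 2
      - 1 / (2 * p.η) * ‖agdX f p x₀ (k + 1) - agdX f p x₀ k‖ ^ 2
      - 3 * p.η / 8 * ‖gradient f (agdY f p x₀ k)‖ ^ 2 := by
  have hη := hp.η_pos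
  set x := agdX f p x₀ k
  set y := agdY f p x₀ k with hy
  set g := gradient f y
  have hx' : agdX f p x₀ (k + 1) = y - p.η • g := rfl
  have h1 := (abs_le.1 (hf.abs_sub_linear_le y (y - p.η • g))).2
  have h2 := (abs_le.1 (hf.abs_sub_linear_le y x)).1
  have h3 : ‖x - y‖ ^ 2 ≤ ‖x - agdX f p x₀ (k - 1)‖ ^ 2 := by
    rw [hy, agdY_eq, sub_add_cancel_left, norm_neg, norm_smul,
      Real.norm_of_nonneg (by linarith [hp.θ_lt])]
    refine pow_le_pow_left₀ (mul_nonneg (by linarith [hp.θ_lt]) (norm_nonneg _)) ?_ 2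
    exact mul_le_of_le_one_left (norm_nonneg _) (by linarith [hp.θ_pos])
  rw [sub_sub_cancel_left, inner_neg_right, norm_neg, real_inner_smul_right,
    real_inner_self_eq_norm_sq, norm_smul, Real.norm_of_nonneg hη.le, hp.L_eq] at h1
  rw [hp.L_eq] at h2
  -- The squared step contains the inner product left over by the two Taylor bounds, so `1/(2η)`
  -- times it absorbs that term exactly.
  have h4 : ‖y - p.η • g - x‖ ^ 2 = ‖x - y‖ ^ 2 + 2 * p.η * ⟪g, x - y⟫ + p.η ^ 2 * ‖g‖ ^ 2 := by
    have : y - p.η • g - x = -((x - y) + p.η • g) := by abel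
    rw [this, norm_neg, norm_add_sq_real, norm_smul, Real.norm_of_nonneg hη.le,
      real_inner_smul_right, real_inner_comm]
    ring
  rw [hx', h4]
  have h5 : 5 / (8 * p.η) * ‖x - y‖ ^ 2
      ≤ 5 / (8 * p.η) * ‖x - agdX f p x₀ (k - 1)‖ ^ 2 := by gcongr
  have e1 : 1 / (2 * p.η) * (‖x - y‖ ^ 2 + 2 * p.η * ⟪g, x - y⟫ + p.η ^ 2 * ‖g‖ ^ 2)
      = 1 / (2 * p.η) * ‖x - y‖ ^ 2 + ⟪g, x - y⟫ + p.η / 2 * ‖g‖ ^ 2 := by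
    field_simp
  have e2 : 1 / (4 * p.η) / 2 * (p.η * ‖g‖) ^ 2 = p.η / 8 * ‖g‖ ^ 2 := by
    field_simp; ring
  have e3 : 1 / (4 * p.η) / 2 * ‖x - y‖ ^ 2
      = 5 / (8 * p.η) * ‖x - y‖ ^ 2 - 1 / (2 * p.η) * ‖x - y‖ ^ 2 := by
    field_simp; ring
  rw [e1]
  rw [e2] at h1
  rw [e3] at h2
  linarith

lemma sum_sq_steps_eq (x₀ : Vec d) (k : ℕ) :
    ∑ t ∈ Finset.range k, ‖agdX f p x₀ (t + 1) - agdX f p x₀ t‖ ^ 2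
      = ∑ t ∈ Finset.range (k - 1), ‖agdX f p x₀ (t + 1) - agdX f p x₀ t‖ ^ 2
        + ‖agdX f p x₀ k - agdX f p x₀ (k - 1)‖ ^ 2 := by
  rcases k with _ | k
  · simp
  · rw [Finset.sum_range_succ]; rfl

lemma sum_sq_steps_le {x₀ : Vec d} {n : ℕ} (hn : ¬ Triggers f p x₀ n) :
    ∑ t ∈ Finset.range n, ‖agdX f p x₀ (t + 1) - agdX f p x₀ t‖ ^ 2 ≤ p.B ^ 2 := by
  rw [Triggers, not_lt] at hn
  rcases n with _ | k
  · simpa using sq_nonneg p.B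
  · refine le_trans (le_mul_of_one_le_left (by positivity) ?_) hn
    push_cast; linarith [k.cast_nonneg (α := ℝ)]

/-- Since `5/8 = 1/2 + 1/8`, a step raises the energy by at most `1/(8η)` times the square of the
step before. The total rise is at most `B²/(8η)` as long as the test has not fired. -/
lemma agd_energy_le {L ρ χ : ℝ} (hf : SmoothObjective f L ρ) (hp : p.Tuned L ρ χ) (x₀ : Vec d)
    (k : ℕ) :
    f (agdX f p x₀ k) + 1 / (2 * p.η) * ‖agdX f p x₀ k - agdX f p x₀ (k - 1)‖ ^ 2
      ≤ f x₀ + 1 / (8 * p.η) *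
        ∑ t ∈ Finset.range (k - 1), ‖agdX f p x₀ (t + 1) - agdX f p x₀ t‖ ^ 2 := by
  have hη := hp.η_pos
  induction k with
  | zero => simp [agdX_zero]
  | succ k ih =>
    have h := agd_step_le hf hp x₀ k
    rw [Nat.add_sub_cancel, sum_sq_steps_eq, mul_add]
    have h0 : 0 ≤ 3 * p.η / 8 * ‖gradient f (agdY f p x₀ k)‖ ^ 2 := by positivity
    have h1 : 5 / (8 * p.η) = 1 / (2 * p.η) + 1 / (8 * p.η) := by field_simp; norm_num
    rw [h1, add_mul] at h
    linarith

/-- If the last gradient of the epoch is large, the objective drops by `B² / (4η)`. -/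
lemma decrease_of_large_gradient {L ρ χ : ℝ} (hf : SmoothObjective f L ρ) (hp : p.Tuned L ρ χ)
    {x₀ : Vec d} {n : ℕ} (hn : ¬ Triggers f p x₀ n)
    (hg : p.B / p.η < ‖gradient f (agdY f p x₀ n)‖) :
    f (agdX f p x₀ (n + 1)) ≤ f x₀ - p.B ^ 2 / (4 * p.η) := by
  have hη := hp.η_pos
  have h := agd_step_le hf hp x₀ n
  have hH := agd_energy_le hf hp x₀ n
  have h2 := sum_sq_steps_le hn
  rw [sum_sq_steps_eq] at h2
  generalize ∑ t ∈ Finset.range (n - 1), ‖agdX f p x₀ (t + 1) - agdX f p x₀ t‖ ^ 2 = S at *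
  have h3 : p.B ^ 2 / p.η ≤ p.η * ‖gradient f (agdY f p x₀ n)‖ ^ 2 := by
    have : (p.B / p.η) ^ 2 ≤ ‖gradient f (agdY f p x₀ n)‖ ^ 2 :=
      pow_le_pow_left₀ (div_nonneg hp.B_pos.le hη.le) hg.le 2
    calc p.B ^ 2 / p.η = p.η * (p.B / p.η) ^ 2 := by field_simp
      _ ≤ _ := by gcongr
  have h4 : 0 ≤ 1 / (2 * p.η) * ‖agdX f p x₀ (n + 1) - agdX f p x₀ n‖ ^ 2 := by positivity
  have h1 : 5 / (8 * p.η) = 1 / (2 * p.η) + 1 / (8 * p.η) := by field_simp; norm_num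
  rw [h1, add_mul] at h
  -- In units of `B²/η`: earlier steps cost at most `1/8`, the last gradient gains `3/8`.
  have h5 := mul_le_mul_of_nonneg_left h2 (show 0 ≤ 1 / (8 * p.η) by positivity)
  rw [mul_add] at h5
  have e2 : 1 / (8 * p.η) * p.B ^ 2 = 1 / 8 * (p.B ^ 2 / p.η) := by field_simp
  have e3 : p.B ^ 2 / (4 * p.η) = 1 / 4 * (p.B ^ 2 / p.η) := by field_simp
  rw [e3]
  linarith

end Epoch

/-! ### Decrease of the objective per restart. -/

section Decrease

variable {d : ℕ} {f : Vec d → ℝ} {p : Params} {L ρ χ : ℝ}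

lemma inner_eigenvectorBasis_apply {A : Vec d →L[ℝ] Vec d}
    (hA : (A : Vec d →ₗ[ℝ] Vec d).IsSymmetric) (i : Fin d) (v : Vec d) :
    ⟪hA.eigenvectorBasis (n := d) (by simp) i, A v⟫
      = hA.eigenvalues (n := d) (by simp) i * ⟪hA.eigenvectorBasis (n := d) (by simp) i, v⟫ := by
  have h := hA (hA.eigenvectorBasis (n := d) (by simp) i) v
  rw [hA.apply_eigenvectorBasis] at h
  rw [← real_inner_smul_left]
  simpa using h.symm

/-- Along an epoch, the quadratic model of the objective at the starting point decreases, up to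
the squared errors of the linear model of the gradient. -/
lemma quadratic_model_decrease (hf : SmoothObjective f L ρ) (hp : p.Tuned L ρ χ) (x₀ : Vec d)
    (n : ℕ) :
    ⟪gradient f x₀, agdX f p x₀ n - x₀⟫
        + 1 / 2 * ⟪hess f x₀ (agdX f p x₀ n - x₀), agdX f p x₀ n - x₀⟫
      ≤ -(3 * p.θ / (8 * p.η)) *
          ∑ k ∈ Finset.range n, ‖agdX f p x₀ (k + 1) - agdX f p x₀ k‖ ^ 2
        + 2 * p.η / p.θ * ∑ k ∈ Finset.range n, ‖gradient f (agdY f p x₀ k) - gradient f x₀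
          - hess f x₀ (agdY f p x₀ k - x₀)‖ ^ 2 := by
  have hη := hp.η_pos
  have hA := hf.hess_isSymmetric x₀
  set e := hA.eigenvectorBasis (n := d) (by simp) with he
  set l := hA.eigenvalues (n := d) (by simp) with hl
  set δ : ℕ → Vec d := fun k => gradient f (agdY f p x₀ k) - gradient f x₀
          - hess f x₀ (agdY f p x₀ k - x₀) with hδ
  -- Each eigencoordinate of the displacement follows the scalar recursion with curvature `l i` and
  -- error `⟪e i, δ k⟫`. Summing over `i` restores the norms by Parseval.
  have hi : ∀ i, ⟪e i, gradient f x₀⟫ * ⟪e i, agdX f p x₀ n - x₀⟫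
      + l i / 2 * ⟪e i, agdX f p x₀ n - x₀⟫ ^ 2
      ≤ -(3 * p.θ / (8 * p.η)) * ∑ k ∈ Finset.range n,
          (⟪e i, agdX f p x₀ (k + 1) - x₀⟫ - ⟪e i, agdX f p x₀ k - x₀⟫) ^ 2
        + 2 * p.η / p.θ * ∑ k ∈ Finset.range n, ⟪e i, δ k⟫ ^ 2 := by
    intro i
    refine scalar_quadratic_decrease (a := fun k => ⟪e i, agdX f p x₀ k - x₀⟫)
      (δ := fun k => ⟪e i, δ k⟫) hη hp.θ_pos hp.θ_lt ?_ (by simp [agdX_zero]) (fun k => ?_) n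
    · have h1 : |l i| ≤ L :=
        (abs_eigenvalue_le_norm (hA.hasEigenvalue_eigenvalues _ i)).trans
          (hf.norm_hess_le hp.L_pos.le x₀)
      calc |l i| * p.η ≤ L * p.η := by gcongr
        _ ≤ 1 := by rw [hp.L_mul_η]; norm_num
    · have h1 : agdX f p x₀ (k + 1) - x₀ = (agdY f p x₀ k - x₀)
          - p.η • (gradient f x₀ + hess f x₀ (agdY f p x₀ k - x₀) + δ k) := by
        have : gradient f x₀ + hess f x₀ (agdY f p x₀ k - x₀) + δ k
            = gradient f (agdY f p x₀ k) := by
          simp only [hδ, sub_sub, add_sub_cancel]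
        rw [this, agdX_succ]; abel
      have h2 : agdY f p x₀ k - x₀ = (agdX f p x₀ k - x₀)
          + (1 - p.θ) • ((agdX f p x₀ k - x₀) - (agdX f p x₀ (k - 1) - x₀)) := by
        rw [agdY_eq, sub_sub_sub_cancel_right]; abel
      have h3 : ⟪e i, agdY f p x₀ k - x₀⟫ = ⟪e i, agdX f p x₀ k - x₀⟫
          + (1 - p.θ) * (⟪e i, agdX f p x₀ k - x₀⟫ - ⟪e i, agdX f p x₀ (k - 1) - x₀⟫) := by
        rw [h2, inner_add_right, real_inner_smul_right, inner_sub_right (e i) (_ - _) (_ - _)]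
      rw [h1, inner_sub_right, real_inner_smul_right, inner_add_right, inner_add_right,
        inner_eigenvectorBasis_apply hA, ← h3]
  have hsum := Finset.sum_le_sum fun i (_ : i ∈ Finset.univ) => hi i
  rw [Finset.sum_add_distrib, Finset.sum_add_distrib, ← Finset.mul_sum, ← Finset.mul_sum,
    Finset.sum_comm, Finset.sum_comm (f := fun i k => ⟪e i, δ k⟫ ^ 2)] at hsum
  simp only [← inner_sub_right, sub_sub_sub_cancel_right, e.sum_sq_inner_right] at hsum
  refine le_trans (le_of_eq ?_) hsum
  congr 1
  · rw [← e.sum_inner_mul_inner]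
    exact Finset.sum_congr rfl fun i _ => by rw [real_inner_comm]
  · rw [inner_apply_eq_sum hA, Finset.mul_sum]
    exact Finset.sum_congr rfl fun i _ => by ring

namespace Params.Tuned

/-- This product controls both errors of the quadratic model, the gradient error accumulated over an
epoch and the cubic Taylor remainder, relative to `U`. -/
lemma ρ_B_η_K_le (hp : p.Tuned L ρ χ) : ρ * p.B * p.η * p.K ≤ p.θ / 144 := by
  have hθ := hp.θ_pos
  have hχ := hp.one_le
  have hχ0 := hp.χ_pos
  have h : ρ * p.B * p.η = p.θ ^ 2 / (288 * χ ^ 2) := by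
    rw [eq_div_iff (by positivity), ← hp.B_eq]; ring
  rw [h, hp.K_eq]
  have : p.θ ^ 2 / (288 * χ ^ 2) * (2 * χ / p.θ) = p.θ / 144 / χ := by field_simp; norm_num
  rw [this]
  exact div_le_self (by positivity) hχ

/-- The unit in which the decrease per epoch is measured. -/
lemma unit_pos (hp : p.Tuned L ρ χ) : 0 < p.θ * p.B ^ 2 / (p.η * p.K) := by
  have := hp.θ_pos; have := hp.B_pos; have := hp.η_pos; have := hp.K_pos
  positivity

end Params.Tuned

/-- If the last gradient of an epoch that ends in a restart is small, the objective drops in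
proportion to `θ B² / (η K)`. -/
lemma decrease_of_small_gradient (hf : SmoothObjective f L ρ) (hp : p.Tuned L ρ χ)
    {x₀ : Vec d} {n : ℕ} (hn : ∀ k ≤ n, ¬ Triggers f p x₀ k) (hT : Triggers f p x₀ (n + 1))
    (hnK : n + 1 ≤ ⌈p.K⌉₊) (hg : ‖gradient f (agdY f p x₀ n)‖ ≤ p.B / p.η) :
    f (agdX f p x₀ (n + 1)) ≤ f x₀ - 3 / 16 * (p.θ * p.B ^ 2 / (p.η * p.K)) := by
  have hη := hp.η_pos
  have hB := hp.B_pos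
  have hθ := hp.θ_pos
  have hK := hp.K_pos
  have hρ := hp.ρ_pos
  have hu := hp.ρ_B_η_K_le
  have hU := hp.unit_pos
  have hN : ((n + 1 : ℕ) : ℝ) ≤ 3 / 2 * p.K := le_trans (by exact_mod_cast hnK) hp.ceil_K_le
  have hq := quadratic_model_decrease hf hp x₀ (n + 1)
  -- The test fired at `n + 1 ≤ 3K/2`.
  have hS : 2 * p.B ^ 2 / (3 * p.K)
      ≤ ∑ k ∈ Finset.range (n + 1), ‖agdX f p x₀ (k + 1) - agdX f p x₀ k‖ ^ 2 := by
    rw [Triggers] at hT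
    rw [div_le_iff₀ (by positivity)]
    have h0 : 0 ≤ ∑ k ∈ Finset.range (n + 1), ‖agdX f p x₀ (k + 1) - agdX f p x₀ k‖ ^ 2 := by
      positivity
    have := mul_le_mul_of_nonneg_right hN h0
    linarith
  have hE : ∑ k ∈ Finset.range (n + 1), ‖gradient f (agdY f p x₀ k) - gradient f x₀
      - hess f x₀ (agdY f p x₀ k - x₀)‖ ^ 2 ≤ 3 / 2 * p.K * (2 * ρ * p.B ^ 2) ^ 2 := by
    have h1 : ∀ k ∈ Finset.range (n + 1), ‖gradient f (agdY f p x₀ k) - gradient f x₀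
        - hess f x₀ (agdY f p x₀ k - x₀)‖ ^ 2 ≤ (2 * ρ * p.B ^ 2) ^ 2 := by
      intro k hk
      have h2 := norm_agdY_sub_le hB.le hθ.le hp.θ_lt.le
        (hn k (Nat.lt_succ_iff.1 (Finset.mem_range.1 hk)))
      refine pow_le_pow_left₀ (norm_nonneg _) ((hf.norm_gradient_sub_linear_le _ _).trans ?_) 2
      calc ρ / 2 * ‖agdY f p x₀ k - x₀‖ ^ 2 ≤ ρ / 2 * (2 * p.B) ^ 2 := by gcongr
        _ = _ := by ring
    refine (Finset.sum_le_card_nsmul _ _ _ h1).trans ?_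
    rw [Finset.card_range, nsmul_eq_mul]
    gcongr
  -- The step that fires the test is not controlled by the test; the small last gradient bounds it.
  have hd3 : ‖agdX f p x₀ (n + 1) - x₀‖ ≤ 3 * p.B := by
    have h2 := norm_agdY_sub_le hB.le hθ.le hp.θ_lt.le (hn n le_rfl)
    have h3 : ‖p.η • gradient f (agdY f p x₀ n)‖ ≤ p.B := by
      rw [norm_smul, Real.norm_of_nonneg hη.le]
      calc _ ≤ p.η * (p.B / p.η) := by gcongr
        _ = _ := by field_simp
    rw [agdX_succ, sub_right_comm]
    refine (norm_sub_le _ _).trans ?_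
    linarith
  have hc := (abs_le.1 (hf.abs_sub_quadratic_le x₀ (agdX f p x₀ (n + 1)))).2
  have hcube : ρ / 6 * ‖agdX f p x₀ (n + 1) - x₀‖ ^ 3 ≤ ρ / 6 * (3 * p.B) ^ 3 := by gcongr
  have b1 : -(3 * p.θ / (8 * p.η)) *
      ∑ k ∈ Finset.range (n + 1), ‖agdX f p x₀ (k + 1) - agdX f p x₀ k‖ ^ 2
      ≤ -(1 / 4) * (p.θ * p.B ^ 2 / (p.η * p.K)) := by
    have h := mul_le_mul_of_nonneg_left hS (show 0 ≤ 3 * p.θ / (8 * p.η) by positivity)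
    have e : 3 * p.θ / (8 * p.η) * (2 * p.B ^ 2 / (3 * p.K))
        = 1 / 4 * (p.θ * p.B ^ 2 / (p.η * p.K)) := by field_simp; norm_num
    linarith
  have b2 : 2 * p.η / p.θ * (3 / 2 * p.K * (2 * ρ * p.B ^ 2) ^ 2)
      ≤ 12 / 144 ^ 2 * (p.θ * p.B ^ 2 / (p.η * p.K)) := by
    have e : 2 * p.η / p.θ * (3 / 2 * p.K * (2 * ρ * p.B ^ 2) ^ 2)
        = 12 * (p.B ^ 2 / (p.η * p.K * p.θ)) * (ρ * p.B * p.η * p.K) ^ 2 := by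
      field_simp; ring
    have e' : 12 / 144 ^ 2 * (p.θ * p.B ^ 2 / (p.η * p.K))
        = 12 * (p.B ^ 2 / (p.η * p.K * p.θ)) * (p.θ / 144) ^ 2 := by
      field_simp
    rw [e, e']
    gcongr
  have b3 : ρ / 6 * (3 * p.B) ^ 3 ≤ 1 / 32 * (p.θ * p.B ^ 2 / (p.η * p.K)) := by
    have e : ρ / 6 * (3 * p.B) ^ 3
        = 9 / 2 * (p.B ^ 2 / (p.η * p.K)) * (ρ * p.B * p.η * p.K) := by
      field_simp; ring
    have e' : 1 / 32 * (p.θ * p.B ^ 2 / (p.η * p.K))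
        = 9 / 2 * (p.B ^ 2 / (p.η * p.K)) * (p.θ / 144) := by
      field_simp; norm_num
    rw [e, e']
    gcongr
  have b4 := mul_le_mul_of_nonneg_left hE (show 0 ≤ 2 * p.η / p.θ by positivity)
  -- The sum is `-1/4 + 12/144² + 1/32 ≤ -3/16`.
  generalize p.θ * p.B ^ 2 / (p.η * p.K) = U at *
  linarith

/-- A perturbation within the radius raises the objective only slightly where the gradient is
small. -/
lemma perturbation_le (hf : SmoothObjective f L ρ) (hp : p.Tuned L ρ χ) {x ξ : Vec d}
    (hg : ‖gradient f x‖ ≤ 5 / 4 * (p.B / p.η)) (hξ : ‖ξ‖ ≤ p.radius) :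
    f (x + ξ) ≤ f x + 1 / 8 * (p.θ * p.B ^ 2 / (p.η * p.K)) := by
  have hη := hp.η_pos
  have hB := hp.B_pos
  have hθ := hp.θ_pos
  have hK := hp.K_pos
  have h1 : ‖ξ‖ ≤ p.θ * p.B / (20 * p.K) :=
    hξ.trans ((min_le_right _ _).trans (min_le_left _ _))
  have h2 : ‖ξ‖ ^ 2 ≤ p.θ * p.B ^ 2 / (2 * p.K) := by
    have h : ‖ξ‖ ≤ √(p.θ * p.B ^ 2 / (2 * p.K)) :=
      hξ.trans ((min_le_right _ _).trans (min_le_right _ _))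
    calc ‖ξ‖ ^ 2 ≤ √(p.θ * p.B ^ 2 / (2 * p.K)) ^ 2 := by gcongr
      _ = _ := Real.sq_sqrt (by positivity)
  have h3 := (abs_le.1 (hf.abs_sub_linear_le x (x + ξ))).2
  rw [add_sub_cancel_left, hp.L_eq] at h3
  have h4 : ⟪gradient f x, ξ⟫ ≤ 5 / 4 * (p.B / p.η) * (p.θ * p.B / (20 * p.K)) :=
    (real_inner_le_norm _ _).trans (by gcongr)
  have h5 : 1 / (4 * p.η) / 2 * ‖ξ‖ ^ 2 ≤ 1 / (4 * p.η) / 2 * (p.θ * p.B ^ 2 / (2 * p.K)) := by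
    gcongr
  -- The second and third entries of the minimum defining the radius make the linear and the
  -- quadratic term `1/16` of the unit each.
  have e : 5 / 4 * (p.B / p.η) * (p.θ * p.B / (20 * p.K))
      + 1 / (4 * p.η) / 2 * (p.θ * p.B ^ 2 / (2 * p.K))
      = 1 / 8 * (p.θ * p.B ^ 2 / (p.η * p.K)) := by field_simp; norm_num
  linarith

/-- Because `L η = 1/4`. The perturbation rule tests the gradient at `y^{k-1}`, and this transfers
the outcome to `x^k`, with threshold `5/4` or `3/4` of `B/η`. -/
lemma norm_gradient_agdX_succ_le (hf : SmoothObjective f L ρ) (hp : p.Tuned L ρ χ) {x₀ : Vec d}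
    {n : ℕ} : ‖gradient f (agdX f p x₀ (n + 1)) - gradient f (agdY f p x₀ n)‖
      ≤ 1 / 4 * ‖gradient f (agdY f p x₀ n)‖ := by
  have h := hf.lip_grad (agdX f p x₀ (n + 1)) (agdY f p x₀ n)
  rw [agdX_succ, sub_sub_cancel_left, norm_neg, norm_smul, Real.norm_of_nonneg hp.η_pos.le,
    ← mul_assoc, hp.L_mul_η] at h
  exact h

/-- Each restart, the perturbation included, lowers the objective by a fixed amount. -/
lemma restart_decrease (hf : SmoothObjective f L ρ) (hp : p.Tuned L ρ χ)
    {x₀ ξ : Vec d} {n : ℕ} (hn : ∀ k ≤ n, ¬ Triggers f p x₀ k) (hT : Triggers f p x₀ (n + 1))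
    (hnK : n + 1 ≤ ⌈p.K⌉₊) (hξ : ‖ξ‖ ≤ p.radius) :
    f (perturb f p (agdX f p x₀ (n + 1)) (agdY f p x₀ n) ξ)
      ≤ f x₀ - 1 / 16 * (p.θ * p.B ^ 2 / (p.η * p.K)) := by
  have hη := hp.η_pos
  have hB := hp.B_pos
  have hU := hp.unit_pos
  rw [perturb]
  split_ifs with hg
  · have h1 := decrease_of_small_gradient hf hp hn hT hnK hg
    have h2 : ‖gradient f (agdX f p x₀ (n + 1))‖ ≤ 5 / 4 * (p.B / p.η) := by
      have h3 := norm_gradient_agdX_succ_le hf hp (x₀ := x₀) (n := n)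
      have h4 := norm_sub_norm_le (gradient f (agdX f p x₀ (n + 1)))
        (gradient f (agdY f p x₀ n))
      linarith
    have h3 := perturbation_le hf hp h2 hξ
    linarith
  · rw [not_le] at hg
    have h1 := decrease_of_large_gradient hf hp (hn n le_rfl) hg
    have h2 : p.θ * p.B ^ 2 / (p.η * p.K) ≤ p.B ^ 2 / p.η := by
      rw [mul_comm p.η, mul_comm p.θ, mul_comm p.K, ← div_mul_div_comm]
      refine mul_le_of_le_one_right (by positivity) ?_
      rw [div_le_one hp.K_pos]
      linarith [hp.θ_lt, hp.two_lt_K]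
    have e3 : p.B ^ 2 / (4 * p.η) = 1 / 4 * (p.B ^ 2 / p.η) := by field_simp
    linarith

/-- An epoch that starts unperturbed after a large gradient ends in a restart. -/
lemma epochRestarts_of_large_gradient (hp : p.Tuned L ρ χ)
    {x₀ : Vec d} (hg : 3 / 4 * (p.B / p.η) < ‖gradient f x₀‖) : EpochRestarts f p x₀ := by
  have hη := hp.η_pos
  have hB := hp.B_pos
  -- The first step alone, longer than `3B/4`, fires the test at `k = 2`: `2 * (3/4)² > 1`. At `k =
  -- 1` it need not.
  refine ⟨2, hp.two_lt_ceil_K.le, ?_⟩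
  have h1 : agdX f p x₀ 1 - agdX f p x₀ 0 = -(p.η • gradient f x₀) := by
    rw [show (1 : ℕ) = 0 + 1 from rfl, agdX_succ, agdY_zero, agdX_zero]; abel
  have h2 : 3 / 4 * p.B < ‖agdX f p x₀ 1 - agdX f p x₀ 0‖ := by
    rw [h1, norm_neg, norm_smul, Real.norm_of_nonneg hη.le]
    calc 3 / 4 * p.B = p.η * (3 / 4 * (p.B / p.η)) := by field_simp
      _ < _ := by gcongr
  rw [Triggers, Finset.sum_range_succ, Finset.sum_range_one]
  have h3 : (3 / 4 * p.B) ^ 2 < ‖agdX f p x₀ (0 + 1) - agdX f p x₀ 0‖ ^ 2 := by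
    rw [zero_add]; gcongr
  have h4 : 0 ≤ ‖agdX f p x₀ (1 + 1) - agdX f p x₀ 1‖ ^ 2 := by positivity
  push_cast
  nlinarith

end Decrease

/-! ### The averaged output of an epoch without restart. -/

section Output

variable {d : ℕ} {f : Vec d → ℝ} {p : Params} {L ρ χ : ℝ}

/-- As `K` is not rounded, `K > 2` is used to put an integer between `⌊K/2⌋` and `K - 1`. -/
lemma exists_isOutput (hp : p.Tuned L ρ χ) (x₀ : Vec d) : ∃ yhat, IsOutput f p x₀ yhat := by
  have hK := hp.two_lt_K
  have hne : (Finset.Icc ⌊p.K / 2⌋₊ (⌊p.K⌋₊ - 1)).Nonempty := by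
    rw [Finset.nonempty_Icc]
    refine Nat.le_sub_one_of_lt ((Nat.floor_lt' (Nat.floor_pos.2 (by linarith)).ne').2 ?_)
    have := Nat.lt_floor_add_one p.K
    have h2 : (2 : ℝ) ≤ ⌊p.K⌋₊ := by exact_mod_cast Nat.le_floor (by exact_mod_cast hK.le)
    linarith
  have h1 : 1 ≤ ⌊p.K⌋₊ := Nat.floor_pos.2 (by linarith)
  have hmem : ∀ k : ℕ, k ∈ Finset.Icc ⌊p.K / 2⌋₊ (⌊p.K⌋₊ - 1) ↔
      ⌊p.K / 2⌋₊ ≤ k ∧ (k : ℝ) ≤ p.K - 1 := by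
    intro k
    rw [Finset.mem_Icc, le_sub_iff_add_le]
    have : (k : ℝ) + 1 ≤ p.K ↔ k ≤ ⌊p.K⌋₊ - 1 := by
      rw [Nat.le_sub_iff_add_le h1, Nat.le_floor_iff (by linarith)]; push_cast; rfl
    rw [this]
  obtain ⟨K₀, hK₀, hmin⟩ := Finset.exists_min_image _
    (fun k => ‖agdX f p x₀ (k + 1) - agdX f p x₀ k‖) hne
  exact ⟨_, K₀, (hmem K₀).1 hK₀, fun k h h' => hmin k ((hmem k).2 ⟨h, h'⟩), rfl⟩

/-- The shortest step in the second half of an epoch without restart is short. -/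
lemma norm_step_le_of_isMin (hp : p.Tuned L ρ χ) {x₀ : Vec d} {s : ℝ} (hs : 0 ≤ s)
    (hn : ∀ k ≤ ⌈p.K⌉₊, ¬ Triggers f p x₀ k)
    (hmin : ∀ k : ℕ, ⌊p.K / 2⌋₊ ≤ k → (k : ℝ) ≤ p.K - 1 →
      s ≤ ‖agdX f p x₀ (k + 1) - agdX f p x₀ k‖) :
    s ≤ 3 * p.B / p.K := by
  have hK := hp.two_lt_K
  have hB := hp.B_pos
  set M := ⌊p.K⌋₊ with hM
  have hM1 : 1 ≤ M := Nat.floor_pos.2 (by linarith)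
  have hMK : 2 / 3 * p.K ≤ (M : ℝ) := by
    have h1 := Nat.lt_floor_add_one p.K
    have h2 : (2 : ℝ) ≤ M := by exact_mod_cast Nat.le_floor (by exact_mod_cast hK.le)
    rw [← hM] at h1
    linarith
  have hhalf : ⌊p.K / 2⌋₊ * 2 ≤ M := by
    rw [hM, Nat.le_floor_iff (by linarith)]
    push_cast
    have := Nat.floor_le (show 0 ≤ p.K / 2 by linarith)
    linarith
  have hT := hn M (Nat.floor_le_ceil _)
  rw [Triggers, not_lt] at hT
  have hsub : Finset.Ico ⌊p.K / 2⌋₊ M ⊆ Finset.range M := fun k hk =>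
    Finset.mem_range.2 (Finset.mem_Ico.1 hk).2
  -- At least half of the first `M` steps have an index in the range of the minimum.
  have h1 : ((M : ℝ) / 2) * s ^ 2
      ≤ ∑ t ∈ Finset.range M, ‖agdX f p x₀ (t + 1) - agdX f p x₀ t‖ ^ 2 := by
    calc ((M : ℝ) / 2) * s ^ 2 ≤ ((M - ⌊p.K / 2⌋₊ : ℕ) : ℝ) * s ^ 2 := by
          gcongr
          rw [Nat.cast_sub (by omega)]
          have : (⌊p.K / 2⌋₊ : ℝ) * 2 ≤ M := by exact_mod_cast hhalf
          linarith
      _ = (Finset.Ico ⌊p.K / 2⌋₊ M).card • s ^ 2 := by simp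
      _ ≤ ∑ t ∈ Finset.Ico ⌊p.K / 2⌋₊ M, ‖agdX f p x₀ (t + 1) - agdX f p x₀ t‖ ^ 2 := by
          refine Finset.card_nsmul_le_sum _ _ _ fun k hk => ?_
          rw [Finset.mem_Ico] at hk
          refine pow_le_pow_left₀ hs (hmin k hk.1 ?_) 2
          have : ((k + 1 : ℕ) : ℝ) ≤ M := by exact_mod_cast hk.2
          have h2 := Nat.floor_le (show 0 ≤ p.K by linarith)
          rw [← hM] at h2
          push_cast at this
          linarith
      _ ≤ _ := Finset.sum_le_sum_of_subset_of_nonneg hsub fun _ _ _ => by positivity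
  have h2 : (M : ℝ) * ((M : ℝ) / 2 * s ^ 2) ≤ p.B ^ 2 :=
    (mul_le_mul_of_nonneg_left h1 (by positivity)).trans hT
  have h3 : (2 / 3 * p.K) * (2 / 3 * p.K / 2 * s ^ 2) ≤ p.B ^ 2 := by
    refine le_trans ?_ h2
    have : 0 ≤ 2 / 3 * p.K := by linarith
    gcongr
  rw [le_div_iff₀ (by linarith)]
  refine le_of_sq_le_sq ?_ (by positivity)
  nlinarith

/-- The update reads `η ∇f(y^k) = (1-θ)(x^k - x^{k-1}) - (x^{k+1} - x^k)`; summing leaves only the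
last step and `θ` times the displacement. This is why `K₀` is chosen to make the last step short. -/
lemma sum_gradient_agdY (x₀ : Vec d) (n : ℕ) :
    p.η • ∑ k ∈ Finset.range (n + 1), gradient f (agdY f p x₀ k)
      = -((agdX f p x₀ (n + 1) - agdX f p x₀ n) + p.θ • (agdX f p x₀ n - x₀)) := by
  induction n with
  | zero =>
    rw [Finset.sum_range_one, agdX_succ, agdY_zero, agdX_zero]
    simp
  | succ n ih =>
    rw [Finset.sum_range_succ, smul_add, ih, agdX_succ f p x₀ (n + 1), agdY_eq f p x₀ (n + 1),
      Nat.add_sub_cancel]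
    module

lemma isOutput_norm_sub_le (hp : p.Tuned L ρ χ) {x₀ yhat : Vec d}
    (hn : ∀ k ≤ ⌈p.K⌉₊, ¬ Triggers f p x₀ k) (hy : IsOutput f p x₀ yhat) :
    ‖yhat - x₀‖ ≤ 2 * p.B := by
  obtain ⟨K₀, ⟨-, hK⟩, -, rfl⟩ := hy
  have hpos : (0 : ℝ) < (K₀ : ℝ) + 1 := by positivity
  have e : (1 / ((K₀ : ℝ) + 1)) • ∑ k ∈ Finset.range (K₀ + 1), agdY f p x₀ k - x₀
      = (1 / ((K₀ : ℝ) + 1)) • ∑ k ∈ Finset.range (K₀ + 1), (agdY f p x₀ k - x₀) := by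
    rw [Finset.sum_sub_distrib, smul_sub, Finset.sum_const, Finset.card_range,
      ← Nat.cast_smul_eq_nsmul ℝ, smul_smul]
    push_cast
    rw [one_div_mul_cancel hpos.ne', one_smul]
  rw [e, norm_smul, Real.norm_of_nonneg (by positivity), one_div, inv_mul_le_iff₀ hpos]
  suffices hb : ∀ k ∈ Finset.range (K₀ + 1), ‖agdY f p x₀ k - x₀‖ ≤ 2 * p.B from
    (norm_sum_le _ _).trans ((Finset.sum_le_card_nsmul _ _ _ hb).trans_eq (by simp))
  intro k hk
  refine norm_agdY_sub_le hp.B_pos.le hp.θ_pos.le hp.θ_lt.le (hn k ?_)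
  have h1 : k ≤ K₀ := Nat.lt_succ_iff.1 (Finset.mem_range.1 hk)
  have h2 : (K₀ : ℝ) ≤ ⌈p.K⌉₊ := by linarith [Nat.le_ceil p.K]
  exact h1.trans (by exact_mod_cast h2)

/-- Up to the errors `E` of the linear model, the gradient at the average is the average of the
gradients, which telescopes. The bound is `ε` for the actual parameters (`params_ε`). -/
lemma isOutput_norm_gradient_le (hf : SmoothObjective f L ρ) (hp : p.Tuned L ρ χ)
    {x₀ yhat : Vec d} (hn : ∀ k ≤ ⌈p.K⌉₊, ¬ Triggers f p x₀ k) (hy : IsOutput f p x₀ yhat) :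
    ‖gradient f yhat‖ ≤ 288 * χ ^ 2 * p.B * p.θ ^ 2 / p.η := by
  have hη := hp.η_pos
  have hB := hp.B_pos
  have hθ := hp.θ_pos
  have hK := hp.two_lt_K
  have hρ := hp.ρ_pos
  have hχ := hp.one_le
  have hdist := isOutput_norm_sub_le hp hn hy
  obtain ⟨K₀, ⟨hK₁, hK₂⟩, hmin, rfl⟩ := hy
  have hs := norm_step_le_of_isMin hp (norm_nonneg _) hn hmin
  have hpos : (0 : ℝ) < (K₀ : ℝ) + 1 := by positivity
  have hKc : K₀ ≤ ⌈p.K⌉₊ := by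
    have h2 : (K₀ : ℝ) ≤ ⌈p.K⌉₊ := by linarith [Nat.le_ceil p.K]
    exact_mod_cast h2
  set yhat := (1 / ((K₀ : ℝ) + 1)) • ∑ k ∈ Finset.range (K₀ + 1), agdY f p x₀ k with hyhat
  set E : Vec d → Vec d := fun y => gradient f y - gradient f x₀ - hess f x₀ (y - x₀) with hE
  have hEb : ∀ y, ‖y - x₀‖ ≤ 2 * p.B → ‖E y‖ ≤ 2 * ρ * p.B ^ 2 := by
    intro y hy
    refine (hf.norm_gradient_sub_linear_le x₀ y).trans ?_
    calc ρ / 2 * ‖y - x₀‖ ^ 2 ≤ ρ / 2 * (2 * p.B) ^ 2 := by gcongr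
      _ = _ := by ring
  have e1 : gradient f yhat = E yhat
      + (1 / ((K₀ : ℝ) + 1)) • ∑ k ∈ Finset.range (K₀ + 1), gradient f (agdY f p x₀ k)
      - (1 / ((K₀ : ℝ) + 1)) • ∑ k ∈ Finset.range (K₀ + 1), E (agdY f p x₀ k) := by
    have hc : ∀ v : Vec d, (1 / ((K₀ : ℝ) + 1)) • ∑ k ∈ Finset.range (K₀ + 1), v = v := by
      intro v
      rw [Finset.sum_const, Finset.card_range, ← Nat.cast_smul_eq_nsmul ℝ, smul_smul]
      push_cast
      rw [one_div_mul_cancel hpos.ne', one_smul]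
    have h1 : (1 / ((K₀ : ℝ) + 1)) • ∑ k ∈ Finset.range (K₀ + 1), E (agdY f p x₀ k)
        = (1 / ((K₀ : ℝ) + 1)) • ∑ k ∈ Finset.range (K₀ + 1), gradient f (agdY f p x₀ k)
          - gradient f x₀ - hess f x₀ (yhat - x₀) := by
      have h2 : hess f x₀ yhat
          = (1 / ((K₀ : ℝ) + 1)) • ∑ k ∈ Finset.range (K₀ + 1), hess f x₀ (agdY f p x₀ k) := by
        rw [hyhat, map_smul, map_sum]
      simp only [hE, map_sub, Finset.sum_sub_distrib, smul_sub, hc, h2]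
    rw [h1]
    simp only [hE]
    abel
  have b1 : ‖(1 / ((K₀ : ℝ) + 1)) • ∑ k ∈ Finset.range (K₀ + 1), E (agdY f p x₀ k)‖
      ≤ 2 * ρ * p.B ^ 2 := by
    rw [norm_smul, Real.norm_of_nonneg (by positivity), one_div, inv_mul_le_iff₀ hpos]
    suffices hb : ∀ k ∈ Finset.range (K₀ + 1), ‖E (agdY f p x₀ k)‖ ≤ 2 * ρ * p.B ^ 2 from
      (norm_sum_le _ _).trans ((Finset.sum_le_card_nsmul _ _ _ hb).trans_eq (by simp))
    intro k hk
    refine hEb _ (norm_agdY_sub_le hB.le hθ.le hp.θ_lt.le (hn k ?_))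
    exact (Nat.lt_succ_iff.1 (Finset.mem_range.1 hk)).trans hKc
  have b2 : ‖(1 / ((K₀ : ℝ) + 1)) • ∑ k ∈ Finset.range (K₀ + 1), gradient f (agdY f p x₀ k)‖
      ≤ 2 / p.K * ((3 * p.B / p.K + p.θ * p.B) / p.η) := by
    have h1 : ‖p.η • ∑ k ∈ Finset.range (K₀ + 1), gradient f (agdY f p x₀ k)‖
        ≤ 3 * p.B / p.K + p.θ * p.B := by
      rw [sum_gradient_agdY, norm_neg]
      refine (norm_add_le _ _).trans (add_le_add hs ?_)
      rw [norm_smul, Real.norm_of_nonneg hθ.le]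
      gcongr
      exact norm_agdX_sub_le hB.le (hn K₀ hKc)
    rw [norm_smul, Real.norm_of_nonneg hη.le, mul_comm, ← le_div_iff₀ hη] at h1
    rw [norm_smul, Real.norm_of_nonneg (by positivity)]
    have h2 : 1 / ((K₀ : ℝ) + 1) ≤ 2 / p.K := by
      rw [div_le_div_iff₀ hpos (by linarith)]
      have := Nat.lt_floor_add_one (p.K / 2)
      have h3 : (⌊p.K / 2⌋₊ : ℝ) ≤ K₀ := by exact_mod_cast hK₁
      linarith
    gcongr
  have b3 : ρ * p.B ^ 2 ≤ p.B * p.θ ^ 2 / p.η / 288 := by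
    have h : ρ * p.B ^ 2 = p.B * p.θ ^ 2 / p.η / 288 / χ ^ 2 := by
      rw [← hp.B_eq]; field_simp
    rw [h]
    exact div_le_self (by positivity) (by nlinarith)
  -- Both contributions are of order `Bθ²/η`, since `1/K = θ/(2χ) ≤ θ/2`.
  have b4 : 2 / p.K * ((3 * p.B / p.K + p.θ * p.B) / p.η) ≤ 5 / 2 * (p.B * p.θ ^ 2 / p.η) := by
    have hi : 1 / p.K ≤ p.θ / 2 := by
      rw [hp.K_eq, one_div_div]
      gcongr
      linarith
    have e : 2 / p.K * ((3 * p.B / p.K + p.θ * p.B) / p.η)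
        = 2 * p.B / p.η * ((1 / p.K) * (3 * (1 / p.K) + p.θ)) := by
      field_simp
    have e' : 5 / 2 * (p.B * p.θ ^ 2 / p.η)
        = 2 * p.B / p.η * (p.θ / 2 * (3 * (p.θ / 2) + p.θ)) := by
      field_simp; norm_num
    rw [e, e']
    have : 0 ≤ 1 / p.K := by positivity
    gcongr
  have b5 : p.B * p.θ ^ 2 / p.η ≤ χ ^ 2 * (p.B * p.θ ^ 2 / p.η) :=
    le_mul_of_one_le_left (by positivity) (by nlinarith)
  have e5 : 288 * χ ^ 2 * p.B * p.θ ^ 2 / p.η = 288 * (χ ^ 2 * (p.B * p.θ ^ 2 / p.η)) := by ring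
  have b6 := hEb _ hdist
  have b7 : 0 ≤ p.B * p.θ ^ 2 / p.η := by positivity
  rw [e5, e1]
  refine (norm_sub_le _ _).trans ?_
  refine (add_le_add_left (norm_add_le _ _) _).trans ?_
  linarith

end Output

/-! ### From the loop to the sequence of epochs. -/

section Bookkeeping

variable {d : ℕ} (f : Vec d → ℝ) (p : Params)

open Classical in
/-- The counter at which the epoch that starts at `z` ends, by a restart or by reaching `K`. -/
noncomputable def stopTime (z : Vec d) : ℕ :=
  Nat.find (p := fun k => Triggers f p z k ∨ k = ⌈p.K⌉₊) ⟨⌈p.K⌉₊, Or.inr rfl⟩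

/-- The last iterate of the epoch that starts at `z`. -/
noncomputable def epochEnd (z : Vec d) : Vec d := agdX f p z (stopTime f p z)

/-- The point at which the last gradient of the epoch that starts at `z` is evaluated. -/
noncomputable def epochLastY (z : Vec d) : Vec d := agdY f p z (stopTime f p z - 1)

/-- The starting points of the successive epochs. -/
noncomputable def epochStart (x₀ : Vec d) (ξ : ℕ → Vec d) : ℕ → Vec d
  | 0 => x₀
  | n + 1 => perturb f p (epochEnd f p (epochStart x₀ ξ n)) (epochLastY f p (epochStart x₀ ξ n))
      (ξ n)

variable {f p}

lemma not_triggers_zero (z : Vec d) : ¬ Triggers f p z 0 := by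
  simp only [Triggers, Nat.cast_zero, zero_mul, not_lt]
  positivity

lemma not_triggers_of_lt_stopTime {z : Vec d} {k : ℕ} (hk : k < stopTime f p z) :
    ¬ Triggers f p z k := by
  classical
  exact fun h => Nat.find_min (p := fun k => Triggers f p z k ∨ k = ⌈p.K⌉₊) _ hk (Or.inl h)

lemma stopTime_le (z : Vec d) : stopTime f p z ≤ ⌈p.K⌉₊ := by
  classical
  exact Nat.find_min' (p := fun k => Triggers f p z k ∨ k = ⌈p.K⌉₊) _ (Or.inr rfl)

lemma triggers_stopTime {z : Vec d} (h : EpochRestarts f p z) :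
    Triggers f p z (stopTime f p z) := by
  classical
  obtain ⟨k, hk, hT⟩ := h
  rcases Nat.find_spec (p := fun k => Triggers f p z k ∨ k = ⌈p.K⌉₊) ⟨⌈p.K⌉₊, Or.inr rfl⟩ with h | h
  · exact h
  · have h1 : stopTime f p z ≤ k :=
      Nat.find_min' (p := fun k => Triggers f p z k ∨ k = ⌈p.K⌉₊) _ (Or.inl hT)
    have h2 : stopTime f p z = ⌈p.K⌉₊ := h
    have : stopTime f p z = k := by omega
    rwa [this]

lemma stopTime_pos {z : Vec d} (h : EpochRestarts f p z) : 0 < stopTime f p z :=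
  Nat.pos_of_ne_zero fun h0 => not_triggers_zero z (h0 ▸ triggers_stopTime h)

lemma iterate_step_of_not_triggers (ξ : ℕ → Vec d) (z : Vec d) (n : ℕ) {k : ℕ} (hk : k ≤ ⌈p.K⌉₊)
    (hn : ∀ j ≤ k, ¬ Triggers f p z j) : (step f p ξ)^[k] ⟨z, 0, n⟩ = ⟨z, k, n⟩ := by
  induction k with
  | zero => rfl
  | succ k ih =>
    rw [Function.iterate_succ_apply', ih (by omega) fun j hj => hn j (by omega), step,
      if_pos (Nat.lt_ceil.1 (by simpa using hk)), if_neg (hn (k + 1) le_rfl)]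

lemma iterate_step_of_epochRestarts (ξ : ℕ → Vec d) {z : Vec d} (n : ℕ)
    (h : EpochRestarts f p z) :
    (step f p ξ)^[stopTime f p z] ⟨z, 0, n⟩
      = ⟨perturb f p (epochEnd f p z) (epochLastY f p z) (ξ n), 0, n + 1⟩ := by
  obtain ⟨m, hm⟩ := Nat.exists_eq_succ_of_ne_zero (stopTime_pos h).ne'
  have hle := stopTime_le (f := f) (p := p) z
  rw [hm, Nat.succ_eq_add_one, Function.iterate_succ_apply',
    iterate_step_of_not_triggers ξ z n (by omega)
      fun j hj => not_triggers_of_lt_stopTime (by omega), step]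
  have hT := triggers_stopTime h
  rw [hm] at hT
  rw [if_pos (Nat.lt_ceil.1 (by simp only; omega)), if_pos hT]
  simp [epochEnd, epochLastY, hm]

/-- Concatenates restarting epochs. Each takes at most `⌈K⌉` passes, and the loop condition holds
throughout, so the method has not stopped before. -/
lemma exists_run_eq_epochStart (x₀ : Vec d) (ξ : ℕ → Vec d) (N : ℕ)
    (h : ∀ n < N, EpochRestarts f p (epochStart f p x₀ ξ n)) :
    ∃ T ≤ N * ⌈p.K⌉₊, run f p x₀ ξ T = ⟨epochStart f p x₀ ξ N, 0, N⟩ ∧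
      ∀ t < T, ((run f p x₀ ξ t).k : ℝ) < p.K := by
  induction N with
  | zero => exact ⟨0, by simp, rfl, by simp⟩
  | succ N ih =>
    obtain ⟨T, hT, hrun, hlt⟩ := ih fun n hn => h n (by omega)
    have hN := h N (by omega)
    set z := epochStart f p x₀ ξ N with hz
    have hadd : ∀ j, run f p x₀ ξ (T + j) = (step f p ξ)^[j] ⟨z, 0, N⟩ := by
      intro j
      rw [← hrun, run, run, add_comm, Function.iterate_add_apply]
    refine ⟨T + stopTime f p z, ?_, ?_, ?_⟩
    · rw [Nat.succ_mul]; exact Nat.add_le_add hT (stopTime_le z)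
    · rw [hadd, iterate_step_of_epochRestarts ξ N hN]; rfl
    · intro t ht
      rcases lt_or_ge t T with h1 | h1
      · exact hlt t h1
      · obtain ⟨j, rfl⟩ := Nat.exists_eq_add_of_le h1
        have hj : j < stopTime f p z := by omega
        have hle := stopTime_le (f := f) (p := p) z
        rw [hadd, iterate_step_of_not_triggers ξ z N (by omega)
          fun i hi => not_triggers_of_lt_stopTime (by omega)]
        exact Nat.lt_ceil.1 (by simp only; omega)

lemma exists_haltsAt (x₀ : Vec d) (ξ : ℕ → Vec d) (N : ℕ)
    (h : ∀ n < N, EpochRestarts f p (epochStart f p x₀ ξ n))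
    (hN : ¬ EpochRestarts f p (epochStart f p x₀ ξ N)) :
    ∃ T ≤ (N + 1) * ⌈p.K⌉₊, HaltsAt f p x₀ ξ T ∧
      (run f p x₀ ξ T).start = epochStart f p x₀ ξ N := by
  obtain ⟨T, hT, hrun, hlt⟩ := exists_run_eq_epochStart x₀ ξ N h
  set z := epochStart f p x₀ ξ N with hz
  have hn : ∀ k ≤ ⌈p.K⌉₊, ¬ Triggers f p z k := fun k hk hT => hN ⟨k, hk, hT⟩
  have hadd : ∀ j ≤ ⌈p.K⌉₊, run f p x₀ ξ (T + j) = ⟨z, j, N⟩ := by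
    intro j hj
    rw [← iterate_step_of_not_triggers ξ z N hj fun i hi => hn i (hi.trans hj), ← hrun, run, run,
      add_comm, Function.iterate_add_apply]
  refine ⟨T + ⌈p.K⌉₊, ?_, ⟨?_, ?_⟩, ?_⟩
  · rw [Nat.succ_mul]; exact Nat.add_le_add_right hT _
  · rw [hadd _ le_rfl]; exact Nat.le_ceil _
  · intro t ht
    rcases lt_or_ge t T with h1 | h1
    · exact hlt t h1
    · obtain ⟨j, rfl⟩ := Nat.exists_eq_add_of_le h1
      rw [hadd j (by omega)]
      exact Nat.lt_ceil.1 (by simp only; omega)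
  · rw [hadd _ le_rfl]

variable {L ρ χ : ℝ}

lemma gap_nonneg (hf : SmoothObjective f L ρ) (x : Vec d) : 0 ≤ gap f x :=
  sub_nonneg.2 (ciInf_le hf.bdd x)

lemma epochStart_succ_le (hf : SmoothObjective f L ρ) (hp : p.Tuned L ρ χ) {x₀ : Vec d}
    {ξ : ℕ → Vec d} {n : ℕ} (hξ : ‖ξ n‖ ≤ p.radius)
    (h : EpochRestarts f p (epochStart f p x₀ ξ n)) :
    f (epochStart f p x₀ ξ (n + 1))
      ≤ f (epochStart f p x₀ ξ n) - 1 / 16 * (p.θ * p.B ^ 2 / (p.η * p.K)) := by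
  set z := epochStart f p x₀ ξ n with hz
  obtain ⟨m, hm⟩ := Nat.exists_eq_succ_of_ne_zero (stopTime_pos h).ne'
  have hT := triggers_stopTime h
  rw [hm] at hT
  have hle := stopTime_le (f := f) (p := p) z
  have := restart_decrease hf hp (x₀ := z) (ξ := ξ n) (n := m)
    (fun k hk => not_triggers_of_lt_stopTime (by omega)) hT (by omega) hξ
  rw [epochStart, ← hz, epochEnd, epochLastY, hm]
  exact this

/-- For perturbations within the radius the number of restarts is bounded by the gap. -/
lemma exists_last_epoch (hf : SmoothObjective f L ρ) (hp : p.Tuned L ρ χ) (x₀ : Vec d)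
    {ξ : ℕ → Vec d} (hξ : ∀ n, ‖ξ n‖ ≤ p.radius) :
    ∃ N : ℕ, (N : ℝ) * (p.θ * p.B ^ 2 / (p.η * p.K)) ≤ 16 * gap f x₀ ∧
      (∀ n < N, EpochRestarts f p (epochStart f p x₀ ξ n)) ∧
      ¬ EpochRestarts f p (epochStart f p x₀ ξ N) := by
  classical
  have hU := hp.unit_pos
  set U := p.θ * p.B ^ 2 / (p.η * p.K) with hUdef
  -- This serves twice: it rules out endless restarts and bounds their number.
  have H : ∀ N : ℕ, (∀ n < N, EpochRestarts f p (epochStart f p x₀ ξ n)) →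
      (N : ℝ) * U ≤ 16 * gap f x₀ := by
    intro N hN
    have h1 : f (epochStart f p x₀ ξ N) ≤ f x₀ - N * (1 / 16 * U) := by
      induction N with
      | zero => simp [epochStart]
      | succ N ih =>
        have h2 := ih fun n hn => hN n (by omega)
        have h3 := epochStart_succ_le hf hp (hξ N) (hN N (by omega))
        push_cast
        linarith
    have h2 := ciInf_le hf.bdd (epochStart f p x₀ ξ N)
    rw [gap]
    linarith
  have hex : ∃ N, ¬ EpochRestarts f p (epochStart f p x₀ ξ N) := by
    by_contra! hall
    obtain ⟨N, hN⟩ := exists_nat_gt (16 * gap f x₀ / U)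
    rw [div_lt_iff₀ hU] at hN
    linarith [H N fun n _ => hall n]
  refine ⟨Nat.find hex, ?_, ?_, Nat.find_spec hex⟩
  · exact H _ fun n hn => not_not.1 (Nat.find_min hex hn)
  · exact fun n hn => not_not.1 (Nat.find_min hex hn)

/-- A sufficient condition for the method to achieve a property of its output. -/
lemma achieves_of_last_epoch (hp : p.Tuned L ρ χ) {x₀ : Vec d}
    {ξ : ℕ → Vec d} {N : ℕ} {b : ℝ} {Q : Vec d → Prop}
    (h : ∀ n < N, EpochRestarts f p (epochStart f p x₀ ξ n))
    (hN : ¬ EpochRestarts f p (epochStart f p x₀ ξ N))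
    (hb : ((N : ℝ) + 1) * (3 / 2 * p.K) ≤ b)
    (hQ : ∀ yhat, IsOutput f p (epochStart f p x₀ ξ N) yhat → Q yhat) :
    Achieves f p x₀ ξ b Q := by
  obtain ⟨T, hT, hhalt, hstart⟩ := exists_haltsAt x₀ ξ N h hN
  refine ⟨T, ?_, ?_, ?_⟩
  · refine le_trans ?_ hb
    calc (T : ℝ) ≤ (((N + 1) * ⌈p.K⌉₊ : ℕ) : ℝ) := by exact_mod_cast hT
      _ = ((N : ℝ) + 1) * ⌈p.K⌉₊ := by push_cast; ring
      _ ≤ _ := by gcongr; exact hp.ceil_K_le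
  · obtain ⟨y, hy⟩ := exists_isOutput (f := f) hp (epochStart f p x₀ ξ N)
    exact ⟨y, hhalt, hstart ▸ hy⟩
  · exact fun y hy => hQ y (hstart ▸ hy.2)

end Bookkeeping

/-! ### Growth in the linear momentum recurrence. -/

section MomentumRecurrence

/-- `μ` and `ν` are the characteristic roots of the momentum recurrence
`u (k+1) = (1+γ) ((2-θ) u k - (1-θ) u (k-1))`. -/
structure MomentumRoots (θ γ μ ν : ℝ) : Prop where
  add_eq : μ + ν = (1 + γ) * (2 - θ)
  mul_eq : μ * ν = (1 + γ) * (1 - θ)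
  ν_nonneg : 0 ≤ ν
  ν_le : ν ≤ μ
  le_μ : 1 + θ / 2 ≤ μ
  γ_le : 1 + γ ≤ μ

/-- Both lower bounds on `μ` hold because the characteristic polynomial is negative at `1 + θ/2` and
at `1 + γ`, so these points lie between its roots. At `1 + θ/2` this uses `θ² ≤ γ`. -/
lemma exists_momentumRoots {θ γ : ℝ} (hθ : 0 < θ) (hθ1 : θ < 1) (hγ : θ ^ 2 ≤ γ) :
    ∃ μ ν, MomentumRoots θ γ μ ν := by
  have hγ0 : 0 < γ := lt_of_lt_of_le (by positivity) hγ
  set s := (1 + γ) * (2 - θ) with hs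
  set q := (1 + γ) * (1 - θ) with hq
  have hq0 : 0 ≤ q := mul_nonneg (by linarith) (by linarith)
  have hs0 : 0 ≤ s := mul_nonneg (by linarith) (by linarith)
  have hD : 0 ≤ s ^ 2 - 4 * q := by
    have : s ^ 2 - 4 * q = (1 + γ) * (θ ^ 2 + γ * (2 - θ) ^ 2) := by rw [hs, hq]; ring
    rw [this]; positivity
  have hR := Real.sq_sqrt hD
  have hR0 := Real.sqrt_nonneg (s ^ 2 - 4 * q)
  set R := √(s ^ 2 - 4 * q)
  have hRs : R ≤ s := abs_le_of_sq_le_sq' (by linarith) hs0 |>.2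
  have key : ∀ z, (z - (s + R) / 2) * (z - (s - R) / 2) < 0 → z ≤ (s + R) / 2 := by
    intro z hz
    by_contra! h
    have : 0 ≤ (z - (s + R) / 2) * (z - (s - R) / 2) := mul_nonneg (by linarith) (by linarith)
    linarith
  have hz : ∀ z, (z - (s + R) / 2) * (z - (s - R) / 2) = z ^ 2 - s * z + q := by
    intro z; linear_combination (-1 / 4) * hR
  refine ⟨(s + R) / 2, (s - R) / 2, by ring, by linear_combination (-1 / 4) * hR, by linarith,
    by linarith, key _ ?_, key _ ?_⟩
  · rw [hz]
    have : (1 + θ / 2) ^ 2 - s * (1 + θ / 2) + q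
        = 3 / 4 * θ ^ 2 - γ * (1 + θ - θ ^ 2 / 2) := by rw [hs, hq]; ring
    rw [this]
    have h1 : 1 ≤ 1 + θ - θ ^ 2 / 2 := by nlinarith
    nlinarith
  · rw [hz]
    have : (1 + γ) ^ 2 - s * (1 + γ) + q = -((1 + γ) * (1 - θ) * γ) := by rw [hs, hq]; ring
    rw [this, neg_lt_zero]
    exact mul_pos (mul_pos (by linarith) (by linarith)) hγ0

variable {θ γ μ ν : ℝ}

lemma MomentumRoots.one_le (h : MomentumRoots θ γ μ ν) (hθ : 0 < θ) : 1 ≤ μ := by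
  linarith [h.le_μ]

/-- The solution of the momentum recurrence that starts at rest at `1`. -/
noncomputable def momentumSol (θ γ : ℝ) : ℕ → ℝ
  | 0 => 1
  | 1 => 1 + γ
  | k + 2 => (1 + γ) * ((2 - θ) * momentumSol θ γ (k + 1) - (1 - θ) * momentumSol θ γ k)

lemma momentumSol_succ (θ γ : ℝ) (k : ℕ) : momentumSol θ γ (k + 1)
    = (1 + γ) * ((2 - θ) * momentumSol θ γ k - (1 - θ) * momentumSol θ γ (k - 1)) := by
  cases k with
  | zero => simp only [momentumSol, Nat.zero_sub]; ring
  | succ k => rfl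

/-- Splitting off the root `ν` leaves a geometric sequence of ratio `μ`. The upper bound then
propagates by `1 + γ ≤ μ`, the lower one by `(μ + ν)/2 ≤ 1 + γ`. -/
lemma momentumSol_mem (h : MomentumRoots θ γ μ ν) (hθ : 0 < θ) (hγ : 0 ≤ γ) (k : ℕ) :
    1 / 2 * μ ^ k ≤ momentumSol θ γ k ∧ momentumSol θ γ k ≤ μ ^ k := by
  have hμ := h.one_le hθ
  have hrec : ∀ k, momentumSol θ γ (k + 1) = ν * momentumSol θ γ k + μ ^ k * (1 + γ - ν) := by
    intro k
    induction k with
    | zero => simp only [momentumSol]; ring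
    | succ k ih =>
      have e : momentumSol θ γ (k + 2)
          = (μ + ν) * momentumSol θ γ (k + 1) - μ * ν * momentumSol θ γ k := by
        rw [h.add_eq, h.mul_eq, momentumSol]; ring
      rw [e]
      linear_combination μ * ih
  induction k with
  | zero => simp only [momentumSol]; norm_num
  | succ k ih =>
    have hk : 0 ≤ μ ^ k := by positivity
    have h1 := mul_le_mul_of_nonneg_left ih.1 h.ν_nonneg
    have h2 := mul_le_mul_of_nonneg_left ih.2 h.ν_nonneg
    rw [hrec, pow_succ]
    constructor
    · have h3 : μ / 2 + ν / 2 ≤ 1 + γ := by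
        have := h.add_eq
        nlinarith
      have := mul_le_mul_of_nonneg_left h3 hk
      linarith
    · have := mul_le_mul_of_nonneg_left h.γ_le hk
      linarith

/-- The impulse response of the momentum recurrence with factor `a`. -/
noncomputable def impulse (θ a : ℝ) : ℕ → ℝ
  | 0 => 1
  | 1 => a * (2 - θ)
  | m + 2 => a * ((2 - θ) * impulse θ a (m + 1) - (1 - θ) * impulse θ a m)

/-- No smaller factor `a` produces a root beyond `μ`. A real root above `μ` would make the
polynomial for `1 + γ` nonpositive to the right of its largest root; a conjugate pair has squared
modulus `a(1-θ) ≤ μν ≤ μ²`. -/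
lemma exists_complex_roots (h : MomentumRoots θ γ μ ν) (hθ : 0 < θ) (hθ1 : θ < 1) {a : ℝ}
    (ha : 0 < a) (haγ : a ≤ 1 + γ) :
    ∃ z w : ℂ, z + w = ((a * (2 - θ) : ℝ) : ℂ) ∧ z * w = ((a * (1 - θ) : ℝ) : ℂ) ∧
      ‖z‖ ≤ μ ∧ ‖w‖ ≤ μ := by
  have hμ := h.one_le hθ
  set s := a * (2 - θ) with hs
  set q := a * (1 - θ) with hq
  have hs0 : 0 ≤ s := mul_nonneg ha.le (by linarith)
  have hq0 : 0 < q := mul_pos ha (by linarith)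
  rcases le_total 0 (s ^ 2 - 4 * q) with hD | hD
  · have hR := Real.sq_sqrt hD
    have hR0 := Real.sqrt_nonneg (s ^ 2 - 4 * q)
    set R := √(s ^ 2 - 4 * q)
    have hRs : R ≤ s := abs_le_of_sq_le_sq' (by linarith) hs0 |>.2
    have key : ∀ z : ℝ, 0 ≤ z → z ^ 2 = s * z - q → ‖(z : ℂ)‖ ≤ μ := by
      intro z hz0 hz
      rw [Complex.norm_real, Real.norm_of_nonneg hz0]
      by_contra! hlt
      have h1 : z ^ 2 = a * ((2 - θ) * z - (1 - θ)) := by rw [hz, hs, hq]; ring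
      have h2 : 0 ≤ (2 - θ) * z - (1 - θ) := by nlinarith
      have h3 : z ^ 2 ≤ (1 + γ) * ((2 - θ) * z - (1 - θ)) := by
        rw [h1]; gcongr
      have h4 : 0 < (z - μ) * (z - ν) := mul_pos (by linarith) (by linarith [h.ν_le])
      have h5 : (z - μ) * (z - ν) = z ^ 2 - (1 + γ) * ((2 - θ) * z - (1 - θ)) := by
        linear_combination (-z) * h.add_eq + h.mul_eq
      linarith
    refine ⟨((s + R) / 2 : ℝ), ((s - R) / 2 : ℝ), ?_, ?_, key _ (by linarith) ?_,
      key _ (by linarith) ?_⟩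
    · rw [← Complex.ofReal_add]; congr 1; ring
    · rw [← Complex.ofReal_mul]; congr 1; linear_combination (-1 / 4) * hR
    · linear_combination (1 / 4) * hR
    · linear_combination (1 / 4) * hR
  · have hD' : 0 ≤ 4 * q - s ^ 2 := by linarith
    have hR := Real.sq_sqrt hD'
    set R := √(4 * q - s ^ 2)
    have hn : ‖(⟨s / 2, R / 2⟩ : ℂ)‖ ≤ μ := by
      refine le_of_sq_le_sq ?_ (by linarith)
      rw [Complex.sq_norm, Complex.normSq_mk]
      have h1 : s / 2 * (s / 2) + R / 2 * (R / 2) = q := by linear_combination (1 / 4) * hR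
      have h2 : q ≤ (1 + γ) * (1 - θ) := by
        rw [hq]; exact mul_le_mul_of_nonneg_right haγ (by linarith)
      rw [h1]
      rw [← h.mul_eq] at h2
      have := mul_le_mul_of_nonneg_left h.ν_le (show 0 ≤ μ by linarith)
      nlinarith
    refine ⟨⟨s / 2, R / 2⟩, (starRingEnd ℂ) ⟨s / 2, R / 2⟩, ?_, ?_, hn, ?_⟩
    · rw [Complex.add_conj]; congr 1; ring
    · rw [Complex.mul_conj, Complex.normSq_mk]; congr 1; linear_combination (1 / 4) * hR
    · rwa [Complex.norm_conj]

/-- The response is the sum of `z^i w^(m-i)` over `i ≤ m`: `m + 1` terms of modulus at most `μ^m`.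
This form also covers a double root. -/
lemma abs_impulse_le (h : MomentumRoots θ γ μ ν) (hθ : 0 < θ) (hθ1 : θ < 1) {a : ℝ}
    (ha : 0 < a) (haγ : a ≤ 1 + γ) (m : ℕ) : |impulse θ a m| ≤ (m + 1) * μ ^ m := by
  obtain ⟨z, w, hadd, hmul, hz, hw⟩ := exists_complex_roots h hθ hθ1 ha haγ
  have hμ := h.one_le hθ
  have hrec : ∀ m, (impulse θ a (m + 1) : ℂ) = z * impulse θ a m + w ^ (m + 1) := by
    intro m
    induction m with
    | zero => simp only [impulse]; push_cast at hadd ⊢; rw [← hadd]; ring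
    | succ m ih =>
      have e : (impulse θ a (m + 2) : ℂ)
          = (z + w) * impulse θ a (m + 1) - z * w * impulse θ a m := by
        rw [hadd, hmul, impulse]; push_cast; ring
      rw [e]
      linear_combination w * ih
  induction m with
  | zero => simp [impulse]
  | succ m ih =>
    rw [← Real.norm_eq_abs, ← Complex.norm_real, hrec]
    rw [← Real.norm_eq_abs, ← Complex.norm_real] at ih
    calc ‖z * impulse θ a m + w ^ (m + 1)‖ ≤ ‖z‖ * ‖(impulse θ a m : ℂ)‖ + ‖w‖ ^ (m + 1) := by
          rw [← norm_mul, ← norm_pow]; exact norm_add_le _ _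
      _ ≤ μ * ((m + 1) * μ ^ m) + μ ^ (m + 1) := by gcongr
      _ = _ := by push_cast; ring

variable {d : ℕ}

/-- The impulse response of the vector recurrence with factor `A`. -/
noncomputable def impulseOp (θ : ℝ) (A : Vec d →L[ℝ] Vec d) : ℕ → Vec d → Vec d
  | 0 => id
  | 1 => fun v => A ((2 - θ) • v)
  | m + 2 => fun v => A ((2 - θ) • impulseOp θ A (m + 1) v - (1 - θ) • impulseOp θ A m v)

lemma inner_impulseOp {A : Vec d →L[ℝ] Vec d} {e : Vec d} {a : ℝ}
    (he : ∀ v, ⟪e, A v⟫ = a * ⟪e, v⟫) (m : ℕ) (v : Vec d) :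
    ⟪e, impulseOp θ A m v⟫ = impulse θ a m * ⟪e, v⟫ := by
  induction m using Nat.twoStepInduction with
  | zero => simp [impulseOp, impulse]
  | one => simp only [impulseOp, impulse, he, real_inner_smul_right]; ring
  | more m ih1 ih2 =>
    simp only [impulseOp, impulse, he, inner_sub_right, real_inner_smul_right, ih1, ih2]; ring

lemma norm_impulseOp_le (h : MomentumRoots θ γ μ ν) (hθ : 0 < θ) (hθ1 : θ < 1)
    {A : Vec d →L[ℝ] Vec d} (e : OrthonormalBasis (Fin d) ℝ (Vec d)) {a : Fin d → ℝ}
    (he : ∀ i v, ⟪e i, A v⟫ = a i * ⟪e i, v⟫) (ha : ∀ i, 0 < a i) (haγ : ∀ i, a i ≤ 1 + γ)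
    (m : ℕ) (v : Vec d) : ‖impulseOp θ A m v‖ ≤ (m + 1) * μ ^ m * ‖v‖ := by
  have hμ := h.one_le hθ
  refine le_of_sq_le_sq ?_ (by positivity)
  rw [← e.sum_sq_inner_right, mul_pow, ← e.sum_sq_inner_right v, Finset.mul_sum]
  refine Finset.sum_le_sum fun i _ => ?_
  rw [inner_impulseOp (he i), mul_pow, ← sq_abs (impulse θ (a i) m)]
  have := abs_impulse_le h hθ hθ1 (ha i) (haγ i) m
  gcongr

/-- Duhamel's formula: a recurrence that starts from zero is the superposition of the responses to
its forcing terms. -/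
lemma eq_sum_impulseOp {A : Vec d →L[ℝ] Vec d} {u ψ : ℕ → Vec d} (h0 : u 0 = 0)
    (hu : ∀ k, u (k + 1) = A ((2 - θ) • u k - (1 - θ) • u (k - 1)) + ψ k) (k : ℕ) :
    u k = ∑ j ∈ Finset.range k, impulseOp θ A (k - 1 - j) (ψ j) := by
  induction k using Nat.twoStepInduction with
  | zero => simp [h0]
  | one => rw [hu]; simp [h0, impulseOp]
  | more k ih1 ih2 =>
    rw [hu (k + 1), Nat.add_sub_cancel, Finset.sum_range_succ, Finset.sum_range_succ, ih2,
      Finset.sum_range_succ, ih1]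
    have e : ∀ j ∈ Finset.range k, impulseOp θ A (k + 2 - 1 - j) (ψ j)
        = A ((2 - θ) • impulseOp θ A (k + 1 - 1 - j) (ψ j)
          - (1 - θ) • impulseOp θ A (k - 1 - j) (ψ j)) := by
      intro j hj
      rw [Finset.mem_range] at hj
      have h1 : k + 2 - 1 - j = (k - 1 - j) + 2 := by omega
      have h2 : k + 1 - 1 - j = (k - 1 - j) + 1 := by omega
      rw [h1, h2]; rfl
    rw [Finset.sum_congr rfl e, ← map_sum, Finset.sum_sub_distrib, ← Finset.smul_sum,
      ← Finset.smul_sum]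
    have h1 : k + 2 - 1 - k = 1 := by omega
    have h2 : k + 1 - 1 - k = 0 := by omega
    have h3 : k + 2 - 1 - (k + 1) = 0 := by omega
    rw [h1, h2, h3]
    simp only [impulseOp, id_eq]
    rw [← map_add, smul_add, sub_add_eq_add_sub]

/-- Exponential growth along an unstable eigenvector, in spite of small relative errors. -/
lemma growth_of_unstable (h : MomentumRoots θ γ μ ν) (hθ : 0 < θ) (hθ1 : θ < 1) (hγ : 0 ≤ γ)
    {A : Vec d →L[ℝ] Vec d} (e : OrthonormalBasis (Fin d) ℝ (Vec d)) {a : Fin d → ℝ}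
    (he : ∀ i v, ⟪e i, A v⟫ = a i * ⟪e i, v⟫) (ha : ∀ i, 0 < a i) (haγ : ∀ i, a i ≤ 1 + γ)
    {e₁ : Vec d} (he₁ : ‖e₁‖ = 1) (hAe : A e₁ = (1 + γ) • e₁) {t κ : ℝ} (ht : 0 ≤ t) (hκ : 0 ≤ κ)
    {w ψ : ℕ → Vec d} (h0 : w 0 = t • e₁)
    (hw : ∀ k, w (k + 1) = A ((2 - θ) • w k - (1 - θ) • w (k - 1)) + ψ k) {n : ℕ}
    (hψ : ∀ k < n, ‖ψ k‖ ≤ κ * ‖(2 - θ) • w k - (1 - θ) • w (k - 1)‖)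
    (hn : 15 * κ * (n : ℝ) ^ 2 ≤ 1) : t / 4 * μ ^ n ≤ ‖w n‖ := by
  have hμ := h.one_le hθ
  -- The deviation from the exact unstable solution starts from zero and is driven by `ψ` alone.
  set u : ℕ → Vec d := fun k => w k - (t * momentumSol θ γ k) • e₁ with hu
  have hu0 : u 0 = 0 := by simp [hu, h0, momentumSol]
  have hur : ∀ k, u (k + 1) = A ((2 - θ) • u k - (1 - θ) • u (k - 1)) + ψ k := by
    intro k
    simp only [hu, hw, momentumSol_succ, map_sub, map_smul, hAe]
    module
  -- Bootstrap: the bound on `u` before `k` gives `‖w‖ ≤ 5/4 t μ^j`. The coefficients `2-θ` and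
  -- `1-θ` add up to at most `3`, hence `15/4`. Duhamel's sum then has at most `n` terms, each with
  -- a weight of at most `n`.
  have hbound : ∀ k ≤ n, ‖u k‖ ≤ 1 / 4 * t * μ ^ k := by
    intro k
    induction k using Nat.strong_induction_on with
    | _ k ih =>
      intro hk
      have hwb : ∀ j < k, ‖w j‖ ≤ 5 / 4 * t * μ ^ j := by
        intro j hj
        have h1 := ih j hj (by omega)
        have h2 : w j = u j + (t * momentumSol θ γ j) • e₁ := by simp [hu]
        have h3 := momentumSol_mem h hθ hγ j
        have h4 : 0 ≤ momentumSol θ γ j := le_trans (by positivity) h3.1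
        rw [h2]
        refine (norm_add_le _ _).trans ?_
        rw [norm_smul, he₁, mul_one, Real.norm_of_nonneg (mul_nonneg ht h4)]
        have := mul_le_mul_of_nonneg_left h3.2 ht
        linarith
      have hψb : ∀ j < k, ‖ψ j‖ ≤ κ * (15 / 4 * t * μ ^ j) := by
        intro j hj
        refine (hψ j (by omega)).trans ?_
        gcongr
        refine (norm_sub_le _ _).trans ?_
        rw [norm_smul, norm_smul, Real.norm_of_nonneg (by linarith),
          Real.norm_of_nonneg (by linarith)]
        have h1 := hwb j hj
        have h2 : ‖w (j - 1)‖ ≤ 5 / 4 * t * μ ^ j := by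
          refine (hwb (j - 1) (by omega)).trans ?_
          gcongr
          omega
        have h3 : (2 - θ) * ‖w j‖ ≤ 2 * (5 / 4 * t * μ ^ j) := by
          gcongr; linarith
        have h4 : (1 - θ) * ‖w (j - 1)‖ ≤ 1 * (5 / 4 * t * μ ^ j) := by
          gcongr; linarith
        linarith
      rw [eq_sum_impulseOp hu0 hur k]
      have hterm : ∀ j ∈ Finset.range k, ‖impulseOp θ A (k - 1 - j) (ψ j)‖
          ≤ n * κ * (15 / 4 * t * μ ^ k) := by
        intro j hj
        rw [Finset.mem_range] at hj
        refine (norm_impulseOp_le h hθ hθ1 e he ha haγ _ _).trans ?_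
        have h1 : ((k - 1 - j : ℕ) : ℝ) + 1 ≤ n := by exact_mod_cast (by omega)
        calc (((k - 1 - j : ℕ) : ℝ) + 1) * μ ^ (k - 1 - j) * ‖ψ j‖
            ≤ n * μ ^ (k - 1 - j) * (κ * (15 / 4 * t * μ ^ j)) := by
              gcongr; exact hψb j hj
          _ = n * κ * (15 / 4 * t * μ ^ (k - 1 - j + j)) := by rw [pow_add]; ring
          _ ≤ _ := by
              gcongr
              omega
      refine (norm_sum_le _ _).trans ((Finset.sum_le_card_nsmul _ _ _ hterm).trans ?_)
      rw [Finset.card_range, nsmul_eq_mul]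
      have hkn : (k : ℝ) ≤ n := by exact_mod_cast hk
      calc (k : ℝ) * (n * κ * (15 / 4 * t * μ ^ k)) ≤ n * (n * κ * (15 / 4 * t * μ ^ k)) := by
            gcongr
        _ = 15 * κ * (n : ℝ) ^ 2 * (1 / 4 * t * μ ^ k) := by ring
        _ ≤ 1 * (1 / 4 * t * μ ^ k) := by gcongr
        _ = _ := one_mul _
  have h1 := hbound n le_rfl
  have h2 := (momentumSol_mem h hθ hγ n).1
  have h4 : 0 ≤ momentumSol θ γ n := le_trans (by positivity) h2
  have h3 : ‖(t * momentumSol θ γ n) • e₁‖ ≤ ‖w n‖ + ‖u n‖ := by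
    have : (t * momentumSol θ γ n) • e₁ = w n - u n := by simp [hu]
    rw [this]; exact norm_sub_le _ _
  rw [norm_smul, he₁, mul_one, Real.norm_of_nonneg (mul_nonneg ht h4)] at h3
  have := mul_le_mul_of_nonneg_left h2 ht
  linarith

end MomentumRecurrence

/-! ### Escape from negative curvature. -/

section Escape

variable {d : ℕ} {f : Vec d → ℝ} {p : Params} {L ρ χ : ℝ}

lemma not_triggers_of_not_epochRestarts {z : Vec d} (h : ¬ EpochRestarts f p z) :
    ∀ k ≤ ⌈p.K⌉₊, ¬ Triggers f p z k := fun k hk hT => h ⟨k, hk, hT⟩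

/-- Since `K > 2`, `⌊K⌋ ≥ K/2 = χ/θ`, and `exp (θ/3) ≤ 1 + θ/2` for `θ ≤ 1`. -/
lemma exp_le_pow_floor (hp : p.Tuned L ρ χ) :
    Real.exp (χ / 3) ≤ (1 + p.θ / 2) ^ ⌊p.K⌋₊ := by
  have hθ := hp.θ_pos
  have hθ1 := hp.θ_lt
  have hK := hp.two_lt_K
  have h1 : Real.exp (p.θ / 3) ≤ 1 + p.θ / 2 := by
    have h2 := Real.one_sub_le_exp_neg (p.θ / 3)
    have h3 : 0 < Real.exp (p.θ / 3) := Real.exp_pos _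
    have h4 : Real.exp (p.θ / 3) * Real.exp (-(p.θ / 3)) = 1 := by
      rw [← Real.exp_add]; simp
    have h5 : Real.exp (p.θ / 3) * (1 - p.θ / 3) ≤ 1 :=
      (mul_le_mul_of_nonneg_left h2 h3.le).trans_eq h4
    have h6 : 1 ≤ (1 + p.θ / 2) * (1 - p.θ / 3) := by nlinarith
    exact le_of_mul_le_mul_right (h5.trans h6) (by linarith)
  have h2 : χ / p.θ ≤ ⌊p.K⌋₊ := by
    have h3 := Nat.lt_floor_add_one p.K
    have h4 : χ / p.θ = p.K / 2 := by rw [hp.K_eq]; ring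
    linarith
  calc Real.exp (χ / 3) = Real.exp (χ / p.θ * (p.θ / 3)) := by congr 1; field_simp
    _ ≤ Real.exp (⌊p.K⌋₊ * (p.θ / 3)) := by gcongr
    _ = Real.exp (p.θ / 3) ^ ⌊p.K⌋₊ := Real.exp_nat_mul _ _
    _ ≤ _ := by gcongr

lemma radius_le_half (p : Params) : p.radius ≤ p.B / 2 := min_le_left _ _

/-- Near a point with a sufficiently negative curvature there is a direction in which two starting
points of epochs without restart are exponentially close. -/
lemma exists_escape_direction (hd : 0 < d) (hf : SmoothObjective f L ρ) (hp : p.Tuned L ρ χ)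
    {c : Vec d} (hc : lambdaMin (hess f c) < -(p.θ ^ 2 / p.η)) :
    ∃ e₁ : Vec d, ‖e₁‖ = 1 ∧ ∀ (z : Vec d) (t : ℝ), 0 ≤ t → ‖z - c‖ ≤ p.radius →
      ‖z + t • e₁ - c‖ ≤ p.radius → ¬ EpochRestarts f p z → ¬ EpochRestarts f p (z + t • e₁) →
      t ≤ 12 * p.B * Real.exp (-(χ / 3)) := by
  have hη := hp.η_pos
  have hB := hp.B_pos
  have hθ := hp.θ_pos
  have hθ1 := hp.θ_lt
  have hρ := hp.ρ_pos
  have hK := hp.two_lt_K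
  have hχ := hp.χ_pos
  have hA := hf.hess_isSymmetric c
  have hrank : Module.finrank ℝ (Vec d) = d := by simp
  obtain ⟨i₀, -, hi₀⟩ := Finset.exists_min_image Finset.univ (hA.eigenvalues hrank)
    ⟨⟨0, hd⟩, Finset.mem_univ _⟩
  have hneg : hA.eigenvalues hrank i₀ < -(p.θ ^ 2 / p.η) := by
    obtain ⟨m, hm, hlt⟩ := exists_lt_of_csInf_lt (lambdaMin_set_nonempty hd hA) hc
    obtain ⟨i, hi⟩ := hA.exists_eigenvalues_eq hrank hm
    have h1 := hi₀ i (Finset.mem_univ _)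
    have h2 : hA.eigenvalues hrank i = m := by simpa using hi
    linarith
  set e := hA.eigenvectorBasis hrank with he
  set l := hA.eigenvalues hrank with hl
  set γ := -(p.η * l i₀) with hγ
  have hγθ : p.θ ^ 2 ≤ γ := by
    have := mul_lt_mul_of_pos_left hneg hη
    have e1 : p.η * -(p.θ ^ 2 / p.η) = -p.θ ^ 2 := by field_simp
    linarith
  have hγ0 : 0 ≤ γ := le_trans (by positivity) hγθ
  obtain ⟨μ, ν, hr⟩ := exists_momentumRoots hθ hθ1 hγθ
  refine ⟨e i₀, e.orthonormal.1 i₀, fun z t ht hz hz' hn hn' => ?_⟩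
  set A : Vec d →L[ℝ] Vec d := ContinuousLinearMap.id ℝ _ - p.η • hess f c with hAdef
  have hAv : ∀ v, A v = v - p.η • hess f c v := fun v => rfl
  have hAi : ∀ i v, ⟪e i, A v⟫ = (1 - p.η * l i) * ⟪e i, v⟫ := by
    intro i v
    rw [hAv, inner_sub_right, real_inner_smul_right, inner_eigenvectorBasis_apply hA]
    ring
  have hli : ∀ i, |p.η * l i| ≤ 1 / 4 := by
    intro i
    rw [abs_mul, abs_of_pos hη, ← hp.L_mul_η, mul_comm]
    gcongr
    exact (abs_eigenvalue_le_norm (hA.hasEigenvalue_eigenvalues _ i)).trans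
      (hf.norm_hess_le hp.L_pos.le c)
  set w : ℕ → Vec d := fun k => agdX f p (z + t • e i₀) k - agdX f p z k with hw
  set v : ℕ → Vec d := fun k => agdY f p (z + t • e i₀) k - agdY f p z k with hv
  have hvw : ∀ k, v k = (2 - p.θ) • w k - (1 - p.θ) • w (k - 1) := by
    intro k
    simp only [hv, hw, agdY_eq]
    module
  -- The difference of two epochs follows the momentum recurrence with factor `I - η ∇²f(c)`; `ψ`
  -- collects the deviation of the gradient difference from the Hessian at `c`.
  set ψ : ℕ → Vec d := fun k => -(p.η • (gradient f (agdY f p (z + t • e i₀) k)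
    - gradient f (agdY f p z k) - hess f c (v k))) with hψ
  have hrec : ∀ k, w (k + 1) = A ((2 - p.θ) • w k - (1 - p.θ) • w (k - 1)) + ψ k := by
    intro k
    rw [← hvw, hAv]
    simp only [hw, hψ, agdX_succ, hv]
    module
  have hfloor : (⌊p.K⌋₊ : ℝ) ≤ p.K := Nat.floor_le (by linarith)
  have hdist : ∀ x, ‖x - c‖ ≤ p.radius → ¬ EpochRestarts f p x → ∀ k < ⌊p.K⌋₊,
      ‖agdY f p x k - c‖ ≤ 5 / 2 * p.B := by
    intro x hx hnx k hk
    have h1 := norm_agdY_sub_le hB.le hθ.le hθ1.le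
      (not_triggers_of_not_epochRestarts hnx k (hk.le.trans (Nat.floor_le_ceil _)))
    have h2 := radius_le_half p
    calc ‖agdY f p x k - c‖ ≤ ‖agdY f p x k - x‖ + ‖x - c‖ := norm_sub_le_norm_sub_add_norm_sub ..
      _ ≤ _ := by linarith
  have hψb : ∀ k < ⌊p.K⌋₊, ‖ψ k‖
      ≤ p.η * (ρ * (5 / 2 * p.B)) * ‖(2 - p.θ) • w k - (1 - p.θ) • w (k - 1)‖ := by
    intro k hk
    rw [← hvw, norm_neg, norm_smul, Real.norm_of_nonneg hη.le, mul_assoc]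
    gcongr
    exact hf.norm_gradient_sub_gradient_sub_hess_le hρ.le c (hdist _ hz' hn' k hk)
      (hdist _ hz hn k hk)
  -- Here the constant in `B` is needed: the left side is at most `15 · (5/2) · 4 / 288 ≤ 1`.
  have hκ : 15 * (p.η * (ρ * (5 / 2 * p.B))) * (⌊p.K⌋₊ : ℝ) ^ 2 ≤ 1 := by
    have h1 : (⌊p.K⌋₊ : ℝ) ^ 2 ≤ (2 * χ / p.θ) ^ 2 := by rw [← hp.K_eq]; gcongr
    have h2 : p.η * (ρ * (5 / 2 * p.B)) = 5 / 2 / 288 * (p.θ ^ 2 / χ ^ 2) := by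
      rw [← hp.B_eq]; field_simp
    rw [h2]
    calc 15 * (5 / 2 / 288 * (p.θ ^ 2 / χ ^ 2)) * (⌊p.K⌋₊ : ℝ) ^ 2
        ≤ 15 * (5 / 2 / 288 * (p.θ ^ 2 / χ ^ 2)) * (2 * χ / p.θ) ^ 2 := by gcongr
      _ = 15 * 5 / 2 / 288 * 4 := by field_simp; norm_num
      _ ≤ 1 := by norm_num
  have hg := growth_of_unstable hr hθ hθ1 hγ0 e hAi
    (fun i => by linarith [(abs_le.1 (hli i)).2])
    (fun i => by
      have := mul_le_mul_of_nonneg_left (hi₀ i (Finset.mem_univ _)) hη.le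
      linarith)
    (e.orthonormal.1 i₀)
    (by
      have : hess f c (e i₀) = l i₀ • e i₀ :=
        hA.apply_eigenvectorBasis hrank i₀
      rw [hAv, this]; module) ht (by positivity) (w := w)
    (by simp [hw, agdX_zero]) hrec hψb hκ
  -- Each epoch moves by at most `B`, and the starts are at most `2r ≤ B` apart.
  have hwn : ‖w ⌊p.K⌋₊‖ ≤ 3 * p.B := by
    have h1 := norm_agdX_sub_le hB.le
      (not_triggers_of_not_epochRestarts hn _ (Nat.floor_le_ceil _))
    have h2 := norm_agdX_sub_le hB.le
      (not_triggers_of_not_epochRestarts hn' _ (Nat.floor_le_ceil _))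
    have h3 := radius_le_half p
    have e1 : w ⌊p.K⌋₊ = (agdX f p (z + t • e i₀) ⌊p.K⌋₊ - (z + t • e i₀))
        - (agdX f p z ⌊p.K⌋₊ - z) + ((z + t • e i₀ - c) - (z - c)) := by
      simp only [hw]; abel
    rw [e1]
    refine (norm_add_le _ _).trans ?_
    have h4 := norm_sub_le (agdX f p (z + t • e i₀) ⌊p.K⌋₊ - (z + t • e i₀))
      (agdX f p z ⌊p.K⌋₊ - z)
    have h5 := norm_sub_le (z + t • e i₀ - c) (z - c)
    linarith
  have hexp : Real.exp (χ / 3) ≤ μ ^ ⌊p.K⌋₊ :=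
    (exp_le_pow_floor hp).trans (by gcongr; exact hr.le_μ)
  have h1 : t / 4 * Real.exp (χ / 3) ≤ 3 * p.B :=
    (mul_le_mul_of_nonneg_left hexp (by positivity)).trans (hg.trans hwn)
  rw [Real.exp_neg, ← div_eq_mul_inv, le_div_iff₀ (Real.exp_pos _)]
  linarith

/-- A set that meets every line in a fixed direction only within a short segment occupies a small
part of a ball. -/
lemma volume_le_of_short_chords (hd : 0 < d) {G : Set (Vec d)} (hG : MeasurableSet G) {r τ : ℝ}
    (hr : 0 < r) (hτ : 0 < τ) (hGr : G ⊆ Metric.closedBall 0 r) {e₁ : Vec d} (he₁ : ‖e₁‖ = 1)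
    (hchord : ∀ z ∈ G, ∀ t, 0 ≤ t → z + t • e₁ ∈ G → t < τ) {M : ℕ} (hM : M * τ ≤ r / d) :
    (M : ENNReal) * volume G ≤ 3 * volume (Metric.closedBall (0 : Vec d) r) := by
  have hd' : (0 : ℝ) < d := by exact_mod_cast hd
  set T : ℕ → Set (Vec d) := fun j => (fun x => x + -((j * τ) • e₁)) ⁻¹' G with hT
  have hTm : ∀ j, MeasurableSet (T j) := fun j => measurable_add_const _ hG
  have hTv : ∀ j, volume (T j) = volume G := fun j => measure_preimage_add_right _ _ _
  have hdisj : Pairwise (Function.onFun Disjoint T) := by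
    have key : ∀ i j : ℕ, i < j → Disjoint (T i) (T j) := by
      intro i j hij
      rw [Set.disjoint_left]
      intro x hx hx'
      simp only [hT, Set.mem_preimage] at hx hx'
      have hij' : (i : ℝ) + 1 ≤ j := by exact_mod_cast hij
      have h1 := hchord _ hx' ((j - i) * τ) (mul_nonneg (by linarith) hτ.le) (by
        convert hx using 1
        module)
      nlinarith
    intro i j hij
    rcases lt_or_gt_of_ne hij with h | h
    · exact key i j h
    · exact (key j i h).symm
  -- The shifts are at most `Mτ ≤ r/d`, so the enlarged ball has at most `(1 + 1/d)^d ≤ e < 3` times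
  -- the volume.
  have hsub : (⋃ j ∈ Finset.range M, T j) ⊆ Metric.closedBall 0 ((1 + 1 / d) * r) := by
    refine Set.iUnion₂_subset fun j hj x hx => ?_
    have h1 := hGr hx
    rw [mem_closedBall_zero_iff] at h1 ⊢
    have hjM : (j : ℝ) ≤ M := by exact_mod_cast (Finset.mem_range.1 hj).le
    have e : x = (x + -((j * τ) • e₁)) + (j * τ) • e₁ := by abel
    rw [e]
    refine (norm_add_le _ _).trans ?_
    rw [norm_smul, he₁, mul_one, Real.norm_of_nonneg (by positivity)]
    have h2 : j * τ ≤ M * τ := by gcongr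
    have e2 : (1 + 1 / d) * r = r + r / d := by ring
    linarith
  have hball : volume (Metric.closedBall (0 : Vec d) ((1 + 1 / d) * r))
      ≤ 3 * volume (Metric.closedBall (0 : Vec d) r) := by
    rw [Measure.addHaar_closedBall_mul _ _ (by positivity) hr.le]
    gcongr
    rw [show (3 : ENNReal) = ENNReal.ofReal 3 by simp]
    refine ENNReal.ofReal_le_ofReal ?_
    rw [finrank_euclideanSpace_fin]
    calc (1 + 1 / (d : ℝ)) ^ d ≤ Real.exp (1 / d) ^ d := by
          gcongr
          linarith [Real.add_one_le_exp (1 / (d : ℝ))]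
      _ = Real.exp 1 := by rw [← Real.exp_nat_mul]; congr 1; field_simp
      _ ≤ 3 := by linarith [Real.exp_one_lt_d9]
  calc (M : ENNReal) * volume G = ∑ j ∈ Finset.range M, volume (T j) := by simp [hTv]
    _ = volume (⋃ j ∈ Finset.range M, T j) :=
        (measure_biUnion_finset (fun i _ j _ hij => hdisj hij) fun j _ => hTm j).symm
    _ ≤ _ := (measure_mono hsub).trans hball

end Escape

/-! ### Measurability of the epoch map, and the volume of stuck perturbations. -/

section Measurability

variable {d : ℕ} {f : Vec d → ℝ} {p : Params} {L ρ χ : ℝ}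

lemma continuous_agdPair (hf : SmoothObjective f L ρ) (k : ℕ) :
    Continuous fun z => agdPair f p z k := by
  induction k with
  | zero => exact continuous_id.prodMk continuous_id
  | succ k ih =>
    have := hf.continuous_gradient
    simp only [agdPair, extrapolate]
    fun_prop

lemma continuous_agdX (hf : SmoothObjective f L ρ) (k : ℕ) : Continuous fun z => agdX f p z k :=
  (continuous_agdPair hf k).snd

lemma continuous_agdY (hf : SmoothObjective f L ρ) (k : ℕ) : Continuous fun z => agdY f p z k := by
  have := continuous_agdPair (p := p) hf k
  simp only [agdY, extrapolate]
  fun_prop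

lemma measurableSet_triggers (hf : SmoothObjective f L ρ) (k : ℕ) :
    MeasurableSet {z | Triggers f p z k} := by
  have := fun k => continuous_agdX (p := p) hf k
  refine (isOpen_lt continuous_const ?_).measurableSet
  fun_prop

lemma measurableSet_epochRestarts (hf : SmoothObjective f L ρ) :
    MeasurableSet {z | EpochRestarts f p z} := by
  have : {z | EpochRestarts f p z} = ⋃ k ∈ Finset.range (⌈p.K⌉₊ + 1), {z | Triggers f p z k} := by
    ext z
    simp [EpochRestarts]
  rw [this]
  exact Finset.measurableSet_biUnion _ fun k _ => measurableSet_triggers hf k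

lemma measurable_stopTime (hf : SmoothObjective f L ρ) : Measurable (stopTime f p) := by
  classical
  exact measurable_find _ fun k => (measurableSet_triggers hf k).union (MeasurableSet.const _)

lemma measurable_apply_nat {α β : Type*} [MeasurableSpace α] [MeasurableSpace β]
    {g : α → ℕ → β} {n : α → ℕ} (hg : ∀ k, Measurable fun z => g z k) (hn : Measurable n) :
    Measurable fun z => g z (n z) :=
  (measurable_from_prod_countable_left (f := fun q : α × ℕ => g q.1 q.2) hg).comp
    (measurable_id.prodMk hn)

lemma measurable_epochEnd (hf : SmoothObjective f L ρ) : Measurable (epochEnd f p) :=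
  measurable_apply_nat (fun k => (continuous_agdX hf k).measurable) (measurable_stopTime hf)

lemma measurable_epochLastY (hf : SmoothObjective f L ρ) : Measurable (epochLastY f p) :=
  measurable_apply_nat (g := fun z k => agdY f p z (k - 1))
    (fun k => (continuous_agdY hf (k - 1)).measurable) (measurable_stopTime hf)

lemma measurable_perturb (hf : SmoothObjective f L ρ) {α : Type*} [MeasurableSpace α]
    {x y u : α → Vec d} (hx : Measurable x) (hy : Measurable y) (hu : Measurable u) :
    Measurable fun t => perturb f p (x t) (y t) (u t) :=
  Measurable.ite (measurableSet_le (hf.continuous_gradient.measurable.comp hy).norm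
    measurable_const) (hx.add hu) hx

/-- A uniform perturbation of a point of negative curvature leads to a restart, except with
small probability. -/
lemma stuck_volume_le (hd : 0 < d) (hf : SmoothObjective f L ρ) (hp : p.Tuned L ρ χ)
    (hr : 0 < p.radius) {c : Vec d} (hc : lambdaMin (hess f c) < -(p.θ ^ 2 / p.η)) {M : ℕ}
    (hM : M * (13 * p.B * Real.exp (-(χ / 3))) ≤ p.radius / d) :
    (M : ENNReal) * (cond volume (Metric.closedBall (0 : Vec d) p.radius))
      {u | ¬ EpochRestarts f p (c + u)} ≤ 3 := by
  have hB := hp.B_pos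
  obtain ⟨e₁, he₁, hesc⟩ := exists_escape_direction hd hf hp hc
  have hSm : MeasurableSet {u | ¬ EpochRestarts f p (c + u)} :=
    (measurableSet_epochRestarts hf).compl.preimage (measurable_const_add c)
  have hv := volume_le_of_short_chords hd (Metric.isClosed_closedBall.measurableSet.inter hSm)
    -- The escape bound has `12`; `13` makes the chord bound strict.
    hr (τ := 13 * p.B * Real.exp (-(χ / 3))) (by positivity) Set.inter_subset_left he₁
    (fun z hz t ht hz' => by
      have h1 := hesc (c + z) t ht (by simpa using hz.1)
        (by simpa [add_assoc] using hz'.1) hz.2 (by rw [add_assoc]; exact hz'.2)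
      have : 0 < p.B * Real.exp (-(χ / 3)) := by positivity
      linarith) hM
  have hv0 : volume (Metric.closedBall (0 : Vec d) p.radius) ≠ 0 :=
    (Metric.measure_closedBall_pos _ _ hr).ne'
  have hvt : volume (Metric.closedBall (0 : Vec d) p.radius) ≠ ⊤ := measure_closedBall_lt_top.ne
  rw [cond_apply Metric.isClosed_closedBall.measurableSet, mul_left_comm]
  calc _ ≤ (volume (Metric.closedBall (0 : Vec d) p.radius))⁻¹
        * (3 * volume (Metric.closedBall (0 : Vec d) p.radius)) := by gcongr
    _ = 3 := by rw [mul_left_comm, ENNReal.inv_mul_cancel hv0 hvt, mul_one]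

end Measurability

/-! ### Second-order stationarity of the output, for fixed perturbations. -/

section SecondOrder

variable {d : ℕ} {f : Vec d → ℝ} {p : Params} {L ρ χ : ℝ}

/-- The output is within `2B + r ≤ 5B/2` of `c`, so by Weyl the eigenvalue drops by at most `5ρB/2 ≤
(5/2)/288 · θ²/η`, which is less than `0.011 θ²/η`. -/
lemma isOutput_lambdaMin_ge (hd : 0 < d) (hf : SmoothObjective f L ρ) (hp : p.Tuned L ρ χ)
    {z c yhat : Vec d} (hz : ¬ EpochRestarts f p z) (hzc : ‖z - c‖ ≤ p.radius)
    (hc : -(p.θ ^ 2 / p.η) ≤ lambdaMin (hess f c)) (hy : IsOutput f p z yhat) :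
    -(1.011 * (p.θ ^ 2 / p.η)) ≤ lambdaMin (hess f yhat) := by
  have hη := hp.η_pos
  have hB := hp.B_pos
  have hρ := hp.ρ_pos
  have hθ := hp.θ_pos
  have hχ := hp.one_le
  have h1 := isOutput_norm_sub_le hp (not_triggers_of_not_epochRestarts hz) hy
  have h2 := lambdaMin_sub_le hd (hf.hess_isSymmetric c) (hf.hess_isSymmetric yhat)
  have h3 : ‖yhat - c‖ ≤ 5 / 2 * p.B := by
    have := radius_le_half p
    calc ‖yhat - c‖ ≤ ‖yhat - z‖ + ‖z - c‖ := norm_sub_le_norm_sub_add_norm_sub ..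
      _ ≤ _ := by linarith
  have h4 : ‖hess f yhat - hess f c‖ ≤ ρ * (5 / 2 * p.B) :=
    (hf.lip_hess _ _).trans (by gcongr)
  have h5 : ρ * p.B ≤ p.θ ^ 2 / p.η / 288 := by
    have h : ρ * p.B = p.θ ^ 2 / p.η / 288 / χ ^ 2 := by
      rw [← hp.B_eq]; field_simp
    rw [h]
    exact div_le_self (by positivity) (by nlinarith)
  have h6 : 0 ≤ p.θ ^ 2 / p.η := by positivity
  norm_num
  linarith

/-- The method finds a second-order stationary point unless a perturbation of a point of negative
curvature fails to trigger a restart. -/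
lemma achieves_second_order (hd : 0 < d) (hf : SmoothObjective f L ρ) (hp : p.Tuned L ρ χ)
    {x₀ : Vec d} {ξ : ℕ → Vec d} (hξ : ∀ n, ‖ξ n‖ ≤ p.radius) {k : ℕ} {b : ℝ}
    (hk : 16 * gap f x₀ ≤ k * (p.θ * p.B ^ 2 / (p.η * p.K)))
    (hb : ((k : ℝ) + 1) * (3 / 2 * p.K) ≤ b)
    (h_first : ¬ EpochRestarts f p x₀ →
      ∃ c, ‖x₀ - c‖ ≤ p.radius ∧ -(p.θ ^ 2 / p.η) ≤ lambdaMin (hess f c))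
    (hgood : ∀ n < k, ¬ (lambdaMin (hess f (epochEnd f p (epochStart f p x₀ ξ n)))
        < -(p.θ ^ 2 / p.η) ∧
      ¬ EpochRestarts f p (epochEnd f p (epochStart f p x₀ ξ n) + ξ n))) :
    Achieves f p x₀ ξ b fun yhat => ‖gradient f yhat‖ ≤ 288 * χ ^ 2 * p.B * p.θ ^ 2 / p.η ∧
      -(1.011 * (p.θ ^ 2 / p.η)) ≤ lambdaMin (hess f yhat) := by
  obtain ⟨N, hNU, hres, hN⟩ := exists_last_epoch hf hp x₀ hξ
  have hU := hp.unit_pos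
  have hNk : N ≤ k := by
    have := le_of_mul_le_mul_right (hNU.trans hk) hU
    exact_mod_cast this
  have hK := hp.K_pos
  refine achieves_of_last_epoch hp hres hN (le_trans (by gcongr) hb) fun y hy =>
    ⟨isOutput_norm_gradient_le hf hp (not_triggers_of_not_epochRestarts hN) hy, ?_⟩
  suffices h : ∃ c, ‖epochStart f p x₀ ξ N - c‖ ≤ p.radius ∧
      -(p.θ ^ 2 / p.η) ≤ lambdaMin (hess f c) by
    obtain ⟨c, h1, h2⟩ := h
    exact isOutput_lambdaMin_ge hd hf hp hN h1 h2 hy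
  rcases N with _ | n
  · exact h_first hN
  · have hr := hres n (by omega)
    have hg := hgood n (by omega)
    set z := epochStart f p x₀ ξ n with hz
    rw [epochStart, ← hz] at hN ⊢
    by_cases hsmall : ‖gradient f (epochLastY f p z)‖ ≤ p.B / p.η
    · rw [perturb, if_pos hsmall] at hN ⊢
      refine ⟨epochEnd f p z, by simpa using hξ n, ?_⟩
      by_contra! hlt
      exact hg ⟨hlt, hN⟩
    -- Without a perturbation the gradient at the new start exceeds `3/4` of `B/η`, so this epoch
    -- would restart and could not be the last.
    · rw [perturb, if_neg hsmall] at hN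
      refine absurd (epochRestarts_of_large_gradient hp ?_) hN
      rw [not_le] at hsmall
      obtain ⟨m, hm⟩ := Nat.exists_eq_succ_of_ne_zero (stopTime_pos hr).ne'
      rw [epochLastY, hm, Nat.succ_sub_one] at hsmall
      rw [epochEnd, hm]
      have h3 := norm_gradient_agdX_succ_le hf hp (x₀ := z) (n := m)
      have h4 := norm_sub_norm_le (gradient f (agdY f p z m)) (gradient f (agdX f p z (m + 1)))
      rw [norm_sub_rev] at h4
      rw [Nat.succ_eq_add_one]
      linarith

end SecondOrder

/-! ### Dependence of an epoch on the earlier perturbations. -/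

section Adapted

variable {d : ℕ} {f : Vec d → ℝ} {p : Params} {L ρ : ℝ}

/-- The starting point of an epoch is a measurable function of the earlier perturbations. -/
lemma exists_epochStart_eq_comp {α : Type*} (hf : SmoothObjective f L ρ) {ξ : ℕ → α → Vec d}
    {m : ℕ} {Z : α → Vec d} {g : (Finset.range m → Vec d) → Vec d} (hg : Measurable g)
    (hZ : ∀ ω, Z ω = g fun i => ξ i ω) (n : ℕ) :
    ∃ G : (Finset.range (n + m) → Vec d) → Vec d, Measurable G ∧
      ∀ ω, epochStart f p (Z ω) (fun j => ξ (j + m) ω) n = G fun i => ξ i ω := by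
  induction n with
  | zero =>
    rw [Nat.zero_add]
    exact ⟨g, hg, hZ⟩
  | succ n ih =>
    obtain ⟨G, hG, hGe⟩ := ih
    have hle : ∀ i : Finset.range (n + m), (i : ℕ) ∈ Finset.range (n + 1 + m) := fun i =>
      Finset.mem_range.2 (by have := Finset.mem_range.1 i.2; omega)
    have hlast : n + m ∈ Finset.range (n + 1 + m) := Finset.mem_range.2 (by omega)
    have hres : Measurable fun (t : Finset.range (n + 1 + m) → Vec d)
        (i : Finset.range (n + m)) => t ⟨i, hle i⟩ :=
      measurable_pi_lambda _ fun i => measurable_pi_apply _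
    refine ⟨fun t => perturb f p (epochEnd f p (G fun i => t ⟨i, hle i⟩))
      (epochLastY f p (G fun i => t ⟨i, hle i⟩)) (t ⟨n + m, hlast⟩), ?_, fun ω => ?_⟩
    · have hG' : Measurable fun t : Finset.range (n + 1 + m) → Vec d =>
          G fun i => t ⟨i, hle i⟩ := hG.comp hres
      exact measurable_perturb hf ((measurable_epochEnd hf).comp hG')
        ((measurable_epochLastY hf).comp hG') (measurable_pi_apply _)
    · rw [epochStart, hGe]

end Adapted

/-! ### Independence and the union bound. -/

section Probability

variable {Ω : Type*} [MeasurableSpace Ω] {P : Measure Ω}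

/-- Union bound in the form of a lower bound. -/
lemma ofReal_one_sub_le_measure [IsProbabilityMeasure P] {ζ : ℝ} (hζ : 0 ≤ ζ) {S : Set Ω} {k M : ℕ}
    (hM0 : 0 < M) (hM : 3 * (k : ℝ) ≤ ζ * M) {E : ℕ → Set Ω}
    (hE : ∀ i < k, (M : ENNReal) * P (E i) ≤ 3)
    (hS : ∀ᵐ ω ∂P, (∀ i < k, ω ∉ E i) → ω ∈ S) : ENNReal.ofReal (1 - ζ) ≤ P S := by
  have hM' : (0 : ℝ) < M := by exact_mod_cast hM0
  -- Only monotonicity and subadditivity are used, so the success event `S` need not be measurable.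
  have h1 : (1 : ENNReal) ≤ P S + P (⋃ i ∈ Finset.range k, E i) := by
    rw [← measure_univ (μ := P)]
    refine le_trans (measure_mono_ae ?_) (measure_union_le _ _)
    filter_upwards [hS] with ω hω _
    by_cases h : ∀ i < k, ω ∉ E i
    · exact Or.inl (hω h)
    · push Not at h
      obtain ⟨i, hi, hiE⟩ := h
      exact Or.inr (Set.mem_iUnion₂.2 ⟨i, Finset.mem_range.2 hi, hiE⟩)
  have h2 : P (⋃ i ∈ Finset.range k, E i) ≤ ENNReal.ofReal ζ := by
    refine (measure_biUnion_finset_le _ _).trans ?_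
    have h3 : ∀ i ∈ Finset.range k, P (E i) ≤ ENNReal.ofReal (3 / M) := by
      intro i hi
      rw [ENNReal.ofReal_div_of_pos hM', ENNReal.le_div_iff_mul_le (by simp [hM0.ne']) (by simp),
        mul_comm]
      simpa using hE i (Finset.mem_range.1 hi)
    refine (Finset.sum_le_card_nsmul _ _ _ h3).trans ?_
    rw [Finset.card_range, nsmul_eq_mul, ← ENNReal.ofReal_natCast,
      ← ENNReal.ofReal_mul (by positivity)]
    refine ENNReal.ofReal_le_ofReal ?_
    rw [← mul_div_assoc, div_le_iff₀ hM']
    linarith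
  rw [ENNReal.ofReal_sub _ hζ, ENNReal.ofReal_one, tsub_le_iff_right]
  exact h1.trans (by gcongr)

/-- Fubini for an event that depends on two independent variables. -/
lemma measure_and_le_of_indepFun [IsProbabilityMeasure P] {α β : Type*} [MeasurableSpace α]
    [MeasurableSpace β] {X : Ω → α} {Y : Ω → β} (hX : Measurable X) (hY : Measurable Y)
    (hXY : IndepFun X Y P) {R : α → β → Prop} (hR : MeasurableSet {q : α × β | R q.1 q.2})
    {D : α → Prop} {M : ENNReal} (hM : M ≠ ⊤) {B : ENNReal}
    (hD : ∀ x, D x → M * (P.map Y) {y | R x y} ≤ B) :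
    M * P {ω | D (X ω) ∧ R (X ω) (Y ω)} ≤ B := by
  have : IsProbabilityMeasure (P.map X) := Measure.isProbabilityMeasure_map hX.aemeasurable
  have : IsProbabilityMeasure (P.map Y) := Measure.isProbabilityMeasure_map hY.aemeasurable
  -- `D` need not be measurable. It is replaced by the larger measurable condition that the section
  -- bound holds.
  set T : Set (α × β) :=
    {q | M * (P.map Y) {y | R q.1 y} ≤ B} ∩ {q | R q.1 q.2} with hT
  have hTm : MeasurableSet T := by
    refine MeasurableSet.inter ?_ hR
    have h1 : Measurable fun x => (P.map Y) {y | R x y} := measurable_measure_prodMk_left hR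
    exact measurableSet_le ((h1.comp measurable_fst).const_mul M) measurable_const
  calc M * P {ω | D (X ω) ∧ R (X ω) (Y ω)} ≤ M * P ((fun ω => (X ω, Y ω)) ⁻¹' T) := by
        gcongr
        rintro ω ⟨h1, h2⟩
        exact ⟨hD _ h1, h2⟩
    _ = M * ((P.map X).prod (P.map Y)) T := by
        rw [← (indepFun_iff_map_prod_eq_prod_map_map hX.aemeasurable hY.aemeasurable).1 hXY,
          Measure.map_apply (hX.prodMk hY) hTm]
    _ = ∫⁻ x, M * (P.map Y) (Prod.mk x ⁻¹' T) ∂(P.map X) := by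
        rw [Measure.prod_apply hTm, lintegral_const_mul' _ _ hM]
    _ ≤ ∫⁻ _, B ∂(P.map X) := by
        refine lintegral_mono fun x => ?_
        by_cases hx : M * (P.map Y) {y | R x y} ≤ B
        · refine le_trans ?_ hx
          simp only
          gcongr
          exact fun y hy => hy.2
        · have : Prod.mk x ⁻¹' T = ∅ := by
            ext y
            simp [hT, hx]
          simp [this]
    _ = B := by simp

variable {d : ℕ} {f : Vec d → ℝ} {p : Params} {L ρ χ : ℝ}

lemma ae_norm_le_of_isUniform {X : Ω → Vec d} {r : ℝ} (hr : 0 < r)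
    (h : pdf.IsUniform X (Metric.closedBall 0 r) P volume) : ∀ᵐ ω ∂P, ‖X ω‖ ≤ r := by
  have h1 := h.measure_preimage (Metric.measure_closedBall_pos _ _ hr).ne'
    measure_closedBall_lt_top.ne
    (Metric.isClosed_closedBall (x := (0 : Vec d)) (ε := r)).measurableSet.compl
  rw [Set.inter_compl_self, measure_empty, ENNReal.zero_div] at h1
  filter_upwards [measure_eq_zero_iff_ae_notMem.1 h1] with ω hω
  simpa using hω

lemma stuck_probability_le [IsProbabilityMeasure P] (hd : 0 < d) (hf : SmoothObjective f L ρ)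
    (hp : p.Tuned L ρ χ) (hr : 0 < p.radius) {X ξ : Ω → Vec d} (hX : Measurable X)
    (hξ : Measurable ξ) (hXξ : IndepFun X ξ P)
    (hu : pdf.IsUniform ξ (Metric.closedBall 0 p.radius) P volume) {M : ℕ}
    (hM : M * (13 * p.B * Real.exp (-(χ / 3))) ≤ p.radius / d) :
    (M : ENNReal) * P {ω | lambdaMin (hess f (X ω)) < -(p.θ ^ 2 / p.η) ∧
      ¬ EpochRestarts f p (X ω + ξ ω)} ≤ 3 := by
  refine measure_and_le_of_indepFun (R := fun x u => ¬ EpochRestarts f p (x + u))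
    (D := fun x => lambdaMin (hess f x) < -(p.θ ^ 2 / p.η)) hX hξ hXξ ?_ (by simp) fun x hx => ?_
  · exact (measurableSet_epochRestarts hf).compl.preimage (measurable_fst.add measurable_snd)
  · rw [hu]
    exact stuck_volume_le hd hf hp hr hx hM

/-- The probabilities of the events excluded in `achieves_second_order`. -/
lemma epoch_stuck_probability_le [IsProbabilityMeasure P] (hd : 0 < d)
    (hf : SmoothObjective f L ρ) (hp : p.Tuned L ρ χ) (hr : 0 < p.radius) {ξ : ℕ → Ω → Vec d}
    (hξ : ∀ n, Measurable (ξ n)) (hind : iIndepFun ξ P)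
    (hu : ∀ n, pdf.IsUniform (ξ n) (Metric.closedBall 0 p.radius) P volume) {M : ℕ}
    (hM : M * (13 * p.B * Real.exp (-(χ / 3))) ≤ p.radius / d) {m : ℕ}
    {Z : Ω → Vec d} {g : (Finset.range m → Vec d) → Vec d} (hg : Measurable g)
    (hZ : ∀ ω, Z ω = g fun i => ξ i ω) (n : ℕ) :
    (M : ENNReal) * P {ω | lambdaMin (hess f (epochEnd f p
        (epochStart f p (Z ω) (fun j => ξ (j + m) ω) n))) < -(p.θ ^ 2 / p.η) ∧
      ¬ EpochRestarts f p (epochEnd f p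
        (epochStart f p (Z ω) (fun j => ξ (j + m) ω) n) + ξ (n + m) ω)} ≤ 3 := by
  obtain ⟨G, hG, hGe⟩ := exists_epochStart_eq_comp (p := p) hf hg hZ n
  simp only [hGe]
  have hG' := (measurable_epochEnd (p := p) hf).comp hG
  have hlast : n + m ∈ ({n + m} : Finset ℕ) := Finset.mem_singleton_self _
  -- The end of the epoch depends on the perturbations with index below `n + m`, while the next one
  -- used has index `n + m`.
  have hi := (hind.indepFun_finset (Finset.range (n + m)) {n + m} (by simp) hξ).comp hG'
    (measurable_pi_apply (⟨n + m, hlast⟩ : ({n + m} : Finset ℕ)))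
  exact stuck_probability_le hd hf hp hr
    (hG'.comp (measurable_pi_lambda _ fun i => hξ i)) (hξ (n + m)) hi (hu (n + m)) hM

/-- The method started at a given point succeeds with high probability. -/
lemma probability_achieves [IsProbabilityMeasure P] (hd : 0 < d)
    (hf : SmoothObjective f L ρ) (hp : p.Tuned L ρ χ) (hr : 0 < p.radius) {ξ : ℕ → Ω → Vec d}
    (hξ : ∀ n, Measurable (ξ n)) (hind : iIndepFun ξ P)
    (hu : ∀ n, pdf.IsUniform (ξ n) (Metric.closedBall 0 p.radius) P volume) {M k : ℕ} {b ζ : ℝ}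
    (hζ : 0 ≤ ζ) (hM0 : 0 < M) (hM : M * (13 * p.B * Real.exp (-(χ / 3))) ≤ p.radius / d)
    (hkM : 3 * (k : ℝ) ≤ ζ * M) (x₀ : Vec d)
    (hk : 16 * gap f x₀ ≤ k * (p.θ * p.B ^ 2 / (p.η * p.K)))
    (hb : ((k : ℝ) + 1) * (3 / 2 * p.K) ≤ b)
    (h_first : EpochRestarts f p x₀ ∨ -(p.θ ^ 2 / p.η) ≤ lambdaMin (hess f x₀)) :
    ENNReal.ofReal (1 - ζ) ≤ P {ω | Achieves f p x₀ (fun n => ξ n ω) b fun yhat =>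
      ‖gradient f yhat‖ ≤ 288 * χ ^ 2 * p.B * p.θ ^ 2 / p.η ∧
      -(1.011 * (p.θ ^ 2 / p.η)) ≤ lambdaMin (hess f yhat)} := by
  refine ofReal_one_sub_le_measure hζ hM0 hkM (fun i _ =>
    epoch_stuck_probability_le hd hf hp hr hξ hind hu hM (m := 0) (Z := fun _ => x₀)
      (g := fun _ => x₀) measurable_const (fun _ => rfl) i) ?_
  filter_upwards [ae_all_iff.2 fun n => ae_norm_le_of_isUniform hr (hu n)] with ω hω hgood
  refine achieves_second_order hd hf hp hω hk hb (fun h => ⟨x₀, ?_, h_first.resolve_left h⟩) hgood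
  simpa using hr.le

variable (f p) in
/-- The points that are perturbed when the perturbation rule is applied to the initial point as
well. -/
noncomputable def perturbedPoint (x₀ : Vec d) (ξ : ℕ → Vec d) : ℕ → Vec d
  | 0 => x₀
  | n + 1 => epochEnd f p (epochStart f p (perturb f p x₀ x₀ (ξ 0)) (fun j => ξ (j + 1)) n)

lemma perturbedPoint_stuck_probability_le [IsProbabilityMeasure P] (hd : 0 < d)
    (hf : SmoothObjective f L ρ) (hp : p.Tuned L ρ χ) (hr : 0 < p.radius) {ξ : ℕ → Ω → Vec d}
    (hξ : ∀ n, Measurable (ξ n)) (hind : iIndepFun ξ P)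
    (hu : ∀ n, pdf.IsUniform (ξ n) (Metric.closedBall 0 p.radius) P volume) {M : ℕ}
    (hM : M * (13 * p.B * Real.exp (-(χ / 3))) ≤ p.radius / d) (x₀ : Vec d) (i : ℕ) :
    (M : ENNReal) * P {ω | lambdaMin (hess f (perturbedPoint f p x₀ (fun n => ξ n ω) i))
        < -(p.θ ^ 2 / p.η) ∧
      ¬ EpochRestarts f p (perturbedPoint f p x₀ (fun n => ξ n ω) i + ξ i ω)} ≤ 3 := by
  rcases i with _ | n
  · exact stuck_probability_le hd hf hp hr (X := fun _ => x₀) measurable_const (hξ 0)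
      (indepFun_const_left _ _) (hu 0) hM
  · have h0 : 0 ∈ Finset.range 1 := by simp
    have hgm : Measurable fun t : Finset.range 1 → Vec d => perturb f p x₀ x₀ (t ⟨0, h0⟩) :=
      measurable_perturb hf measurable_const measurable_const (measurable_pi_apply _)
    exact epoch_stuck_probability_le hd hf hp hr hξ hind hu hM (m := 1)
      (Z := fun ω => perturb f p x₀ x₀ (ξ 0 ω)) hgm (fun _ => rfl) n

/-- The method with the perturbation rule applied to the initial point as well succeeds with high
probability. -/
lemma probability_achieves_perturbed [IsProbabilityMeasure P] (hd : 0 < d)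
    (hf : SmoothObjective f L ρ) (hp : p.Tuned L ρ χ) (hr : 0 < p.radius) {ξ : ℕ → Ω → Vec d}
    (hξ : ∀ n, Measurable (ξ n)) (hind : iIndepFun ξ P)
    (hu : ∀ n, pdf.IsUniform (ξ n) (Metric.closedBall 0 p.radius) P volume) {M k : ℕ} {b ζ : ℝ}
    (hζ : 0 ≤ ζ) (hM0 : 0 < M) (hM : M * (13 * p.B * Real.exp (-(χ / 3))) ≤ p.radius / d)
    (hkM : 3 * ((k + 1 : ℕ) : ℝ) ≤ ζ * M) (x₀ : Vec d)
    (hk : 16 * gap f x₀ + 2 * (p.θ * p.B ^ 2 / (p.η * p.K))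
      ≤ k * (p.θ * p.B ^ 2 / (p.η * p.K)))
    (hb : ((k : ℝ) + 1) * (3 / 2 * p.K) ≤ b) :
    ENNReal.ofReal (1 - ζ) ≤ P {ω | Achieves f p (perturb f p x₀ x₀ (ξ 0 ω))
      (fun n => ξ (n + 1) ω) b fun yhat =>
      ‖gradient f yhat‖ ≤ 288 * χ ^ 2 * p.B * p.θ ^ 2 / p.η ∧
      -(1.011 * (p.θ ^ 2 / p.η)) ≤ lambdaMin (hess f yhat)} := by
  have hU := hp.unit_pos
  have hBη : 0 < p.B / p.η := div_pos hp.B_pos hp.η_pos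
  refine ofReal_one_sub_le_measure hζ hM0 hkM
    (fun i _ => perturbedPoint_stuck_probability_le hd hf hp hr hξ hind hu hM x₀ i) ?_
  filter_upwards [ae_all_iff.2 fun n => ae_norm_le_of_isUniform hr (hu n)] with ω hω hgood
  have hgood0 := hgood 0 (by omega)
  refine achieves_second_order hd hf hp (fun n => hω (n + 1)) ?_ hb (fun h => ?_)
    (fun n hn => hgood (n + 1) (by omega))
  -- The initial perturbation raises the gap by at most `1/8` of the unit; times `16` this is the
  -- summand `2` in `hk`.
  · refine le_trans ?_ hk
    have h1 : f (perturb f p x₀ x₀ (ξ 0 ω))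
        ≤ f x₀ + 1 / 8 * (p.θ * p.B ^ 2 / (p.η * p.K)) := by
      rw [perturb]
      split_ifs with hs
      · exact perturbation_le hf hp (by linarith) (hω 0)
      · linarith
    rw [gap, gap]
    linarith
  · rw [perturb] at h ⊢
    split_ifs at h ⊢ with hs
    · refine ⟨x₀, by simpa using hω 0, ?_⟩
      by_contra! hlt
      exact hgood0 ⟨hlt, h⟩
    · exact absurd (epochRestarts_of_large_gradient hp (by linarith)) h

end Probability

/-! ### Parameter arithmetic and constants. -/

section Parameters

lemma pow_rpow_eq_pow {x : ℝ} (hx : 0 ≤ x) {n m : ℕ} {q : ℝ} (h : n * q = m) :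
    (x ^ n) ^ q = x ^ m := by
  rw [← Real.rpow_natCast x n, ← Real.rpow_mul hx, h, Real.rpow_natCast]

lemma exists_root {x : ℝ} (hx : 0 < x) {n : ℕ} (hn : n ≠ 0) : ∃ y : ℝ, 0 < y ∧ x = y ^ n :=
  ⟨x ^ (1 / n : ℝ), by positivity, by
    rw [one_div, Real.rpow_inv_natCast_pow hx.le hn]⟩

variable {a b g χ : ℝ}

/-! With `L = a²`, `ρ = b⁴` and `ε = g⁴` the parameters are rational functions of the roots. -/

lemma params_θ (ha : 0 < a) (hb : 0 < b) (hg : 0 < g) :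
    (params (a ^ 2) (b ^ 4) (g ^ 4) χ).θ = g * b / (2 * a) := by
  have h : g ^ 4 * b ^ 4 / (a ^ 2) ^ 2 = (g * b / a) ^ 4 := by rw [div_pow, mul_pow]; ring
  rw [params, h, pow_rpow_eq_pow (m := 1) (by positivity) (by norm_num)]
  field_simp

lemma params_B (hb : 0 < b) (hg : 0 < g) :
    (params (a ^ 2) (b ^ 4) (g ^ 4) χ).B = g ^ 2 / (288 * χ ^ 2 * b ^ 2) := by
  have h : g ^ 4 / b ^ 4 = (g ^ 2 / b ^ 2) ^ 2 := by rw [div_pow]; ring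
  rw [params, h, Real.sqrt_sq (by positivity)]
  field_simp

lemma params_K_eq_div (L ρ ε χ : ℝ) : (params L ρ ε χ).K = 2 * χ / (params L ρ ε χ).θ := rfl

lemma params_tuned (ha : 0 < a) (hb : 0 < b) (hg : 0 < g) (hχ : 1 ≤ χ)
    (hθ : (params (a ^ 2) (b ^ 4) (g ^ 4) χ).θ < 1) :
    (params (a ^ 2) (b ^ 4) (g ^ 4) χ).Tuned (a ^ 2) (b ^ 4) χ where
  L_pos := by positivity
  ρ_pos := by positivity
  one_le := hχ
  η_eq := rfl
  θ_pos := by rw [params_θ ha hb hg]; positivity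
  θ_lt := hθ
  B_pos := by rw [params_B hb hg]; positivity
  K_eq := rfl
  B_eq := by
    rw [params_θ ha hb hg, params_B hb hg]
    simp only [params]
    field_simp
    norm_num

lemma params_sqrt (ha : 0 < a) (hb : 0 < b) (hg : 0 < g) :
    (params (a ^ 2) (b ^ 4) (g ^ 4) χ).θ ^ 2 / (params (a ^ 2) (b ^ 4) (g ^ 4) χ).η
      = √(g ^ 4 * b ^ 4) := by
  have h : g ^ 4 * b ^ 4 = (g ^ 2 * b ^ 2) ^ 2 := by ring
  rw [h, Real.sqrt_sq (by positivity), params_θ ha hb hg]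
  simp only [params]
  field_simp
  norm_num

lemma params_ε (ha : 0 < a) (hb : 0 < b) (hg : 0 < g) (hχ : 1 ≤ χ) :
    288 * χ ^ 2 * (params (a ^ 2) (b ^ 4) (g ^ 4) χ).B * (params (a ^ 2) (b ^ 4) (g ^ 4) χ).θ ^ 2
      / (params (a ^ 2) (b ^ 4) (g ^ 4) χ).η = g ^ 4 := by
  rw [params_θ ha hb hg, params_B hb hg]
  simp only [params]
  field_simp
  norm_num

/-- For `θ < 1 ≤ χ` the middle entry of the minimum is always the smallest. -/
lemma Params.Tuned.radius_eq {p : Params} {L ρ : ℝ} (hp : p.Tuned L ρ χ) :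
    p.radius = p.θ ^ 2 * p.B / (40 * χ) := by
  have hθ := hp.θ_pos
  have hθ1 := hp.θ_lt
  have hB := hp.B_pos
  have hχ := hp.one_le
  have hχ0 := hp.χ_pos
  have e : p.θ * p.B / (20 * p.K) = p.θ ^ 2 * p.B / (40 * χ) := by
    rw [hp.K_eq]; field_simp; norm_num
  have h1 : p.θ ^ 2 ≤ 1 := by nlinarith
  have h2 : p.θ ^ 2 * p.B / (40 * χ) ≤ p.B / 2 := by
    rw [div_le_div_iff₀ (by positivity) (by norm_num)]
    nlinarith
  have h3 : p.θ ^ 2 * p.B / (40 * χ) ≤ √(p.θ * p.B ^ 2 / (2 * p.K)) := by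
    apply Real.le_sqrt_of_sq_le
    have e2 : p.θ * p.B ^ 2 / (2 * p.K) = p.θ ^ 2 * p.B ^ 2 / (4 * χ) := by
      rw [hp.K_eq]; field_simp; norm_num
    rw [e2, div_pow, div_le_div_iff₀ (by positivity) (by positivity)]
    have e3 : (p.θ ^ 2 * p.B) ^ 2 * (4 * χ) = (p.θ ^ 2 * p.B ^ 2) * (4 * (p.θ ^ 2 * χ)) := by ring
    rw [e3]
    gcongr
    nlinarith
  rw [Params.radius, e, min_eq_left h3, min_eq_right h2]

/-- The unit is of order `ε^{3/2}/(√ρ χ⁵)`. With the factor `χ` in the epoch length `K`, this is the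
source of `χ⁶` in the evaluation bound. -/
lemma params_unit (ha : 0 < a) (hb : 0 < b) (hg : 0 < g) (hχ : 1 ≤ χ) :
    (params (a ^ 2) (b ^ 4) (g ^ 4) χ).θ * (params (a ^ 2) (b ^ 4) (g ^ 4) χ).B ^ 2
      / ((params (a ^ 2) (b ^ 4) (g ^ 4) χ).η * (params (a ^ 2) (b ^ 4) (g ^ 4) χ).K)
      = g ^ 6 / (2 * 288 ^ 2 * χ ^ 5 * b ^ 2) := by
  rw [params_K_eq_div, params_θ ha hb hg, params_B hb hg]
  simp only [params]
  field_simp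
  norm_num

lemma evalBound_eq (ha : 0 < a) (hb : 0 < b) (hg : 0 < g) (Δ : ℝ) :
    evalBound (a ^ 2) (b ^ 4) (g ^ 4) χ Δ
      = Δ * a * b * χ ^ 6 / g ^ 7 + a * χ / (g * b) := by
  rw [evalBound, ← mul_pow, pow_rpow_eq_pow (m := 1) ha.le (by norm_num),
    pow_rpow_eq_pow (m := 1) hb.le (by norm_num), pow_rpow_eq_pow (m := 7) hg.le (by norm_num),
    pow_rpow_eq_pow (m := 1) (by positivity) (by norm_num)]
  simp only [pow_one]

lemma logFactor_eq (hb : 0 < b) (hg : 0 < g) (d : ℕ) (ζ Δ : ℝ) :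
    logFactor d (a ^ 2) (b ^ 4) (g ^ 4) ζ Δ
      = max 1 (Real.log (d * a ^ 2 * (1 + Δ * b ^ 2 / g ^ 6) / (ζ * (g ^ 2 * b ^ 2)))) := by
  have h : g ^ 4 * b ^ 4 = (g ^ 2 * b ^ 2) ^ 2 := by ring
  have h2 : b ^ 4 = (b ^ 2) ^ 2 := by ring
  rw [logFactor, h, Real.sqrt_sq (by positivity), h2, Real.sqrt_sq (by positivity),
    pow_rpow_eq_pow (m := 6) hg.le (by norm_num)]

/-- The number of epochs that the analysis allows for. -/
noncomputable def epochBudget (p : Params) (Δ : ℝ) : ℕ :=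
  ⌈16 * Δ / (p.θ * p.B ^ 2 / (p.η * p.K))⌉₊ + 2

/-- The `2` in `epochBudget` pays for the rise due to a perturbation of the initial point. -/
lemma le_epochBudget_mul {p : Params} {L ρ : ℝ} (hp : p.Tuned L ρ χ) (Δ : ℝ) :
    16 * Δ + 2 * (p.θ * p.B ^ 2 / (p.η * p.K))
      ≤ epochBudget p Δ * (p.θ * p.B ^ 2 / (p.η * p.K)) := by
  have hU := hp.unit_pos
  have h := Nat.le_ceil (16 * Δ / (p.θ * p.B ^ 2 / (p.η * p.K)))
  rw [div_le_iff₀ hU] at h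
  rw [epochBudget]
  push_cast
  linarith

lemma epochBudget_le {p : Params} {L ρ : ℝ} (hp : p.Tuned L ρ χ) {Δ : ℝ} (hΔ : 0 ≤ Δ) :
    (epochBudget p Δ : ℝ) ≤ 16 * Δ / (p.θ * p.B ^ 2 / (p.η * p.K)) + 3 := by
  have hU := hp.unit_pos
  have h := Nat.ceil_lt_add_one (show 0 ≤ 16 * Δ / (p.θ * p.B ^ 2 / (p.η * p.K)) by positivity)
  rw [epochBudget]
  push_cast
  linarith

/-- As `3K/2 = 6aχ/(gb)`, the coefficients are `16 · 2 · 288² · 6 = 15925248` and `4 · 6 = 24`;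
hence the constant `16000000`. -/
lemma epochBudget_mul_le_evalBound (ha : 0 < a) (hb : 0 < b) (hg : 0 < g) (hχ : 1 ≤ χ)
    (hθ : (params (a ^ 2) (b ^ 4) (g ^ 4) χ).θ < 1) {Δ : ℝ} (hΔ : 0 ≤ Δ) :
    ((epochBudget (params (a ^ 2) (b ^ 4) (g ^ 4) χ) Δ : ℝ) + 1)
        * (3 / 2 * (params (a ^ 2) (b ^ 4) (g ^ 4) χ).K)
      ≤ 16000000 * evalBound (a ^ 2) (b ^ 4) (g ^ 4) χ Δ := by
  have hp := params_tuned ha hb hg hχ hθ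
  have h := epochBudget_le hp hΔ
  have hχ0 := hp.χ_pos
  have hK := hp.K_pos
  rw [params_unit ha hb hg hχ] at h
  rw [evalBound_eq ha hb hg]
  have e : (16 * Δ / (g ^ 6 / (2 * 288 ^ 2 * χ ^ 5 * b ^ 2)) + 3 + 1)
      * (3 / 2 * (params (a ^ 2) (b ^ 4) (g ^ 4) χ).K)
      = 15925248 * (Δ * a * b * χ ^ 6 / g ^ 7) + 24 * (a * χ / (g * b)) := by
    rw [params_K_eq_div, params_θ ha hb hg]
    field_simp
    ring
  have h1 : 0 ≤ Δ * a * b * χ ^ 6 / g ^ 7 := by positivity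
  have h2 : 0 ≤ a * χ / (g * b) := by positivity
  calc _ ≤ (16 * Δ / (g ^ 6 / (2 * 288 ^ 2 * χ ^ 5 * b ^ 2)) + 3 + 1)
      * (3 / 2 * (params (a ^ 2) (b ^ 4) (g ^ 4) χ).K) := by gcongr
    _ ≤ _ := by rw [e]; linarith

lemma radius_le (ha : 0 < a) (hb : 0 < b) (hg : 0 < g) (hχ : 1 ≤ χ)
    (hθ : (params (a ^ 2) (b ^ 4) (g ^ 4) χ).θ < 1) :
    (params (a ^ 2) (b ^ 4) (g ^ 4) χ).radius ≤ 16000000 * g ^ 4 / a ^ 2 := by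
  have hp := params_tuned ha hb hg hχ hθ
  have hχ0 := hp.χ_pos
  rw [hp.radius_eq, params_θ ha hb hg, params_B hb hg]
  have e : (g * b / (2 * a)) ^ 2 * (g ^ 2 / (288 * χ ^ 2 * b ^ 2)) / (40 * χ)
      = g ^ 4 / a ^ 2 * (1 / 46080) / χ ^ 3 := by field_simp; norm_num
  have e2 : 16000000 * g ^ 4 / a ^ 2 = g ^ 4 / a ^ 2 * 16000000 := by ring
  rw [e, e2]
  refine (div_le_self (by positivity) (one_le_pow₀ hχ)).trans ?_
  gcongr
  norm_num

/-- Past some threshold, `exp (χ / 6)` dominates a multiple of `χ ^ 6`. -/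
lemma exists_threshold (A : ℝ) : ∃ c : ℝ, 6 ≤ c ∧ ∀ χ, c ≤ χ → A * χ ^ 6 ≤ Real.exp (χ / 6) := by
  have h := (isLittleO_pow_exp_pos_mul_atTop 6 (show (0 : ℝ) < 1 / 6 by norm_num)).const_mul_left A
  have h2 := h.bound (show (0 : ℝ) < 1 by norm_num)
  obtain ⟨c, hc⟩ := Filter.eventually_atTop.1 h2
  refine ⟨max 6 c, le_max_left _ _, fun χ hχ => ?_⟩
  have h3 := hc χ ((le_max_right _ _).trans hχ)
  rw [Real.norm_eq_abs, Real.norm_eq_abs, one_mul, abs_of_pos (Real.exp_pos _)] at h3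
  refine (le_abs_self _).trans (h3.trans_eq ?_)
  congr 1; ring

/-- For `χ` of the order of the logarithmic factor, the perturbations succeed in all epochs with
the required probability. -/
lemma exists_translates (ha : 0 < a) (hb : 0 < b) (hg : 0 < g) (hχ : 1 ≤ χ)
    (hθ : (params (a ^ 2) (b ^ 4) (g ^ 4) χ).θ < 1) {d : ℕ} (hd : 0 < d) {ζ Δ c : ℝ} (hζ : 0 < ζ)
    (hζ1 : ζ < 1) (hΔ : 0 ≤ Δ) (hc6 : 6 ≤ c)
    (hc : ∀ χ, c ≤ χ → 8320 * 2700000 * χ ^ 6 ≤ Real.exp (χ / 6))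
    (hχc : c * logFactor d (a ^ 2) (b ^ 4) (g ^ 4) ζ Δ ≤ χ) :
    ∃ M : ℕ, 0 < M ∧
      3 * ((epochBudget (params (a ^ 2) (b ^ 4) (g ^ 4) χ) Δ + 1 : ℕ) : ℝ) ≤ ζ * M ∧
      M * (13 * (params (a ^ 2) (b ^ 4) (g ^ 4) χ).B * Real.exp (-(χ / 3)))
        ≤ (params (a ^ 2) (b ^ 4) (g ^ 4) χ).radius / d := by
  have hp := params_tuned ha hb hg hχ hθ
  have hχ0 := hp.χ_pos
  have hB := hp.B_pos
  have hd' : (0 : ℝ) < d := by exact_mod_cast hd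
  set N := epochBudget (params (a ^ 2) (b ^ 4) (g ^ 4) χ) Δ with hN
  set S := 1 + Δ * b ^ 2 / g ^ 6 with hS
  have hS1 : 1 ≤ S := by
    have : 0 ≤ Δ * b ^ 2 / g ^ 6 := by positivity
    linarith
  have hNle : (N : ℝ) + 1 ≤ 2700000 * χ ^ 5 * S := by
    have h := epochBudget_le hp hΔ
    rw [params_unit ha hb hg hχ] at h
    have e : 16 * Δ / (g ^ 6 / (2 * 288 ^ 2 * χ ^ 5 * b ^ 2))
        = 2654208 * χ ^ 5 * (Δ * b ^ 2 / g ^ 6) := by field_simp; ring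
    rw [e] at h
    have h5 : 1 ≤ χ ^ 5 := one_le_pow₀ hχ
    have h6 : 0 ≤ Δ * b ^ 2 / g ^ 6 := by positivity
    have h7 : 0 ≤ χ ^ 5 * (Δ * b ^ 2 / g ^ 6) := by positivity
    rw [hS]
    nlinarith
  set X := d * a ^ 2 * S / (ζ * (g ^ 2 * b ^ 2)) with hX
  have hX0 : 0 < X := by positivity
  have hlog : logFactor d (a ^ 2) (b ^ 4) (g ^ 4) ζ Δ = max 1 (Real.log X) :=
    logFactor_eq hb hg d ζ Δ
  rw [hlog] at hχc
  have hcχ : c ≤ χ := le_trans (le_mul_of_one_le_right (by linarith) (le_max_left _ _)) hχc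
  -- Half of `exp (χ/3)` dominates the argument `X` of the logarithm, because `c ≥ 6`; the other
  -- half dominates the powers of `χ`.
  have hXexp : X ≤ Real.exp (χ / 6) := by
    rw [← Real.log_le_iff_le_exp hX0]
    have h1 : 6 * max 1 (Real.log X) ≤ c * max 1 (Real.log X) := by gcongr
    have h2 := le_max_right 1 (Real.log X)
    linarith
  have hexp : 8320 * 2700000 * χ ^ 6 * X ≤ Real.exp (χ / 3) := by
    have e : Real.exp (χ / 3) = Real.exp (χ / 6) * Real.exp (χ / 6) := by
      rw [← Real.exp_add]; congr 1; ring
    rw [e]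
    exact mul_le_mul (hc χ hcχ) hXexp hX0.le (Real.exp_pos _).le
  have hN0 : (0 : ℝ) ≤ N := Nat.cast_nonneg _
  -- The least `M` allowed by the union bound over `N + 1` perturbations.
  refine ⟨⌈3 * ((N : ℝ) + 1) / ζ⌉₊, Nat.ceil_pos.2 (by positivity), ?_, ?_⟩
  · have h := Nat.le_ceil (3 * ((N : ℝ) + 1) / ζ)
    rw [div_le_iff₀ hζ] at h
    push_cast
    linarith
  · have hM : (⌈3 * ((N : ℝ) + 1) / ζ⌉₊ : ℝ) ≤ 4 * ((N : ℝ) + 1) / ζ := by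
      have h := Nat.ceil_lt_add_one (show 0 ≤ 3 * ((N : ℝ) + 1) / ζ by positivity)
      have h2 : 1 ≤ ((N : ℝ) + 1) / ζ := by
        rw [le_div_iff₀ hζ]; linarith
      have e : 4 * ((N : ℝ) + 1) / ζ = 3 * ((N : ℝ) + 1) / ζ + ((N : ℝ) + 1) / ζ := by ring
      linarith
    have hM2 : (⌈3 * ((N : ℝ) + 1) / ζ⌉₊ : ℝ) ≤ 4 * (2700000 * χ ^ 5 * S) / ζ :=
      hM.trans (by gcongr)
    rw [hp.radius_eq, Real.exp_neg, params_θ ha hb hg]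
    calc (⌈3 * ((N : ℝ) + 1) / ζ⌉₊ : ℝ) * (13 * (params (a ^ 2) (b ^ 4) (g ^ 4) χ).B
          * (Real.exp (χ / 3))⁻¹)
        ≤ 4 * (2700000 * χ ^ 5 * S) / ζ * (13 * (params (a ^ 2) (b ^ 4) (g ^ 4) χ).B
          * (8320 * 2700000 * χ ^ 6 * X)⁻¹) := by gcongr
      -- `8320 = 4 · 13 · 4 · 40`: the rounding of `M`, the chord length, the `4` in `θ²` and the
      -- `40` in the radius.
      _ = (g * b / (2 * a)) ^ 2 * (params (a ^ 2) (b ^ 4) (g ^ 4) χ).B / (40 * χ) / d := by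
          rw [hX]
          field_simp
          norm_num

end Parameters

/-- The condition `θ < 1` bounds `ε` in terms of `L` and `ρ`, so the argument of the logarithm is at
most a constant times `(d/(ζε))²`. The exponent gives the `2` in the constant, and `|log A|` is
absorbed because the maximum is at least `1`. -/
lemma logFactor_le {L ρ Δmax : ℝ} (hL : 0 < L) (hρ : 0 < ρ) :
    ∃ c' : ℝ, ∀ (d : ℕ) (ε ζ Δ χ : ℝ),
      0 < d → 0 < ε → 0 < ζ → ζ < 1 → 0 ≤ Δ → Δ ≤ Δmax → (params L ρ ε χ).θ < 1 →
      logFactor d L ρ ε ζ Δ ≤ c' * max 1 (Real.log (d / (ζ * ε))) := by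
  obtain ⟨a, ha, rfl⟩ := exists_root hL (n := 2) (by norm_num)
  obtain ⟨b, hb, rfl⟩ := exists_root hρ (n := 4) (by norm_num)
  set A := a ^ 2 * ((2 * a / b) ^ 6 + Δmax * b ^ 2) / b ^ 2 with hA
  refine ⟨|Real.log A| + 2, fun d ε ζ Δ χ hd hε hζ hζ1 hΔ hΔm hθ => ?_⟩
  obtain ⟨g, hg, rfl⟩ := exists_root hε (n := 4) (by norm_num)
  have hd' : (1 : ℝ) ≤ d := by exact_mod_cast hd
  have hΔ0 : 0 ≤ Δmax := hΔ.trans hΔm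
  have hA0 : 0 < A := by positivity
  rw [params_θ ha hb hg, div_lt_one (by positivity)] at hθ
  have hga : g ≤ 2 * a / b := by rw [le_div_iff₀ hb]; exact hθ.le
  rw [logFactor_eq hb hg]
  set m := max 1 (Real.log (d / (ζ * g ^ 4))) with hm
  have hm1 : 1 ≤ m := le_max_left _ _
  have hm2 : Real.log (d / (ζ * g ^ 4)) ≤ m := le_max_right _ _
  have hAabs := abs_nonneg (Real.log A)
  refine max_le (by nlinarith) ?_
  have h1 : d * a ^ 2 * (1 + Δ * b ^ 2 / g ^ 6) / (ζ * (g ^ 2 * b ^ 2))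
      ≤ A * (d / (ζ * g ^ 4)) ^ 2 := by
    have h2 : 1 + Δ * b ^ 2 / g ^ 6 ≤ ((2 * a / b) ^ 6 + Δmax * b ^ 2) / g ^ 6 := by
      rw [add_div]
      gcongr
      rw [one_le_div (by positivity)]
      gcongr
    have h3 : (d : ℝ) / ζ ≤ (d / ζ) ^ 2 := by
      have : 1 ≤ d / ζ := by rw [le_div_iff₀ hζ]; linarith
      nlinarith
    calc d * a ^ 2 * (1 + Δ * b ^ 2 / g ^ 6) / (ζ * (g ^ 2 * b ^ 2))
        ≤ d * a ^ 2 * (((2 * a / b) ^ 6 + Δmax * b ^ 2) / g ^ 6) / (ζ * (g ^ 2 * b ^ 2)) := by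
          gcongr
      _ = A / g ^ 8 * (d / ζ) := by rw [hA]; field_simp
      _ ≤ A / g ^ 8 * (d / ζ) ^ 2 := by gcongr
      _ = A * (d / (ζ * g ^ 4)) ^ 2 := by field_simp
  have hX0 : (0 : ℝ) < d * a ^ 2 * (1 + Δ * b ^ 2 / g ^ 6) / (ζ * (g ^ 2 * b ^ 2)) := by
    have : (0 : ℝ) < d := by linarith
    positivity
  have hY0 : (0 : ℝ) < d / (ζ * g ^ 4) := by
    have : (0 : ℝ) < d := by linarith
    positivity
  have h4 := Real.log_le_log hX0 h1
  rw [Real.log_mul hA0.ne' (by positivity), Real.log_pow] at h4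
  push_cast at h4
  have h5 := le_abs_self (Real.log A)
  nlinarith

/-! ### Assembly of the main theorem. -/

theorem theorem3 :
    ∃ c C : ℝ, 0 < c ∧ 0 < C ∧
      -- for fixed `L`, `ρ` and bounded `Δ`, the logarithmic factor is `O(log (d / (ζ ε)))`
      (∀ L ρ Δmax : ℝ, 0 < L → 0 < ρ → ∃ c' : ℝ, ∀ (d : ℕ) (ε ζ Δ χ : ℝ),
        0 < d → 0 < ε → 0 < ζ → ζ < 1 → 0 ≤ Δ → Δ ≤ Δmax → (params L ρ ε χ).θ < 1 →
        logFactor d L ρ ε ζ Δ ≤ c' * max 1 (Real.log (d / (ζ * ε)))) ∧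
      ∀ (d : ℕ) (f : Vec d → ℝ) (L ρ ε χ : ℝ) (x_int : Vec d),
        0 < d → 0 < L → 0 < ρ → 0 < ε → 1 ≤ χ → SmoothObjective f L ρ →
        (params L ρ ε χ).θ < 1 →
        (params L ρ ε χ).radius ≤ C * ε / L ∧
        -- termination and first-order stationarity, for all perturbations in the ball
        (∀ ξ : ℕ → Vec d, (∀ n, ‖ξ n‖ ≤ (params L ρ ε χ).radius) →
          Achieves f (params L ρ ε χ) x_int ξ (C * evalBound L ρ ε χ (gap f x_int))
            (fun yhat => ‖gradient f yhat‖ ≤ ε)) ∧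
        -- second-order stationarity with probability at least `1 - ζ`
        ∀ (ζ : ℝ) (Ω : Type*) (_ : MeasurableSpace Ω) (P : Measure Ω) (ξ : ℕ → Ω → Vec d),
          0 < ζ → ζ < 1 → c * logFactor d L ρ ε ζ (gap f x_int) ≤ χ →
          IsProbabilityMeasure P → (∀ n, Measurable (ξ n)) → iIndepFun ξ P →
          (∀ n, pdf.IsUniform (ξ n) (Metric.closedBall 0 (params L ρ ε χ).radius) P volume) →
          -- the method as it stands, started at `x_int`
          ((EpochRestarts f (params L ρ ε χ) x_int ∨ -√(ε * ρ) ≤ lambdaMin (hess f x_int)) →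
            ENNReal.ofReal (1 - ζ) ≤
              P {ω | Achieves f (params L ρ ε χ) x_int (fun n => ξ n ω)
                (C * evalBound L ρ ε χ (gap f x_int))
                (fun yhat => ‖gradient f yhat‖ ≤ ε ∧
                  -(1.011 * √(ε * ρ)) ≤ lambdaMin (hess f yhat))}) ∧
          -- the method with the perturbation rule applied to the initial point as well
          ENNReal.ofReal (1 - ζ) ≤
            P {ω | Achieves f (params L ρ ε χ) (perturb f (params L ρ ε χ) x_int x_int (ξ 0 ω))
              (fun n => ξ (n + 1) ω)
              (C * evalBound L ρ ε χ (gap f x_int))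
              (fun yhat => ‖gradient f yhat‖ ≤ ε ∧
                -(1.011 * √(ε * ρ)) ≤ lambdaMin (hess f yhat))} := by
  obtain ⟨c, hc6, hc⟩ := exists_threshold (8320 * 2700000)
  refine ⟨c, 16000000, by linarith, by norm_num, fun L ρ Δmax hL hρ => logFactor_le hL hρ,
    fun d f L ρ ε χ x_int hd hL hρ hε hχ hf hθ => ?_⟩
  obtain ⟨a, ha, rfl⟩ := exists_root hL (n := 2) (by norm_num)
  obtain ⟨b, hb, rfl⟩ := exists_root hρ (n := 4) (by norm_num)
  obtain ⟨g, hg, rfl⟩ := exists_root hε (n := 4) (by norm_num)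
  have hp := params_tuned ha hb hg hχ hθ
  have hgap := gap_nonneg hf x_int
  have hbudget := epochBudget_mul_le_evalBound ha hb hg hχ hθ hgap
  have hk := le_epochBudget_mul hp (gap f x_int)
  have hs := params_sqrt (χ := χ) ha hb hg
  have hεeq := params_ε ha hb hg hχ
  have hU := hp.unit_pos
  refine ⟨radius_le ha hb hg hχ hθ, fun ξ hξ => ?_, fun ζ Ω _ P ξ hζ hζ1 hχc hP hξm hind hu => ?_⟩
  · obtain ⟨N, hNU, hres, hN⟩ := exists_last_epoch hf hp x_int hξ
    have hNk : (N : ℝ) ≤ epochBudget (params (a ^ 2) (b ^ 4) (g ^ 4) χ) (gap f x_int) :=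
      le_of_mul_le_mul_right (by linarith) hU
    have hK := hp.K_pos
    refine achieves_of_last_epoch hp hres hN (le_trans (by gcongr) hbudget) fun y hy => ?_
    rw [← hεeq]
    exact isOutput_norm_gradient_le hf hp (not_triggers_of_not_epochRestarts hN) hy
  · obtain ⟨M, hM0, hkM, hM⟩ := exists_translates ha hb hg hχ hθ hd hζ hζ1 hgap hc6 hc hχc
    have hr : 0 < (params (a ^ 2) (b ^ 4) (g ^ 4) χ).radius := by
      have := hp.θ_pos; have := hp.B_pos; have := hp.χ_pos
      rw [hp.radius_eq]; positivity
    constructor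
    · intro h_first
      rw [← hs] at h_first
      -- The budget is tailored to the perturbed start; here one stuck event fewer is to be excluded
      -- and the two spare units are not needed.
      have h := probability_achieves hd hf hp hr hξm hind hu hζ.le hM0 hM
        (le_trans (by push_cast; linarith) hkM) x_int (by linarith) hbudget h_first
      rwa [hs, hεeq] at h
    · have h := probability_achieves_perturbed hd hf hp hr hξm hind hu hζ.le hM0 hM hkM x_int hk
        hbudget
      rwa [hs, hεeq] at h
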